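/- **Theorem 3.1.** Let $n\ge 3$, $E>0$, $\delta>1$, $\beta>1$, $r_0,C_1,C_2>0$, and let $V\in L^\infty(\mathbb R^n)$ be real-valued, $V=V_L+V_S$ with $V_L$, $V_S$ real-valued, $V_S$ measurable and $|V_S(x)|\le C_1(|x|+1)^{-\delta}$ for almost every $x$. Assume that for every $w\in\mathbb S^{n-1}$ the function $r\mapsto V_L(rw)$ is $C^1$ on $[r_0,\infty)$, that $V_L(x)\le p(|x|)$ for $|x|\ge r_0$, where $p>0$ is a non-increasing function on $[r_0,\infty)$ with $p(r)\to 0$ as $r\to\infty$, and that $\partial_rV_L(x)\le C_2(|x|+1)^{-\beta}$ for $|x|\ge r_0$. For $0<h<1$ put $P(h)=-h^2\Delta+V$, $\epsilon=(\log\frac1h)^{-1}$, $s=\frac{1+\epsilon}2$, and for parameters $t>1$, $\tau_0>0$ put $a=h^{-m}$, $\tau=\tau_0h^{-1/3}$, where $$(m,k)=\begin{cases}\left(m_0+3\epsilon m_0t,\;1-\epsilon t\right)&\text{if }\delta>3,\ \beta\ge3,\\ \left(m_1+6\epsilon m_1^2t,\;\frac{2}{3m_1}-\epsilon t\right)&\text{if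 }\delta\le3,\\ \left(m_2+\frac{6\epsilon m_2t}{\beta-1},\;\frac{\beta-1}2-\epsilon t\right)&\text{if }\delta>3,\ \beta<3,\end{cases}$$ $$m_0=\max\left\{\tfrac23,\tfrac1{\delta-3}\right\},\quad m_1=\max\left\{\tfrac7{3(\delta-1)},\tfrac4{3(\beta-1)}\right\},\quad m_2=\max\left\{\tfrac1{\delta-\beta},\tfrac4{3(\beta-1)}\right\}.$$ Let $\varphi\in C^1([0,\infty))$ be given by $\varphi(0)=0$, $\varphi'(r)=\tau(r+1)^{-k}-\tau(a+1)^{-k}$ for $0\le r\le a$ and $\varphi'(r)=0$ for $r\ge a$, and write $\varphi=\varphi(|x|)$ on $\mathbb R^n$. Then for all sufficiently large $\tau_0$, and for all $t$ sufficiently large (depending on $\tau_0$), there are constants $h_0\in(0,1)$ and $C>0$ such that for all $0<h\le h_0$, all $0<\theta\le\epsilon ha^{-2k}$, either choice of the sign $\pm$, and all $f\in H^2(\mathbb R^n)$ with $(|x|+1)^s(P(h)-E\pm i\theta)f\in L^2(\mathbb R^n)$, $$\|(|x|+1)^{-s}e^{\varphi/h}f\|_{L^2}\le Ca^{2k}(\epsilon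 h)^{-1}\|(|x|+1)^se^{\varphi/h}(P(h)-E\pm i\theta)f\|_{L^2}+Ca^k\tau\left(\frac{\theta}{\epsilon h}\right)^{1/2}\|e^{\varphi/h}f\|_{L^2}.$$ The constants $C$ and $h_0$ do not depend on $h$, $\theta$, $f$ or the sign. -/

import Mathlib

open MeasureTheory Set Filter Topology
open scoped ENNReal SchwartzMap Laplacian

noncomputable section

namespace Carleman

/-- The Sobolev space `H²(ℝⁿ)`, as a property of classes of square integrable functions. -/
def MemH2 {n : ℕ} (f : Lp ℂ 2 (volume : Measure (EuclideanSpace ℝ (Fin n)))) : Prop :=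
  TemperedDistribution.MemSobolev 2 2 (f : 𝓢'(EuclideanSpace ℝ (Fin n), ℂ))

/-- The distributional Laplacian of an `H²` function is a square integrable function. -/
theorem MemH2.exists_laplacian {n : ℕ} {f : Lp ℂ 2 (volume : Measure (EuclideanSpace ℝ (Fin n)))}
    (hf : MemH2 f) :
    ∃ g : Lp ℂ 2 (volume : Measure (EuclideanSpace ℝ (Fin n))),
      Δ (f : 𝓢'(EuclideanSpace ℝ (Fin n), ℂ)) = (g : 𝓢'(EuclideanSpace ℝ (Fin n), ℂ)) := by
  have h := TemperedDistribution.MemSobolev.laplacian hf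
  rw [sub_self] at h
  exact TemperedDistribution.memSobolev_zero_iff.1 h

/-- The Laplacian `H²(ℝⁿ) → L²(ℝⁿ)` (the unique square integrable function that represents the
distributional Laplacian). -/
def laplacianH2 {n : ℕ} (f : Lp ℂ 2 (volume : Measure (EuclideanSpace ℝ (Fin n))))
    (hf : MemH2 f) : Lp ℂ 2 (volume : Measure (EuclideanSpace ℝ (Fin n))) :=
  hf.exists_laplacian.choose

theorem laplacianH2_spec {n : ℕ} (f : Lp ℂ 2 (volume : Measure (EuclideanSpace ℝ (Fin n))))
    (hf : MemH2 f) :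
    Δ (f : 𝓢'(EuclideanSpace ℝ (Fin n), ℂ)) =
      (laplacianH2 f hf : 𝓢'(EuclideanSpace ℝ (Fin n), ℂ)) :=
  hf.exists_laplacian.choose_spec

/-- `(P(h) - z) f` for `P(h) = -h² Δ + V`, a complex number `z` and `f ∈ H²(ℝⁿ)`. -/
def schrodingerSub {n : ℕ} (h : ℝ) (V : EuclideanSpace ℝ (Fin n) → ℝ) (z : ℂ)
    (f : Lp ℂ 2 (volume : Measure (EuclideanSpace ℝ (Fin n)))) (hf : MemH2 f) :
    EuclideanSpace ℝ (Fin n) → ℂ :=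
  fun x => -(h : ℂ) ^ 2 * laplacianH2 f hf x + (V x : ℂ) * f x - z * f x

/-- `ε = (log (1 / h))⁻¹`. -/
def eps (h : ℝ) : ℝ := (Real.log (1 / h))⁻¹

def m₀ (δ : ℝ) : ℝ := max (2 / 3) (1 / (δ - 3))

def m₁ (δ β : ℝ) : ℝ := max (7 / (3 * (δ - 1))) (4 / (3 * (β - 1)))

def m₂ (δ β : ℝ) : ℝ := max (1 / (δ - β)) (4 / (3 * (β - 1)))

/-- The exponent `m`, in the three cases `δ > 3, β ≥ 3`; `δ > 3, β < 3`; `δ ≤ 3`. -/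
def mExp (δ β t h : ℝ) : ℝ :=
  if 3 < δ then
    if 3 ≤ β then m₀ δ + eps h * (3 * m₀ δ * t)
    else m₂ δ β + eps h * (6 * m₂ δ β * t / (β - 1))
  else m₁ δ β + eps h * (6 * m₁ δ β ^ 2 * t)

/-- The exponent `k`, in the same three cases. -/
def kExp (δ β t h : ℝ) : ℝ :=
  if 3 < δ then
    if 3 ≤ β then 1 - eps h * t
    else (β - 1) / 2 - eps h * t
  else 2 / (3 * m₁ δ β) - eps h * t

/-- The radius `a = h ^ (-m)`. -/
def aRad (δ β t h : ℝ) : ℝ := h ^ (-mExp δ β t h)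

/-- The exponent `s = (1 + ε) / 2`. -/
def sExp (h : ℝ) : ℝ := (1 + eps h) / 2

/-- The large parameter `τ = τ₀ h ^ (-1/3)`. -/
def tauPar (τ₀ h : ℝ) : ℝ := τ₀ * h ^ (-(1 / 3) : ℝ)

/-- The derivative of the phase. -/
def phaseDeriv (a k τ r : ℝ) : ℝ :=
  if r ≤ a then τ * (r + 1) ^ (-k) - τ * (a + 1) ^ (-k) else 0

/-- The phase `φ` on `[0, ∞)`, determined by `φ(0) = 0` and its derivative. -/
def phase (a k τ r : ℝ) : ℝ := ∫ σ in (0 : ℝ)..r, phaseDeriv a k τ σ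

/-- The exponential weight `x ↦ exp (φ(|x|) / h)` on `ℝⁿ`. -/
def expWeight {n : ℕ} (δ β t τ₀ h : ℝ) (x : EuclideanSpace ℝ (Fin n)) : ℝ :=
  Real.exp (phase (aRad δ β t h) (kExp δ β t h) (tauPar τ₀ h) ‖x‖ / h)

end Carleman

end

/-! The estimate is a radial multiplier argument carried out under the weight e^{2φ/h}. Put ϕ = φ/h,
ψ = ϕ', ν = n - 1 and Q = ∂_r f + (ν/2r) f + ψ f, so that e^ϕ Q is the symmetrised radial derivative
of e^ϕ f. For μ ≥ 0 with μ(0) = 0 consider the flux r^ν μ e^{2ϕ} (|Q|² + ψ²|f|² - |∇_S f|²/r² -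
ν(ν-2)|f|²/(4r²) - W|f|²) with W = (U - E)/h². For a test function its derivative integrates to zero
along every ray. If r μ' ≤ 2μ and ν ≥ 2, the spherical terms have a good sign and drop out, and W
enters only through an upper bound on its radial derivative. What remains is
`integral_radial_multiplier_nonneg`, an inequality between f, Q and -Δf + Wf - ψ'f. A second
integration by parts, `integral_sq_radialDeriv_le`, bounds ∫ e^{2ϕ}|Q|² by ∫ e^{2ϕ}(ψ²|f|² - Re(Δf
f̄)). Both hold for real test functions, extend to complex ones by adding real and imaginary parts,
and extend to H² by density.

The potential is rearranged beforehand: V_L is cut off near the origin to a function U ≤ E/3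
(`exists_longRange_modification`), and the bounded remainder is counted as short range. The operator
then equals -h²Δ + U - E up to short range terms and iθ.

The multiplier is μ = (r+1)^{2k} - 1 for r < a, continued with μ' = (r+1)^{-1-ε} beyond. With φ' =
τ((r+1)^{-k} - (a+1)^{-k}) the leading terms of (μφ'²)' cancel, so this derivative costs little,
while E μ' gives coercivity in f and hμφ' + h²μ' gives coercivity in Q.
`WeightBounds.pointwise_lower_bound` shows that this beats the long range and short range errors in
three regions: r far below a, r comparable to a, and r ≥ a.

The parameters fit together because hτ³ = τ₀³ does not depend on h, because a^k dominates τ² ~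
h^{-2/3}, and because h^{εx} = e^{-x} turns each εt in an exponent into a factor independent of h.
Large τ₀ handles the errors on the inner region, t is then taken large compared with τ₀, and h is
small last (`eventually_weightBounds`).

The term 2μθ|f||Q| coming from iθ is not controlled by coercivity. It is absorbed by adding
8θa^{2k}/h times the elliptic inequality, which leaves the last term of the estimate. -/

/-! ### Density of Schwartz functions in H², by Fourier multipliers. -/

section Density

open scoped FourierTransform LineDeriv ContDiff

variable {E : Type*} [NormedAddCommGroup E] [InnerProductSpace ℝ E] [FiniteDimensional ℝ E]
  [MeasurableSpace E] [BorelSpace E]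

/-- A bounded Fourier multiplier acts on `L²`, with norm at most the bound of the symbol. -/
theorem exists_Lp_fourierMultiplier_norm_le {m : E → ℂ} (hm : m.HasTemperateGrowth) {C : ℝ}
    (hC : ∀ x, ‖m x‖ ≤ C) (u : Lp ℂ 2 (volume : Measure E)) :
    ∃ v : Lp ℂ 2 (volume : Measure E),
      TemperedDistribution.fourierMultiplierCLM ℂ m (u : 𝓢'(E, ℂ)) = (v : 𝓢'(E, ℂ)) ∧
      ‖v‖ ≤ C * ‖u‖ := by
  have hC0 : 0 ≤ C := (norm_nonneg _).trans (hC 0)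
  set g' : BoundedContinuousFunction E ℂ :=
    BoundedContinuousFunction.ofNormedAddCommGroup m hm.1.continuous C hC
  have hmem : MemLp m ∞ (volume : Measure E) := g'.memLp_top
  refine ⟨𝓕⁻ ((hmem.toLp m) • (𝓕 u : Lp ℂ 2 (volume : Measure E))), ?_, ?_⟩
  · rw [TemperedDistribution.fourierMultiplierCLM_apply,
      ← Lp.fourierInv_toTemperedDistribution_eq,
      MeasureTheory.Lp.toTemperedDistribution_smul_eq (by exact hm),
      Lp.fourier_toTemperedDistribution_eq]
  · have h1 : ‖(𝓕⁻ ((hmem.toLp m) • (𝓕 u : Lp ℂ 2 (volume : Measure E))) :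
        Lp ℂ 2 (volume : Measure E))‖ =
        ‖(hmem.toLp m) • (𝓕 u : Lp ℂ 2 (volume : Measure E))‖ := by
      rw [← Lp.norm_fourier_eq (𝓕⁻ _), FourierTransform.fourier_fourierInv_eq]
    rw [h1, ← Lp.norm_fourier_eq u]
    refine (Lp.norm_smul_le _ _).trans ?_
    gcongr
    rw [Lp.norm_toLp]
    refine ENNReal.toReal_le_of_le_ofReal hC0 ?_
    rw [eLpNorm_exponent_top]
    refine eLpNormEssSup_le_of_ae_bound (ae_of_all _ hC)

/-- Schwartz functions are dense in `H²`. -/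
theorem exists_schwartz_approx {f g : Lp ℂ 2 (volume : Measure E)}
    (hf : TemperedDistribution.MemSobolev 2 2 (f : 𝓢'(E, ℂ)))
    (hg : Δ (f : 𝓢'(E, ℂ)) = (g : 𝓢'(E, ℂ))) {ε : ℝ} (hε : 0 < ε) :
    ∃ φ : 𝓢(E, ℂ), ‖φ.toLp 2 volume - f‖ < ε ∧ ‖(Δ φ : 𝓢(E, ℂ)).toLp 2 volume - g‖ < ε := by
  obtain ⟨u, hu⟩ := hf
  -- Here f = m(D)u with u square integrable. Both m and |ξ|²m are bounded by 1, so one L²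
  -- approximation of u by a Schwartz function controls f and Δf at once.
  set m : E → ℂ := fun x => ((1 + ‖x‖ ^ 2) ^ ((-2 : ℝ) / 2) : ℝ) with hm_def
  have hm : m.HasTemperateGrowth := by fun_prop
  have hfu : (f : 𝓢'(E, ℂ)) = TemperedDistribution.fourierMultiplierCLM ℂ m (u : 𝓢'(E, ℂ)) := by
    have := (TemperedDistribution.besselPotential_neg_apply_eq_iff (2 : ℝ) (u : 𝓢'(E, ℂ))
      (f : 𝓢'(E, ℂ))).2 hu
    rw [← this]; rfl
  have hmb : ∀ x, ‖m x‖ ≤ 1 := by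
    intro x
    rw [hm_def, Complex.norm_real, Real.norm_eq_abs, abs_of_nonneg (by positivity)]
    exact Real.rpow_le_one_of_one_le_of_nonpos (by simp) (by norm_num)
  set m' : E → ℂ := m * (fun x => ((‖x‖ ^ 2 : ℝ) : ℂ)) with hm'_def
  have hq : (fun x : E => ((‖x‖ ^ 2 : ℝ) : ℂ)).HasTemperateGrowth := by fun_prop
  have hm' : m'.HasTemperateGrowth := by
    rw [hm'_def]; exact hm.mul hq
  have hmb' : ∀ x, ‖m' x‖ ≤ 1 := by
    intro x
    rw [hm'_def, Pi.mul_apply, norm_mul, hm_def, Complex.norm_real, Complex.norm_real,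
      Real.norm_eq_abs, Real.norm_eq_abs, abs_of_nonneg (by positivity),
      abs_of_nonneg (by positivity)]
    have : (-2 : ℝ) / 2 = -1 := by norm_num
    rw [this, Real.rpow_neg_one, inv_mul_le_iff₀ (by positivity)]
    linarith
  have hgu : (g : 𝓢'(E, ℂ)) = -(2 * Real.pi) ^ 2 •
      TemperedDistribution.fourierMultiplierCLM ℂ m' (u : 𝓢'(E, ℂ)) := by
    rw [← hg, TemperedDistribution.laplacian_eq_fourierMultiplierCLM, hfu,
      TemperedDistribution.fourierMultiplierCLM_fourierMultiplierCLM_apply hm hq]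
  -- The Laplacian has symbol -(2π)²|ξ|² in this normalisation; K leaves room for that factor.
  set K : ℝ := 1 + (2 * Real.pi) ^ 2 with hK
  have hK0 : 0 < K := by positivity
  obtain ⟨ψ, hψ⟩ : ∃ ψ : 𝓢(E, ℂ), ‖ψ.toLp 2 volume - u‖ < ε / K := by
    have := SchwartzMap.denseRange_toLpCLM (F := ℂ) (μ := (volume : Measure E)) (p := 2)
      (by simp)
    obtain ⟨ψ, hψ⟩ := this.exists_dist_lt u (show 0 < ε / K by positivity)
    refine ⟨ψ, ?_⟩
    rw [dist_comm, dist_eq_norm] at hψ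
    exact hψ
  have hinj : ∀ a b : Lp ℂ 2 (volume : Measure E), (a : 𝓢'(E, ℂ)) = (b : 𝓢'(E, ℂ)) → a = b := by
    have := LinearMap.ker_eq_bot.1
      (MeasureTheory.Lp.ker_toTemperedDistributionCLM_eq_bot (F := ℂ) (μ := (volume : Measure E))
        (p := 2))
    intro a b hab
    exact this hab
  have hsub : ∀ a b : Lp ℂ 2 (volume : Measure E),
      ((a - b : Lp ℂ 2 (volume : Measure E)) : 𝓢'(E, ℂ)) = (a : 𝓢'(E, ℂ)) - (b : 𝓢'(E, ℂ)) :=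
    fun a b => map_sub (MeasureTheory.Lp.toTemperedDistributionCLM ℂ volume 2) a b
  have hsmul : ∀ (c : ℝ) (a : Lp ℂ 2 (volume : Measure E)),
      ((c • a : Lp ℂ 2 (volume : Measure E)) : 𝓢'(E, ℂ)) = c • (a : 𝓢'(E, ℂ)) := by
    intro c a
    have := map_smul (MeasureTheory.Lp.toTemperedDistributionCLM ℂ (volume : Measure E) 2)
      (c : ℂ) a
    rw [Complex.coe_smul] at this
    exact this.trans (Complex.coe_smul c _)
  set φ : 𝓢(E, ℂ) := SchwartzMap.fourierMultiplierCLM ℂ m ψ with hφ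
  have hφd : ((φ.toLp 2 volume : Lp ℂ 2 (volume : Measure E)) : 𝓢'(E, ℂ)) =
      TemperedDistribution.fourierMultiplierCLM ℂ m
        ((ψ.toLp 2 volume : Lp ℂ 2 (volume : Measure E)) : 𝓢'(E, ℂ)) := by
    rw [Lp.toTemperedDistribution_toLp_eq, Lp.toTemperedDistribution_toLp_eq,
      TemperedDistribution.fourierMultiplierCLM_toTemperedDistributionCLM_eq hm]
  have hΔφd : (((Δ φ : 𝓢(E, ℂ)).toLp 2 volume : Lp ℂ 2 (volume : Measure E)) : 𝓢'(E, ℂ)) =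
      -(2 * Real.pi) ^ 2 • TemperedDistribution.fourierMultiplierCLM ℂ m'
        ((ψ.toLp 2 volume : Lp ℂ 2 (volume : Measure E)) : 𝓢'(E, ℂ)) := by
    rw [Lp.toTemperedDistribution_toLp_eq,
      ← TemperedDistribution.laplacian_toTemperedDistributionCLM_eq,
      ← Lp.toTemperedDistribution_toLp_eq (p := 2), hφd,
      TemperedDistribution.laplacian_eq_fourierMultiplierCLM,
      TemperedDistribution.fourierMultiplierCLM_fourierMultiplierCLM_apply hm hq]
  refine ⟨φ, ?_, ?_⟩
  · obtain ⟨v, hv, hvn⟩ := exists_Lp_fourierMultiplier_norm_le hm hmb (ψ.toLp 2 volume - u)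
    have : φ.toLp 2 volume - f = v := by
      apply hinj
      rw [hsub, hφd, hfu, ← map_sub, ← hsub, hv]
    rw [this]
    refine hvn.trans_lt ?_
    rw [one_mul]
    refine hψ.trans_le (div_le_self hε.le ?_)
    rw [hK]; nlinarith [sq_nonneg (2 * Real.pi)]
  · obtain ⟨v, hv, hvn⟩ := exists_Lp_fourierMultiplier_norm_le hm' hmb' (ψ.toLp 2 volume - u)
    have : (Δ φ : 𝓢(E, ℂ)).toLp 2 volume - g = (-(2 * Real.pi) ^ 2 : ℝ) • v := by
      apply hinj
      rw [hsub, hΔφd, hgu, ← smul_sub, ← map_sub, ← hsub, hv, hsmul]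
    rw [this, norm_smul, Real.norm_eq_abs, abs_neg, abs_of_nonneg (by positivity)]
    rw [one_mul] at hvn
    have h2 : ‖v‖ < ε / K := hvn.trans_lt hψ
    rw [lt_div_iff₀ hK0] at h2
    have : 0 ≤ ‖v‖ := norm_nonneg v
    rw [hK] at h2
    nlinarith

end Density

/-! ### Cutoff at scale R: smooth compactly supported functions are dense in H². -/

section Cutoff

open scoped FourierTransform LineDeriv ContDiff

variable {E : Type*} [NormedAddCommGroup E]

section Normed

variable [NormedSpace ℝ E]

theorem fderiv_fderiv_apply {F : Type*} [NormedAddCommGroup F] [NormedSpace ℝ F] {u : E → F}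
    (hu : ContDiff ℝ ∞ u) (x v w : E) :
    fderiv ℝ (fun y => fderiv ℝ u y w) x v = fderiv ℝ (fderiv ℝ u) x v w := by
  have h : DifferentiableAt ℝ (fderiv ℝ u) x :=
    ((hu.fderiv_right (m := ∞) (by simp)).differentiable (by simp)).differentiableAt
  rw [fderiv_clm_apply h (by fun_prop)]
  simp

theorem ContDiff.fderiv_apply_const {F : Type*} [NormedAddCommGroup F] [NormedSpace ℝ F] {u : E → F}
    (hu : ContDiff ℝ ∞ u) (w : E) : ContDiff ℝ ∞ (fun y => fderiv ℝ u y w) :=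
  (hu.fderiv_right (m := ∞) (by simp)).clm_apply contDiff_const

theorem fderiv_fderiv_comp_smul {u : E → ℝ} (hu : ContDiff ℝ ∞ u) (c : ℝ) (x v : E) :
    fderiv ℝ (fderiv ℝ (fun y => u (c • y))) x v v =
      c * (c * fderiv ℝ (fderiv ℝ u) (c • x) v v) := by
  have hsc : ContDiff ℝ ∞ (fun x : E => c • x) := contDiff_const_smul _
  have hc : ContDiff ℝ ∞ (fun y => u (c • y)) := hu.comp hsc
  rw [← fderiv_fderiv_apply hc]
  have hf1 : ∀ x, fderiv ℝ (fun y => u (c • y)) x v = c * fderiv ℝ u (c • x) v := by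
    intro x
    rw [fderiv_comp_smul]
    simp
  simp_rw [hf1]
  have hd : DifferentiableAt ℝ (fun y => fderiv ℝ u (c • y) v) x :=
    (((hu.fderiv_apply_const v).comp hsc).differentiable (by simp)) x
  rw [fderiv_const_mul hd, fderiv_comp_smul (f := fun y => fderiv ℝ u y v)]
  simp [fderiv_fderiv_apply hu]

theorem fderiv_fderiv_smul {χ : E → ℝ} {u : E → ℂ} (hχ : ContDiff ℝ ∞ χ) (hu : ContDiff ℝ ∞ u)
    (x v : E) :
    fderiv ℝ (fderiv ℝ (fun y => χ y • u y)) x v v =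
      χ x • fderiv ℝ (fderiv ℝ u) x v v + (2 * fderiv ℝ χ x v) • fderiv ℝ u x v +
        fderiv ℝ (fderiv ℝ χ) x v v • u x := by
  have hd : ∀ y, fderiv ℝ (fun y => χ y • u y) y v = χ y • fderiv ℝ u y v + fderiv ℝ χ y v • u y := by
    intro y
    rw [fderiv_fun_smul (hχ.differentiable (by simp) y) (hu.differentiable (by simp) y)]
    simp
  have hsm : ContDiff ℝ ∞ (fun y => χ y • u y) := hχ.smul hu
  rw [← fderiv_fderiv_apply hsm, ← fderiv_fderiv_apply hu, ← fderiv_fderiv_apply hχ]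
  simp_rw [hd]
  have h1 := (hχ.differentiable (by simp) x)
  have h2 := (hu.differentiable (by simp) x)
  have h3 := ((hu.fderiv_apply_const v).differentiable (by simp) x)
  have h4 := ((hχ.fderiv_apply_const v).differentiable (by simp) x)
  rw [fderiv_fun_add (h1.fun_smul h3) (h4.fun_smul h2), fderiv_fun_smul h1 h3, fderiv_fun_smul h4 h2]
  simp only [_root_.add_apply, _root_.smul_apply, ContinuousLinearMap.smulRight_apply]
  module

theorem HasCompactSupport.exists_bound_fderiv {F : Type*} [NormedAddCommGroup F] [NormedSpace ℝ F]
    {u : E → F} (hu : ContDiff ℝ ∞ u) (hc : HasCompactSupport u) :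
    ∃ C, 0 ≤ C ∧ ∀ x, ‖fderiv ℝ u x‖ ≤ C := by
  obtain ⟨C, hC⟩ := (hu.continuous_fderiv (by simp)).bounded_above_of_compact_support
    (hc.fderiv (𝕜 := ℝ))
  exact ⟨C, (norm_nonneg _).trans (hC 0), hC⟩

end Normed

variable [InnerProductSpace ℝ E] [FiniteDimensional ℝ E]

theorem laplacian_eq_sum_fderiv_fderiv {ι F : Type*} [Fintype ι] [NormedAddCommGroup F]
    [NormedSpace ℝ F] (b : OrthonormalBasis ι ℝ E) (u : E → F) (x : E) :
    Δ u x = ∑ i, fderiv ℝ (fderiv ℝ u) x (b i) (b i) := by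
  rw [InnerProductSpace.laplacian_eq_iteratedFDeriv_orthonormalBasis u b]
  simp [iteratedFDeriv_two_apply]

theorem laplacian_smul_fun {ι : Type*} [Fintype ι] (b : OrthonormalBasis ι ℝ E) {χ : E → ℝ}
    {u : E → ℂ} (hχ : ContDiff ℝ ∞ χ) (hu : ContDiff ℝ ∞ u) (x : E) :
    Δ (fun y => χ y • u y) x = χ x • Δ u x +
      ∑ i, ((2 * fderiv ℝ χ x (b i)) • fderiv ℝ u x (b i) +
        fderiv ℝ (fderiv ℝ χ) x (b i) (b i) • u x) := by
  simp_rw [laplacian_eq_sum_fderiv_fderiv b, fderiv_fderiv_smul hχ hu, Finset.smul_sum]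
  rw [← Finset.sum_add_distrib]
  exact Finset.sum_congr rfl fun i _ => by rw [add_assoc]

/-- Smooth cutoffs at scale `R`, with the bounds on the first two derivatives. -/
theorem exists_cutoff_family : ∃ K : ℝ, 0 ≤ K ∧ ∀ R : ℝ, 1 ≤ R → ∃ χ : E → ℝ,
    ContDiff ℝ ∞ χ ∧ HasCompactSupport χ ∧ (∀ x, |χ x - 1| ≤ R⁻¹ * ‖x‖) ∧
    (∀ x v, ‖v‖ = 1 → |fderiv ℝ χ x v| ≤ R⁻¹ * K) ∧
    (∀ x v, ‖v‖ = 1 → |fderiv ℝ (fderiv ℝ χ) x v v| ≤ R⁻¹ * K) := by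
  obtain ⟨B, hB, hBc, hBn, hBl, hBo⟩ : ∃ B : E → ℝ, ContDiff ℝ ∞ B ∧ HasCompactSupport B ∧
      (∀ x, 0 ≤ B x) ∧ (∀ x, B x ≤ 1) ∧ (∀ x, ‖x‖ ≤ 1 → B x = 1) := by
    let B : ContDiffBump (0 : E) := ⟨1, 2, one_pos, one_lt_two⟩
    exact ⟨B, B.contDiff, B.hasCompactSupport, fun x => B.nonneg, fun x => B.le_one,
      fun x hx => B.one_of_mem_closedBall (by simpa using hx)⟩
  have hB1 : ContDiff ℝ ∞ (fderiv ℝ B) := hB.fderiv_right (by simp)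
  obtain ⟨C1, h01, hC1⟩ := hBc.exists_bound_fderiv hB
  obtain ⟨C2, h02, hC2⟩ := (hBc.fderiv (𝕜 := ℝ)).exists_bound_fderiv hB1
  -- One constant serves both derivatives: second derivatives scale like R⁻², which is at most R⁻¹
  -- because R ≥ 1.
  refine ⟨C1 + C2, by positivity, fun R hR => ?_⟩
  have hR0 : 0 < R := by linarith
  have hRi : R⁻¹ ≤ 1 := inv_le_one_of_one_le₀ hR
  have hRi0 : 0 < R⁻¹ := by positivity
  have hsc : ContDiff ℝ ∞ (fun x : E => R⁻¹ • x) := contDiff_const_smul _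
  have hχ : ContDiff ℝ ∞ (fun x : E => B (R⁻¹ • x)) := hB.comp hsc
  have hf1 : ∀ x v, fderiv ℝ (fun x : E => B (R⁻¹ • x)) x v =
      R⁻¹ * fderiv ℝ B (R⁻¹ • x) v := by
    intro x v
    rw [fderiv_comp_smul]
    simp
  refine ⟨fun x => B (R⁻¹ • x), hχ, ?_, ?_, ?_, ?_⟩
  · exact hBc.comp_smul hRi0.ne'
  · intro x
    change |B (R⁻¹ • x) - 1| ≤ _
    by_cases hx : ‖x‖ ≤ R
    · have : B (R⁻¹ • x) = 1 := by
        apply hBo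
        rw [norm_smul, norm_inv, Real.norm_eq_abs, abs_of_pos hR0]
        rw [inv_mul_le_iff₀ hR0]; linarith
      rw [this]; simp; positivity
    · have h1 : 1 ≤ R⁻¹ * ‖x‖ := by
        rw [le_inv_mul_iff₀ hR0]; linarith
      have := hBl (R⁻¹ • x)
      have h0 := hBn (R⁻¹ • x)
      rw [abs_le]; constructor <;> linarith
  · intro x v hv
    rw [hf1, abs_mul, abs_of_pos hRi0]
    gcongr
    have := (fderiv ℝ B (R⁻¹ • x)).le_opNorm v
    rw [hv, mul_one, Real.norm_eq_abs] at this
    linarith [hC1 (R⁻¹ • x)]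
  · intro x v hv
    rw [fderiv_fderiv_comp_smul hB, abs_mul, abs_of_pos hRi0]
    gcongr
    have := (fderiv ℝ (fderiv ℝ B) (R⁻¹ • x)).le_opNorm₂ v v
    rw [hv, mul_one, mul_one, Real.norm_eq_abs] at this
    rw [abs_mul, abs_of_pos hRi0]
    have h3 := hC2 (R⁻¹ • x)
    nlinarith [abs_nonneg (fderiv ℝ (fderiv ℝ B) (R⁻¹ • x) v v)]

variable [MeasurableSpace E] [BorelSpace E]

/-- The error 1 - χ of a cutoff is only bounded by R⁻¹‖x‖, so a factor ‖x‖ has to be absorbed. It is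
at most 1 + ‖x‖², which is a temperate multiplier. -/
theorem SchwartzMap.memLp_norm_mul (G : 𝓢(E, ℂ)) :
    MemLp (fun x => ‖x‖ * ‖G x‖) 2 (volume : Measure E) := by
  have hq : (fun x : E => ((1 + ‖x‖ ^ 2 : ℝ) : ℂ)).HasTemperateGrowth := by fun_prop
  refine ((SchwartzMap.smulLeftCLM ℂ (fun x : E => ((1 + ‖x‖ ^ 2 : ℝ) : ℂ)) G).memLp 2
    volume).mono ?_ ?_
  · exact (continuous_norm.mul G.continuous.norm).aestronglyMeasurable
  · refine ae_of_all _ fun x => ?_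
    rw [SchwartzMap.smulLeftCLM_apply_apply hq, norm_smul, norm_mul, norm_norm, norm_norm,
      Complex.norm_real, Real.norm_eq_abs, abs_of_nonneg (by positivity)]
    gcongr
    nlinarith [sq_nonneg (‖x‖ - 1)]

/-- Smooth compactly supported functions are dense in `H²`. -/
theorem exists_contDiff_approx {f g : Lp ℂ 2 (volume : Measure E)}
    (hf : TemperedDistribution.MemSobolev 2 2 (f : 𝓢'(E, ℂ)))
    (hg : Δ (f : 𝓢'(E, ℂ)) = (g : 𝓢'(E, ℂ))) {ε : ℝ} (hε : 0 < ε) :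
    ∃ u : E → ℂ, ContDiff ℝ ∞ u ∧ HasCompactSupport u ∧
      eLpNorm (fun x => u x - f x) 2 volume ≤ ENNReal.ofReal ε ∧
      eLpNorm (fun x => Δ u x - g x) 2 volume ≤ ENNReal.ofReal ε := by
  obtain ⟨φ, h1, h2⟩ := exists_schwartz_approx hf hg (half_pos hε)
  obtain ⟨K, hK0, hK⟩ := exists_cutoff_family (E := E)
  set b := stdOrthonormalBasis ℝ E
  -- R⁻¹ H dominates the cutoff errors in φ and in Δφ simultaneously, so R can be read off from the
  -- L² norm of H.
  set H : E → ℝ := fun x => ‖x‖ * ‖φ x‖ + ‖x‖ * ‖(Δ φ : 𝓢(E, ℂ)) x‖ +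
    ∑ i, (2 * K * ‖(∂_{b i} φ : 𝓢(E, ℂ)) x‖ + K * ‖φ x‖) with hH
  have hφs : ContDiff ℝ ∞ (φ : E → ℂ) := φ.smooth ⊤
  have hHmem : MemLp H 2 volume := by
    refine (φ.memLp_norm_mul.add (Δ φ : 𝓢(E, ℂ)).memLp_norm_mul).add (memLp_finsetSum _ fun i _ => ?_)
    exact (((∂_{b i} φ : 𝓢(E, ℂ)).memLp 2).norm.const_mul _).add ((φ.memLp 2).norm.const_mul _)
  have hH0 : ∀ x, 0 ≤ H x := fun x => by
    refine add_nonneg (by positivity) (Finset.sum_nonneg fun i _ => by positivity)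
  set N : ℝ := (eLpNorm H 2 volume).toReal
  have hN0 : 0 ≤ N := ENNReal.toReal_nonneg
  obtain ⟨R, hR1, hRN⟩ : ∃ R : ℝ, 1 ≤ R ∧ R⁻¹ * N ≤ ε / 2 := by
    refine ⟨max 1 (N / (ε / 2)), le_max_left _ _, ?_⟩
    rw [inv_mul_le_iff₀ (by positivity), ← div_le_iff₀ (by positivity)]
    exact le_max_right _ _
  have hRi0 : 0 < R⁻¹ := by positivity
  obtain ⟨χ, hχ, hχc, hχ1, hχ2, hχ3⟩ := hK R hR1
  have key : ∀ (G : E → ℂ) (S : 𝓢(E, ℂ)) (k : Lp ℂ 2 (volume : Measure E)),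
      Continuous G → (∀ x, ‖G x - S x‖ ≤ R⁻¹ * H x) → ‖S.toLp 2 volume - k‖ < ε / 2 →
      eLpNorm (fun x => G x - k x) 2 volume ≤ ENNReal.ofReal ε := by
    intro G S k hG hGS hSk
    have e1 : (fun x => G x - k x) = (fun x => G x - S x) + (fun x => S x - k x) := by
      ext x; simp
    rw [e1]
    refine (eLpNorm_add_le (hG.sub S.continuous).aestronglyMeasurable
      (S.continuous.aestronglyMeasurable.sub (Lp.aestronglyMeasurable k)) (by norm_num)).trans ?_
    rw [← add_halves ε, ENNReal.ofReal_add (by positivity) (by positivity)]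
    gcongr
    · have : eLpNorm (fun x => G x - S x) 2 volume ≤ eLpNorm (R⁻¹ • H) 2 volume := by
        refine eLpNorm_mono_real fun x => ?_
        simpa using hGS x
      refine this.trans ?_
      rw [eLpNorm_const_smul, Real.enorm_eq_ofReal hRi0.le,
        ← ENNReal.ofReal_toReal hHmem.eLpNorm_lt_top.ne, ← ENNReal.ofReal_mul hRi0.le]
      exact ENNReal.ofReal_le_ofReal hRN
    · have : eLpNorm (fun x => S x - k x) 2 volume = eLpNorm (S.toLp 2 volume - k : Lp ℂ 2 volume) 2 volume := by
        refine eLpNorm_congr_ae ?_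
        filter_upwards [Lp.coeFn_sub (S.toLp 2 volume) k, S.coeFn_toLp 2 volume] with x hx hx'
        rw [hx, Pi.sub_apply, hx']
      refine this.trans_le ?_
      rw [← Lp.enorm_def, ← ofReal_norm]
      exact ENNReal.ofReal_le_ofReal hSk.le
  have hu : ContDiff ℝ ∞ (fun x => χ x • φ x) := hχ.smul hφs
  have hld : ∀ x i, (∂_{b i} φ : 𝓢(E, ℂ)) x = fderiv ℝ φ x (b i) := by
    intro x i
    rw [SchwartzMap.lineDerivOp_apply, (hφs.differentiable (by simp) x).lineDeriv_eq_fderiv]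
  refine ⟨fun x => χ x • φ x, hu, hχc.smul_right, key _ φ f hu.continuous ?_ h1,
    key _ (Δ φ) g ?_ ?_ h2⟩
  · intro x
    have : χ x • φ x - φ x = (χ x - 1) • φ x := by module
    rw [this, norm_smul, Real.norm_eq_abs]
    have h3 : |χ x - 1| * ‖φ x‖ ≤ R⁻¹ * ‖x‖ * ‖φ x‖ := by gcongr; exact hχ1 x
    refine h3.trans ?_
    rw [mul_assoc]
    gcongr
    simp only [hH]
    have : 0 ≤ ∑ i, (2 * K * ‖(∂_{b i} φ : 𝓢(E, ℂ)) x‖ + K * ‖φ x‖) :=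
      Finset.sum_nonneg fun i _ => by positivity
    have : 0 ≤ ‖x‖ * ‖(Δ φ : 𝓢(E, ℂ)) x‖ := by positivity
    linarith
  · have : (Δ (fun x => χ x • φ x) : E → ℂ) = fun x =>
        ∑ i, fderiv ℝ (fderiv ℝ (fun x => χ x • φ x)) x (b i) (b i) := by
      ext x; exact laplacian_eq_sum_fderiv_fderiv b _ x
    rw [this]
    refine continuous_finsetSum _ fun i _ => ?_
    exact (((hu.fderiv_right (m := ∞) (by simp)).fderiv_right (m := ∞) (by simp)).continuous.clm_apply
      continuous_const).clm_apply continuous_const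
  · intro x
    rw [laplacian_smul_fun b hχ hφs, SchwartzMap.laplacian_apply]
    have e2 : χ x • Δ (φ : E → ℂ) x + ∑ i, ((2 * fderiv ℝ χ x (b i)) • fderiv ℝ φ x (b i) +
        fderiv ℝ (fderiv ℝ χ) x (b i) (b i) • φ x) - Δ (φ : E → ℂ) x =
        (χ x - 1) • Δ (φ : E → ℂ) x + ∑ i, ((2 * fderiv ℝ χ x (b i)) • fderiv ℝ φ x (b i) +
        fderiv ℝ (fderiv ℝ χ) x (b i) (b i) • φ x) := by module
    rw [e2]
    have hA : ‖(χ x - 1) • Δ (φ : E → ℂ) x‖ ≤ R⁻¹ * (‖x‖ * ‖(Δ φ : 𝓢(E, ℂ)) x‖) := by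
      rw [norm_smul, Real.norm_eq_abs, SchwartzMap.laplacian_apply, ← mul_assoc]
      gcongr
      exact hχ1 x
    have hBi : ‖∑ i, ((2 * fderiv ℝ χ x (b i)) • fderiv ℝ φ x (b i) +
        fderiv ℝ (fderiv ℝ χ) x (b i) (b i) • φ x)‖ ≤
        R⁻¹ * ∑ i, (2 * K * ‖(∂_{b i} φ : 𝓢(E, ℂ)) x‖ + K * ‖φ x‖) := by
      rw [Finset.mul_sum]
      refine norm_sum_le_of_le _ fun i _ => ?_
      refine (norm_add_le _ _).trans ?_
      rw [norm_smul, norm_smul, Real.norm_eq_abs, Real.norm_eq_abs, abs_mul, hld, abs_two]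
      have hb : ‖b i‖ = 1 := b.norm_eq_one i
      have i1 := mul_le_mul_of_nonneg_right (hχ2 x (b i) hb) (norm_nonneg (fderiv ℝ φ x (b i)))
      have i2 := mul_le_mul_of_nonneg_right (hχ3 x (b i) hb) (norm_nonneg (φ x))
      linarith
    refine (norm_add_le _ _).trans ((add_le_add hA hBi).trans ?_)
    rw [← mul_add]
    gcongr
    simp only [hH]
    have : 0 ≤ ‖x‖ * ‖φ x‖ := by positivity
    linarith

end Cutoff

/-! ### Comparison along rays and polar coordinates. -/

section Radial

/-- If `g` is integrable on the half line, vanishes at `0` and its right derivative is at most the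
integrable function `G`, then `∫ G ≥ 0`. -/
theorem integral_Ioi_nonneg_of_hasDerivWithinAt_le {g g' G : ℝ → ℝ}
    (hg : ContinuousOn g (Ici 0)) (hg0 : g 0 = 0) (hgi : IntegrableOn g (Ioi 0))
    (hGi : IntegrableOn G (Ioi 0)) (hd : ∀ r, 0 < r → HasDerivWithinAt g (g' r) (Ioi r) r)
    (hle : ∀ r, 0 < r → g' r ≤ G r) : 0 ≤ ∫ r in Ioi 0, G r := by
  -- If the integral I were negative, comparison would give g ≤ I/2 < 0 near infinity. Integrability
  -- of g would then make the nonzero constant I/2 integrable on a half line.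
  by_contra! hneg
  set I := ∫ r in Ioi 0, G r
  have hlim : Tendsto (fun R => ∫ r in (0 : ℝ)..R, G r) atTop (𝓝 I) :=
    intervalIntegral_tendsto_integral_Ioi 0 hGi tendsto_id
  have hev : ∀ᶠ R in atTop, ∫ r in (0 : ℝ)..R, G r < I / 2 :=
    hlim.eventually_lt_const (by linarith)
  obtain ⟨R₀, hR₀⟩ := (hev.and (eventually_ge_atTop 0)).exists_forall_of_atTop
  have hb : ∀ R, R₀ ≤ R → g R ≤ I / 2 := by
    intro R hR
    obtain ⟨h1, h2⟩ := hR₀ R hR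
    have := intervalIntegral.sub_le_integral_of_hasDeriv_right_of_le (g := g) (g' := g') (φ := G)
      h2 (hg.mono Icc_subset_Ici_self) (fun x hx => hd x hx.1)
      (((integrableOn_Ici_iff_integrableOn_Ioi (by simp)).2 hGi).mono_set Icc_subset_Ici_self)
      (fun x hx => hle x hx.1)
    rw [hg0, sub_zero] at this
    linarith
  have hR₀' : 0 ≤ R₀ := (hR₀ R₀ le_rfl).2
  have hc : IntegrableOn (fun _ : ℝ => I / 2) (Ioi R₀) := by
    refine Integrable.mono (hgi.mono_set (Ioi_subset_Ioi hR₀')) aestronglyMeasurable_const ?_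
    filter_upwards [ae_restrict_mem measurableSet_Ioi] with x hx
    have h1 := hb x (le_of_lt hx)
    rw [Real.norm_eq_abs, Real.norm_eq_abs, abs_of_neg (by linarith), abs_of_neg (by linarith)]
    linarith
  rw [integrableOn_const_iff (by simp)] at hc
  rcases hc with h | h
  · have : I = 0 := by simpa using h
    linarith
  · simp at h

variable {E : Type*} [NormedAddCommGroup E] [InnerProductSpace ℝ E] [FiniteDimensional ℝ E]
  [MeasurableSpace E] [BorelSpace E] {N : ℕ}

theorem integrable_volumeIoiPow_iff {F : ℝ → ℝ} :
    Integrable (fun r : Ioi (0 : ℝ) => F r) (Measure.volumeIoiPow N) ↔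
      IntegrableOn (fun r => r ^ N * F r) (Ioi 0) := by
  rw [Measure.volumeIoiPow, integrable_withDensity_iff_integrable_smul' (by fun_prop) (by simp),
    integrableOn_iff_comap_subtypeVal measurableSet_Ioi, integrable_congr]
  refine .of_forall ?_
  rintro ⟨x, hx : 0 < x⟩
  simp (disch := positivity) [ENNReal.toReal_ofReal]

theorem integral_volumeIoiPow {F : ℝ → ℝ} :
    ∫ r : Ioi (0 : ℝ), F r ∂(Measure.volumeIoiPow N) = ∫ r in Ioi (0 : ℝ), r ^ N * F r := by
  simp only [Measure.volumeIoiPow, ENNReal.ofReal]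
  rw [integral_withDensity_eq_integral_smul,
    integral_subtype_comap measurableSet_Ioi fun a ↦ Real.toNNReal (a ^ N) • F a]
  · refine setIntegral_congr_fun measurableSet_Ioi fun x hx ↦ ?_
    simp only [NNReal.smul_def]
    rw [Real.coe_toNNReal _ (pow_nonneg (le_of_lt hx) _), smul_eq_mul]
  · exact (measurable_subtype_coe.pow_const _).real_toNNReal

theorem integrable_comp_polar (hN : Module.finrank ℝ E = N + 1) {G : E → ℝ} (hG : Integrable G) :
    Integrable (fun z : Metric.sphere (0 : E) 1 × Ioi (0 : ℝ) => G (z.2.1 • z.1.1))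
      ((volume : Measure E).toSphere.prod (Measure.volumeIoiPow N)) := by
  have hmp := (volume : Measure E).measurePreserving_homeomorphUnitSphereProd
  rw [hN, Nat.add_sub_cancel] at hmp
  rw [← hmp.integrable_comp_emb (Homeomorph.measurableEmbedding _)]
  have : Integrable (fun x : ({0}ᶜ : Set E) => G x) ((volume : Measure E).comap (↑)) := by
    have h1 : IntegrableOn G ({0}ᶜ : Set E) := hG.integrableOn
    rwa [integrableOn_iff_comap_subtypeVal (measurableSet_singleton _).compl] at h1
  refine this.congr (.of_forall fun x => ?_)
  have : (homeomorphUnitSphereProd E).symm (homeomorphUnitSphereProd E x) = x := by simp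
  have h2 := congrArg Subtype.val this
  rw [homeomorphUnitSphereProd_symm_apply_coe] at h2
  simp only [Function.comp]
  rw [h2]

theorem integrable_polar (hN : Module.finrank ℝ E = N + 1) {G : E → ℝ}
    (hG : Integrable G) : ∀ᵐ w : Metric.sphere (0 : E) 1 ∂(volume : Measure E).toSphere,
      IntegrableOn (fun r => r ^ N * G (r • (w : E))) (Ioi 0) := by
  filter_upwards [(integrable_comp_polar hN hG).prod_right_ae] with w hw
  exact (integrable_volumeIoiPow_iff (F := fun r => G (r • (w : E)))).1 hw

/-- By Fubini, integrability along a ray is known only for almost every direction. It is therefore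
offered as a premise to the inequality on each ray. -/
theorem integral_polar_nonneg (hN : Module.finrank ℝ E = N + 1) {G : E → ℝ}
    (hG : Integrable G)
    (h : ∀ᵐ w : Metric.sphere (0 : E) 1 ∂(volume : Measure E).toSphere,
      IntegrableOn (fun r => r ^ N * G (r • (w : E))) (Ioi 0) →
        0 ≤ ∫ r in Ioi (0 : ℝ), r ^ N * G (r • (w : E))) :
    0 ≤ ∫ x, G x := by
  have : Nontrivial E := Module.nontrivial_of_finrank_pos (R := ℝ) (by omega)
  have hmp := (volume : Measure E).measurePreserving_homeomorphUnitSphereProd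
  rw [hN, Nat.add_sub_cancel] at hmp
  have h1 : ∫ x, G x = ∫ x : ({0}ᶜ : Set E), G x ∂((volume : Measure E).comap (↑)) := by
    rw [integral_subtype_comap (measurableSet_singleton _).compl G, restrict_compl_singleton]
  have h2 : ∫ x : ({0}ᶜ : Set E), G x ∂((volume : Measure E).comap (↑)) =
      ∫ z : Metric.sphere (0 : E) 1 × Ioi (0 : ℝ), G (z.2.1 • z.1.1)
        ∂((volume : Measure E).toSphere.prod (Measure.volumeIoiPow N)) := by
    rw [← hmp.integral_comp (Homeomorph.measurableEmbedding _)]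
    refine integral_congr_ae (.of_forall fun x => ?_)
    have : (homeomorphUnitSphereProd E).symm (homeomorphUnitSphereProd E x) = x := by simp
    have h2 := congrArg Subtype.val this
    rw [homeomorphUnitSphereProd_symm_apply_coe] at h2
    simp only []
    rw [h2]
  rw [h1, h2, integral_prod _ (integrable_comp_polar hN hG)]
  refine integral_nonneg_of_ae ?_
  filter_upwards [h, integrable_polar hN hG] with w hw hw'
  have := integral_volumeIoiPow (N := N) (F := fun r => G (r • (w : E)))
  simp only [Pi.zero_apply]
  rw [this]
  exact hw hw'

/-- A radial comparison principle: if `F`, `G` are integrable and on each ray the right derivative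
of `r ^ N * F` is at most `r ^ N * G` (`N = dim E - 1`), then `∫ G ≥ 0`. -/
theorem integral_nonneg_of_radial_deriv_le (hN : Module.finrank ℝ E = N + 1) {F G : E → ℝ}
    (hF : Integrable F) (hG : Integrable G)
    (h : ∀ w : E, ‖w‖ = 1 → ∃ g g' : ℝ → ℝ, ContinuousOn g (Ici 0) ∧ g 0 = 0 ∧
      (∀ r, 0 < r → g r = r ^ N * F (r • w)) ∧
      ∀ r, 0 < r → HasDerivWithinAt g (g' r) (Ioi r) r ∧ g' r ≤ r ^ N * G (r • w)) :
    0 ≤ ∫ x, G x := by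
  refine integral_polar_nonneg hN hG ?_
  filter_upwards [integrable_polar hN hF] with w hw hw'
  obtain ⟨g, g', h1, h2, h3, h4⟩ := h w (by simp)
  refine integral_Ioi_nonneg_of_hasDerivWithinAt_le h1 h2 ?_ hw' (fun r hr => (h4 r hr).1)
    (fun r hr => (h4 r hr).2)
  exact hw.congr_fun (fun r hr => (h3 r hr).symm) measurableSet_Ioi

end Radial

/-! ### Rotation fields integrate to zero against radial weights, including singular ones. -/

section Spherical

open scoped ContDiff

variable {E : Type*} [NormedAddCommGroup E] [InnerProductSpace ℝ E] [FiniteDimensional ℝ E]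
  [MeasurableSpace E] [BorelSpace E]

/-- From dimension 3 on, the radial density r^{dim-1} compensates 1/r². The singular terms at the
origin met below are all of this order. -/
theorem integrable_of_le_inv_sq (hdim : 3 ≤ Module.finrank ℝ E) {g : E → ℝ} {C R : ℝ}
    (hm : AEStronglyMeasurable g volume) (hC : ∀ x, x ≠ 0 → |g x| ≤ C / ‖x‖ ^ 2)
    (hR : ∀ x, R ≤ ‖x‖ → g x = 0) : Integrable g := by
  have : Nontrivial E := Module.nontrivial_of_finrank_pos (R := ℝ) (by omega)
  have h1 : IntegrableOn (fun x : E => C / ‖x‖ ^ 2) (Metric.ball 0 R) := by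
    rw [integrableOn_fun_norm_addHaar volume (f := fun r => C / r ^ 2)]
    have h2 : IntegrableOn (fun y : ℝ => C * y ^ (Module.finrank ℝ E - 3)) (Ioo 0 R) := by
      refine (ContinuousOn.integrableOn_Icc (a := 0) (b := R) ?_).mono_set Ioo_subset_Icc_self
      fun_prop
    refine h2.congr_fun (fun y hy => ?_) measurableSet_Ioo
    have hy0 : y ≠ 0 := hy.1.ne'
    have : Module.finrank ℝ E - 1 = (Module.finrank ℝ E - 3) + 2 := by omega
    simp only [smul_eq_mul]
    rw [this, pow_add]
    field_simp
  have h3 : IntegrableOn g (Metric.ball 0 R) := by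
    refine Integrable.mono' h1 hm.restrict ?_
    have : ∀ᵐ x ∂(volume : Measure E), x ≠ 0 := by
      simp [ae_iff]
    filter_upwards [ae_restrict_of_ae this] with x hx
    exact hC x hx
  rw [← integrableOn_iff_integrable_of_support_subset (s := Metric.ball 0 R)]
  · exact h3
  · intro x hx
    by_contra h
    exact hx (hR x (by simpa using h))

theorem aestronglyMeasurable_comp_norm (hdim : 3 ≤ Module.finrank ℝ E) {ζ : ℝ → ℝ}
    (hζ : ContinuousOn ζ (Ioi 0)) :
    AEStronglyMeasurable (fun x : E => ζ ‖x‖) volume := by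
  have : Nontrivial E := Module.nontrivial_of_finrank_pos (R := ℝ) (by omega)
  rw [← restrict_compl_singleton (μ := (volume : Measure E)) 0]
  refine ContinuousOn.aestronglyMeasurable ?_ (measurableSet_singleton _).compl
  exact hζ.comp continuous_norm.continuousOn (fun x hx => by simpa using hx)

omit [InnerProductSpace ℝ E] [FiniteDimensional ℝ E] [MeasurableSpace E] [BorelSpace E] in
theorem HasCompactSupport.exists_norm_bound {g : E → ℝ} (hg : HasCompactSupport g) :
    ∃ R, ∀ x, R ≤ ‖x‖ → g x = 0 := by
  obtain ⟨R, hR⟩ := hg.isCompact.isBounded.subset_ball 0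
  refine ⟨R, fun x hx => ?_⟩
  by_contra h
  have := hR (subset_tsupport _ h)
  simp at this
  linarith

theorem integrable_radial_mul (hdim : 3 ≤ Module.finrank ℝ E) {ζ : ℝ → ℝ} {C : ℝ}
    (hζ : ContinuousOn ζ (Ioi 0)) (hC : ∀ r, 0 < r → |ζ r| ≤ C / r ^ 2) {g : E → ℝ}
    (hg : Continuous g) (hgc : HasCompactSupport g) : Integrable (fun x => ζ ‖x‖ * g x) := by
  obtain ⟨R, hR⟩ := hgc.exists_norm_bound
  obtain ⟨B, hB⟩ := hg.bounded_above_of_compact_support hgc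
  refine integrable_of_le_inv_sq hdim (C := C * B) (R := R)
    ((aestronglyMeasurable_comp_norm hdim hζ).mul hg.aestronglyMeasurable) ?_ ?_
  · intro x hx
    rw [abs_mul]
    have h1 := hC ‖x‖ (norm_pos_iff.2 hx)
    have h2 := hB x
    rw [Real.norm_eq_abs] at h2
    calc |ζ ‖x‖| * |g x| ≤ C / ‖x‖ ^ 2 * B :=
          mul_le_mul h1 h2 (abs_nonneg _) ((abs_nonneg _).trans h1)
      _ = _ := by ring
  · intro x hx
    rw [hR x hx, mul_zero]

/-- The rotation generator `x ↦ ⟪x, e₁⟫ ∂₂ g - ⟪x, e₂⟫ ∂₁ g`. -/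
noncomputable def rotDeriv (e₁ e₂ : E) (g : E → ℝ) (x : E) : ℝ :=
  inner ℝ e₁ x * fderiv ℝ g x e₂ - inner ℝ e₂ x * fderiv ℝ g x e₁

omit [FiniteDimensional ℝ E] [MeasurableSpace E] [BorelSpace E] in
theorem contDiff_rotDeriv (e₁ e₂ : E) {g : E → ℝ} (hg : ContDiff ℝ ∞ g) :
    ContDiff ℝ ∞ (rotDeriv e₁ e₂ g) :=
  ((contDiff_const.inner ℝ contDiff_id).mul (hg.fderiv_apply_const e₂)).sub
    ((contDiff_const.inner ℝ contDiff_id).mul (hg.fderiv_apply_const e₁))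

omit [FiniteDimensional ℝ E] [MeasurableSpace E] [BorelSpace E] in
theorem HasCompactSupport.fderiv_apply_const {g : E → ℝ} (hc : HasCompactSupport g) (v : E) :
    HasCompactSupport (fun x => fderiv ℝ g x v) := hc.fderiv_apply (𝕜 := ℝ) v

omit [FiniteDimensional ℝ E] [MeasurableSpace E] [BorelSpace E] in
theorem hasCompactSupport_rotDeriv (e₁ e₂ : E) {g : E → ℝ} (hc : HasCompactSupport g) :
    HasCompactSupport (rotDeriv e₁ e₂ g) :=
  ((hc.fderiv_apply_const e₂).mul_left).sub ((hc.fderiv_apply_const e₁).mul_left)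

/-- With Z' = η/2, the derivative of Z(‖x‖²) in direction e is η(‖x‖²)⟪e, x⟫. Integrating the mixed
second derivative of g against Z(‖x‖²) by parts in the two possible orders gives the two halves of
the rotation field, and these agree by symmetry of second derivatives. -/
theorem integral_continuous_mul_rotDeriv {η : ℝ → ℝ} (hη : Continuous η) {g : E → ℝ}
    (hg : ContDiff ℝ ∞ g) (hc : HasCompactSupport g) (e₁ e₂ : E) :
    ∫ x, η (‖x‖ ^ 2) * rotDeriv e₁ e₂ g x = 0 := by
  set Z : ℝ → ℝ := fun s => ∫ t in (0 : ℝ)..s, η t / 2 with hZ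
  have hZd : ∀ s, HasDerivAt Z (η s / 2) s := fun s =>
    intervalIntegral.integral_hasDerivAt_right (by apply Continuous.intervalIntegrable; fun_prop)
      (by apply Continuous.stronglyMeasurableAtFilter; fun_prop) (by fun_prop)
  have hF : ∀ x : E, HasFDerivAt (fun x : E => Z (‖x‖ ^ 2))
      ((η (‖x‖ ^ 2) / 2) • (2 • (innerSL ℝ x))) x := fun x =>
    HasDerivAt.comp_hasFDerivAt (f := fun x : E => ‖x‖ ^ 2) x (hZd (‖x‖ ^ 2))
      (hasStrictFDerivAt_norm_sq x).hasFDerivAt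
  have hFd : ∀ x v : E, fderiv ℝ (fun x : E => Z (‖x‖ ^ 2)) x v = η (‖x‖ ^ 2) * inner ℝ v x := by
    intro x v
    rw [(hF x).fderiv]
    simp [real_inner_comm]
    ring
  have hFc : Continuous (fun x : E => Z (‖x‖ ^ 2)) :=
    continuous_iff_continuousAt.2 fun x => (hF x).continuousAt
  have hηc : Continuous (fun x : E => η (‖x‖ ^ 2)) := by fun_prop
  have hint : ∀ {k : E → ℝ}, Continuous k → HasCompactSupport k → Integrable k volume :=
    fun hk hkc => hk.integrable_of_hasCompactSupport hkc
  have ibp : ∀ e e' : E, ∫ x, Z (‖x‖ ^ 2) * fderiv ℝ (fderiv ℝ g) x e e' =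
      - ∫ x, η (‖x‖ ^ 2) * (inner ℝ e x * fderiv ℝ g x e') := by
    intro e e'
    have hgc := hg.fderiv_apply_const e'
    have hgcc := hc.fderiv_apply_const e'
    have := integral_mul_fderiv_eq_neg_fderiv_mul_of_integrable (μ := (volume : Measure E))
      (f := fun x : E => Z (‖x‖ ^ 2)) (g := fun x => fderiv ℝ g x e') (v := e) ?_ ?_ ?_
      (fun x _ => (hF x).differentiableAt) (fun x _ => hgc.differentiable (by simp) x)
    · simp_rw [fderiv_fderiv_apply hg, hFd, mul_assoc] at this
      exact this
    · simp_rw [hFd]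
      refine hint ?_ hgcc.mul_left
      exact (hηc.mul (continuous_const.inner continuous_id)).mul hgc.continuous
    · refine hint ?_ (hgcc.fderiv_apply_const e).mul_left
      exact hFc.mul (hgc.fderiv_apply_const e).continuous
    · exact hint (hFc.mul hgc.continuous) hgcc.mul_left
  have hint' : ∀ e e' : E, Integrable (fun x => η (‖x‖ ^ 2) * (inner ℝ e x * fderiv ℝ g x e')) :=
    fun e e' => hint (hηc.mul ((continuous_const.inner continuous_id).mul
      (hg.fderiv_apply_const e').continuous)) (hc.fderiv_apply_const e').mul_left.mul_left
  have hsymm : ∀ x, fderiv ℝ (fderiv ℝ g) x e₁ e₂ = fderiv ℝ (fderiv ℝ g) x e₂ e₁ := fun x =>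
    ((hg.of_le (m := 2) (WithTop.coe_le_coe.2 le_top)).contDiffAt.isSymmSndFDerivAt (by simp)).eq e₁ e₂
  have h12 := ibp e₁ e₂
  have h21 := ibp e₂ e₁
  simp_rw [hsymm] at h12
  simp_rw [rotDeriv, mul_sub]
  rw [integral_sub (hint' e₁ e₂) (hint' e₂ e₁)]
  linarith

/-- The factor r³/(r³ + 1/(j+1)) makes ζ continuous at the origin, since |ζ| ≤ C/r². It increases to
1, so |ζ| times the rotation derivative dominates and the continuous case passes to the limit. -/
theorem integral_radial_mul_rotDeriv (hdim : 3 ≤ Module.finrank ℝ E) {ζ : ℝ → ℝ} {C : ℝ}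
    (hζ : ContinuousOn ζ (Ioi 0)) (hC : ∀ r, 0 < r → |ζ r| ≤ C / r ^ 2) {g : E → ℝ}
    (hg : ContDiff ℝ ∞ g) (hc : HasCompactSupport g) (e₁ e₂ : E) :
    ∫ x, ζ ‖x‖ * rotDeriv e₁ e₂ g x = 0 := by
  have : Nontrivial E := Module.nontrivial_of_finrank_pos (R := ℝ) (by omega)
  have hC0 : 0 ≤ C := by
    have := (abs_nonneg _).trans (hC 1 one_pos); simpa using this
  set κ : ℕ → ℝ → ℝ := fun j r => ζ r * (r ^ 3 / (r ^ 3 + 1 / ((j : ℝ) + 1))) with hκ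
  have hj : ∀ j : ℕ, 0 < 1 / ((j : ℝ) + 1) := fun j => by positivity
  have hκc : ∀ j, Continuous (fun s : ℝ => κ j √s) := by
    intro j
    have hon : ContinuousOn (κ j) (Ici 0) := by
      intro r hr
      rcases eq_or_lt_of_le (show (0 : ℝ) ≤ r from hr) with rfl | hr0
      · have h0 : κ j 0 = 0 := by simp [hκ]
        rw [ContinuousWithinAt, h0]
        have hb : ∀ r ∈ Ici (0 : ℝ), ‖κ j r‖ ≤ C * ((j : ℝ) + 1) * r := by
          intro r hr
          rcases eq_or_lt_of_le (show (0 : ℝ) ≤ r from hr) with rfl | hr0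
          · simp [h0]
          · rw [hκ, Real.norm_eq_abs, abs_mul, abs_of_nonneg (a := r ^ 3 / _) (by positivity)]
            have h1 : r ^ 3 / (r ^ 3 + 1 / ((j : ℝ) + 1)) ≤ r ^ 3 * ((j : ℝ) + 1) := by
              rw [div_le_iff₀ (by positivity)]
              have : r ^ 3 * ((j : ℝ) + 1) * (r ^ 3 + 1 / ((j : ℝ) + 1)) =
                r ^ 3 + r ^ 3 * ((j : ℝ) + 1) * r ^ 3 := by field_simp; ring
              rw [this]
              have : 0 ≤ r ^ 3 * ((j : ℝ) + 1) * r ^ 3 := by positivity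
              linarith
            calc _ ≤ C / r ^ 2 * (r ^ 3 * ((j : ℝ) + 1)) :=
                  mul_le_mul (hC r hr0) h1 (by positivity) (by positivity)
              _ = _ := by field_simp
        refine squeeze_zero_norm' (eventually_nhdsWithin_of_forall hb) ?_
        have : Tendsto (fun r : ℝ => C * ((j : ℝ) + 1) * r) (𝓝 0) (𝓝 (C * ((j : ℝ) + 1) * 0)) :=
          (continuous_const.mul continuous_id).tendsto 0
        rw [mul_zero] at this
        exact this.mono_left nhdsWithin_le_nhds
      · have h1 : ContinuousAt ζ r := hζ.continuousAt (Ioi_mem_nhds hr0)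
        have h2 : r ^ 3 + 1 / ((j : ℝ) + 1) ≠ 0 := by positivity
        refine ContinuousAt.continuousWithinAt (h1.mul ?_)
        exact ((continuousAt_id.pow 3).div ((continuousAt_id.pow 3).add continuousAt_const) h2)
    exact hon.comp_continuous Real.continuous_sqrt (fun s => Real.sqrt_nonneg s)
  have hzero : ∀ j, ∫ x, κ j ‖x‖ * rotDeriv e₁ e₂ g x = 0 := by
    intro j
    have := integral_continuous_mul_rotDeriv (hκc j) hg hc e₁ e₂
    simpa using this
  have hlim : Tendsto (fun j => ∫ x, κ j ‖x‖ * rotDeriv e₁ e₂ g x) atTop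
      (𝓝 (∫ x, ζ ‖x‖ * rotDeriv e₁ e₂ g x)) := by
    have hgc := (contDiff_rotDeriv e₁ e₂ hg).continuous
    refine tendsto_integral_of_dominated_convergence (fun x => ‖ζ ‖x‖ * rotDeriv e₁ e₂ g x‖) ?_ ?_ ?_ ?_
    · intro j
      have h1 : Continuous (fun x : E => κ j √(‖x‖ ^ 2)) := (hκc j).comp (by fun_prop)
      simp only [Real.sqrt_sq (norm_nonneg _)] at h1
      exact (h1.mul hgc).aestronglyMeasurable
    · exact (integrable_radial_mul hdim hζ hC hgc (hasCompactSupport_rotDeriv e₁ e₂ hc)).norm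
    · intro j
      refine ae_of_all _ fun x => ?_
      have hk : ‖κ j ‖x‖‖ ≤ ‖ζ ‖x‖‖ := by
        rw [hκ, norm_mul]
        refine mul_le_of_le_one_right (norm_nonneg _) ?_
        rw [Real.norm_eq_abs, abs_of_nonneg (by positivity)]
        exact div_le_one_of_le₀ (by linarith [hj j]) (by positivity)
      calc ‖κ j ‖x‖ * rotDeriv e₁ e₂ g x‖ = ‖κ j ‖x‖‖ * ‖rotDeriv e₁ e₂ g x‖ := norm_mul _ _
        _ ≤ ‖ζ ‖x‖‖ * ‖rotDeriv e₁ e₂ g x‖ := mul_le_mul_of_nonneg_right hk (norm_nonneg _)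
        _ = ‖ζ ‖x‖ * rotDeriv e₁ e₂ g x‖ := (norm_mul _ _).symm
    · have : ∀ᵐ x ∂(volume : Measure E), x ≠ 0 := by
        simp [ae_iff]
      filter_upwards [this] with x hx
      refine Tendsto.mul_const _ ?_
      have hx0 : 0 < ‖x‖ := norm_pos_iff.2 hx
      have h1 : Tendsto (fun j : ℕ => ‖x‖ ^ 3 / (‖x‖ ^ 3 + 1 / ((j : ℝ) + 1))) atTop
          (𝓝 (‖x‖ ^ 3 / (‖x‖ ^ 3 + 0))) :=
        tendsto_const_nhds.div (tendsto_const_nhds.add tendsto_one_div_add_atTop_nhds_zero_nat)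
          (by positivity)
      rw [add_zero, div_self (by positivity)] at h1
      simpa [hκ] using h1.const_mul (ζ ‖x‖)
  simp_rw [hzero] at hlim
  exact (tendsto_nhds_unique hlim tendsto_const_nhds)

end Spherical

/-! ### Green's formula on spheres, by summing over the rotation fields. -/

section Green

open scoped ContDiff

variable {E : Type*} [NormedAddCommGroup E] [InnerProductSpace ℝ E]

theorem fderiv_mul_rotDeriv {f v : E → ℝ} (hf : ContDiff ℝ ∞ f) (hv : ContDiff ℝ ∞ v)
    (e₁ e₂ x w : E) :
    fderiv ℝ (fun y => v y * rotDeriv e₁ e₂ f y) x w =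
      fderiv ℝ v x w * rotDeriv e₁ e₂ f x +
      v x * (inner ℝ e₁ w * fderiv ℝ f x e₂ + inner ℝ e₁ x * fderiv ℝ (fderiv ℝ f) x w e₂ -
        (inner ℝ e₂ w * fderiv ℝ f x e₁ + inner ℝ e₂ x * fderiv ℝ (fderiv ℝ f) x w e₁)) := by
  have hi : ∀ e : E, HasFDerivAt (fun y : E => inner ℝ e y) (innerSL ℝ e) x :=
    fun e => (innerSL ℝ e).hasFDerivAt
  have hd : ∀ e : E, HasFDerivAt (fun y => fderiv ℝ f y e) (fderiv ℝ (fun y => fderiv ℝ f y e) x) x :=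
    fun e => ((hf.fderiv_apply_const e).differentiable (by simp) x).hasFDerivAt
  have h := ((hv.differentiable (by simp) x).hasFDerivAt).mul
    (((hi e₁).mul (hd e₂)).sub ((hi e₂).mul (hd e₁)))
  have h' : HasFDerivAt (fun y => v y * rotDeriv e₁ e₂ f y) _ x := h
  rw [h'.fderiv]
  simp only [rotDeriv, _root_.add_apply, _root_.sub_apply, _root_.smul_apply, smul_eq_mul,
    innerSL_apply_apply, fderiv_fderiv_apply hf, Pi.sub_apply, Pi.mul_apply]
  ring

variable {ι : Type*} [Fintype ι]

/-- `r²` times the product of the angular parts of the gradients of `f` and `v`. -/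
noncomputable def angGrad (b : OrthonormalBasis ι ℝ E) (f v : E → ℝ) (x : E) : ℝ :=
  ‖x‖ ^ 2 * ∑ i, fderiv ℝ f x (b i) * fderiv ℝ v x (b i) - fderiv ℝ f x x * fderiv ℝ v x x

theorem sum_inner_mul_fderiv (b : OrthonormalBasis ι ℝ E) (L : E →L[ℝ] ℝ) (x : E) :
    ∑ i, inner ℝ (b i) x * L (b i) = L x := by
  conv_rhs => rw [← b.sum_repr' x]
  simp

theorem angGrad_self_nonneg (b : OrthonormalBasis ι ℝ E) (f : E → ℝ) (x : E) :
    0 ≤ angGrad b f f x := by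
  have h := Finset.sum_mul_sq_le_sq_mul_sq Finset.univ (fun i => inner ℝ (b i) x)
    (fun i => fderiv ℝ f x (b i))
  rw [sum_inner_mul_fderiv b, b.sum_sq_inner_right] at h
  simp only [angGrad, ← sq]
  linarith

/-- This is Lagrange's identity for x and the two gradients. The factor 2 appears because each
rotation is counted for both orderings of its indices. -/
theorem sum_rotDeriv_mul_rotDeriv (b : OrthonormalBasis ι ℝ E) (f v : E → ℝ) (x : E) :
    ∑ i, ∑ j, rotDeriv (b i) (b j) v x * rotDeriv (b i) (b j) f x = 2 * angGrad b f v x := by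
  have h1 := sum_inner_mul_fderiv b (fderiv ℝ f x) x
  have h2 := sum_inner_mul_fderiv b (fderiv ℝ v x) x
  have h3 := b.sum_sq_inner_right x
  set X : ι → ℝ := fun i => inner ℝ (b i) x
  set A : ι → ℝ := fun i => fderiv ℝ f x (b i)
  set B : ι → ℝ := fun i => fderiv ℝ v x (b i)
  have e : ∀ i j, rotDeriv (b i) (b j) v x * rotDeriv (b i) (b j) f x =
      X i ^ 2 * (A j * B j) + (A i * B i) * X j ^ 2 - (X i * A i) * (X j * B j) -
        (X i * B i) * (X j * A j) := by
    intro i j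
    simp only [rotDeriv, X, A, B]
    ring
  simp_rw [e, Finset.sum_sub_distrib, Finset.sum_add_distrib, ← Finset.mul_sum, ← Finset.sum_mul]
  change ∑ i, X i * A i = _ at h1
  change ∑ i, X i * B i = _ at h2
  change ∑ i, X i ^ 2 = _ at h3
  rw [h1, h2, h3, angGrad]
  ring

/-- The summand is a rotation field applied twice to f, in the expanded shape produced by
`fderiv_mul_rotDeriv`. The sum of the squared rotation fields is twice the spherical Laplacian. -/
theorem sum_rot_second (b : OrthonormalBasis ι ℝ E) (f : E → ℝ) (x : E)
    {n : ℝ} (hn : (Fintype.card ι : ℝ) = n + 1) :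
    ∑ i, ∑ j, (inner ℝ (b i) x * (inner ℝ (b i) (b j) * fderiv ℝ f x (b j) +
        inner ℝ (b i) x * fderiv ℝ (fderiv ℝ f) x (b j) (b j) -
        (inner ℝ (b j) (b j) * fderiv ℝ f x (b i) +
          inner ℝ (b j) x * fderiv ℝ (fderiv ℝ f) x (b j) (b i))) -
      inner ℝ (b j) x * (inner ℝ (b i) (b i) * fderiv ℝ f x (b j) +
        inner ℝ (b i) x * fderiv ℝ (fderiv ℝ f) x (b i) (b j) -
        (inner ℝ (b j) (b i) * fderiv ℝ f x (b i) +
          inner ℝ (b j) x * fderiv ℝ (fderiv ℝ f) x (b i) (b i)))) =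
    2 * (‖x‖ ^ 2 * ∑ i, fderiv ℝ (fderiv ℝ f) x (b i) (b i) - fderiv ℝ (fderiv ℝ f) x x x -
      n * fderiv ℝ f x x) := by
  classical
  have h1 := sum_inner_mul_fderiv b (fderiv ℝ f x) x
  have h3 := b.sum_sq_inner_right x
  have h4 : ∑ i, ∑ j, inner ℝ (b i) x * (inner ℝ (b j) x * fderiv ℝ (fderiv ℝ f) x (b i) (b j)) =
      fderiv ℝ (fderiv ℝ f) x x x := by
    simp_rw [← Finset.mul_sum, sum_inner_mul_fderiv b]
    exact sum_inner_mul_fderiv b ((fderiv ℝ (fderiv ℝ f) x).flip x) x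
  have h4' : ∑ i, ∑ j, inner ℝ (b i) x * (inner ℝ (b j) x * fderiv ℝ (fderiv ℝ f) x (b j) (b i)) =
      fderiv ℝ (fderiv ℝ f) x x x := by
    rw [Finset.sum_comm, ← h4]
    exact Finset.sum_congr rfl fun i _ => Finset.sum_congr rfl fun j _ => by ring
  have hsq : ∀ i, inner ℝ (b i) (b i) = (1 : ℝ) := fun i => by simp
  have hij : ∀ i j, inner ℝ (b i) (b j) = if i = j then (1 : ℝ) else 0 :=
    fun i j => orthonormal_iff_ite.1 b.orthonormal i j
  set X : ι → ℝ := fun i => inner ℝ (b i) x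
  set A : ι → ℝ := fun i => fderiv ℝ f x (b i)
  set H : ι → ι → ℝ := fun i j => fderiv ℝ (fderiv ℝ f) x (b i) (b j)
  change ∑ i, X i * A i = _ at h1
  change ∑ i, X i ^ 2 = _ at h3
  change ∑ i, ∑ j, X i * (X j * H i j) = _ at h4
  change ∑ i, ∑ j, X i * (X j * H j i) = _ at h4'
  have e : ∀ i j, (X i * (inner ℝ (b i) (b j) * A j + X i * H j j -
        (inner ℝ (b j) (b j) * A i + X j * H j i)) -
      X j * (inner ℝ (b i) (b i) * A j + X i * H i j -
        (inner ℝ (b j) (b i) * A i + X j * H i i))) =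
      (if i = j then X i * A j + X j * A i else 0) + X i ^ 2 * H j j + H i i * X j ^ 2 - X i * A i - X j * A j
        - X i * (X j * H i j) - X i * (X j * H j i) := by
    intro i j
    rw [hsq, hsq, hij i j, hij j i]
    by_cases h : i = j
    · subst h; simp; ring
    · simp [h, Ne.symm h]; ring
  change ∑ i, ∑ j, (X i * (inner ℝ (b i) (b j) * A j + X i * H j j -
        (inner ℝ (b j) (b j) * A i + X j * H j i)) -
      X j * (inner ℝ (b i) (b i) * A j + X i * H i j -
        (inner ℝ (b j) (b i) * A i + X j * H i i))) = 2 * (‖x‖ ^ 2 * ∑ i, H i i - _ - _)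
  simp_rw [e, Finset.sum_sub_distrib, Finset.sum_add_distrib]
  rw [h4, h4']
  simp_rw [← Finset.mul_sum, ← Finset.sum_mul]
  simp only [Finset.sum_ite_eq, Finset.mem_univ, if_true, Finset.sum_add_distrib, Finset.sum_const,
    Finset.card_univ, nsmul_eq_mul]
  have hs : ∑ i, X i * ((Fintype.card ι : ℝ) * A i) = (n + 1) * fderiv ℝ f x x := by
    rw [← h1, Finset.mul_sum, hn]
    exact Finset.sum_congr rfl fun i _ => by ring
  rw [hs, h1, h3, hn]
  ring

/-- `r²` times the angular part of the Laplacian (`n = dim E - 1`). -/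
noncomputable def angLap (b : OrthonormalBasis ι ℝ E) (n : ℝ) (f : E → ℝ) (x : E) : ℝ :=
  ‖x‖ ^ 2 * ∑ i, fderiv ℝ (fderiv ℝ f) x (b i) (b i) - fderiv ℝ (fderiv ℝ f) x x x -
      n * fderiv ℝ f x x

/-- The Leibniz rule combines the two preceding sums. The left side integrates to zero against any
admissible radial weight, which makes this Green's formula in pointwise form. -/
theorem sum_rotDeriv_mul (b : OrthonormalBasis ι ℝ E) {f v : E → ℝ} (hf : ContDiff ℝ ∞ f)
    (hv : ContDiff ℝ ∞ v) {n : ℝ} (hn : (Fintype.card ι : ℝ) = n + 1) (x : E) :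
    ∑ i, ∑ j, rotDeriv (b i) (b j) (fun y => v y * rotDeriv (b i) (b j) f y) x =
      2 * (angGrad b f v x + v x * angLap b n f x) := by
  rw [mul_add, ← sum_rotDeriv_mul_rotDeriv b f v x]
  have := sum_rot_second b f x hn
  rw [angLap, show 2 * (v x * (‖x‖ ^ 2 * ∑ i, fderiv ℝ (fderiv ℝ f) x (b i) (b i) -
    fderiv ℝ (fderiv ℝ f) x x x - n * fderiv ℝ f x x)) = v x * (2 * (‖x‖ ^ 2 *
    ∑ i, fderiv ℝ (fderiv ℝ f) x (b i) (b i) -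
    fderiv ℝ (fderiv ℝ f) x x x - n * fderiv ℝ f x x)) by ring, ← this, Finset.mul_sum,
    ← Finset.sum_add_distrib]
  refine Finset.sum_congr rfl fun i _ => ?_
  rw [Finset.mul_sum, ← Finset.sum_add_distrib]
  refine Finset.sum_congr rfl fun j _ => ?_
  rw [rotDeriv, fderiv_mul_rotDeriv hf hv, fderiv_mul_rotDeriv hf hv]
  simp only [rotDeriv]
  ring

theorem continuous_angGrad (b : OrthonormalBasis ι ℝ E) {f v : E → ℝ} (hf : ContDiff ℝ ∞ f)
    (hv : ContDiff ℝ ∞ v) : Continuous (angGrad b f v) := by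
  have h1 := hf.continuous_fderiv (by simp)
  have h2 := hv.continuous_fderiv (by simp)
  unfold angGrad
  fun_prop

theorem continuous_angLap (b : OrthonormalBasis ι ℝ E) (n : ℝ) {f : E → ℝ} (hf : ContDiff ℝ ∞ f) :
    Continuous (angLap b n f) := by
  have h1 := hf.continuous_fderiv (by simp)
  have h2 := (hf.fderiv_right (m := ∞) (by simp)).continuous_fderiv (by simp)
  unfold angLap
  fun_prop

theorem angGrad_eq_zero_of_notMem (b : OrthonormalBasis ι ℝ E) {f : E → ℝ} (v : E → ℝ) {x : E}
    (hx : x ∉ tsupport f) : angGrad b f v x = 0 := by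
  have : fderiv ℝ f x = 0 := by
    by_contra h
    exact hx (support_fderiv_subset ℝ h)
  simp [angGrad, this]

theorem hasCompactSupport_angGrad (b : OrthonormalBasis ι ℝ E) {f : E → ℝ} (v : E → ℝ)
    (hf : HasCompactSupport f) : HasCompactSupport (angGrad b f v) :=
  hf.of_isClosed_subset (isClosed_tsupport _) <| by
    refine closure_minimal (fun x hx => ?_) (isClosed_tsupport f)
    by_contra h
    exact hx (angGrad_eq_zero_of_notMem b v h)

variable [FiniteDimensional ℝ E] [MeasurableSpace E] [BorelSpace E]

/-- Green's formula on spheres, integrated against a radial weight. -/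
theorem integral_radial_mul_angLap (b : OrthonormalBasis ι ℝ E) {n : ℝ}
    (hn : (Fintype.card ι : ℝ) = n + 1) (hdim : 3 ≤ Module.finrank ℝ E) {ζ : ℝ → ℝ} {C : ℝ}
    (hζ : ContinuousOn ζ (Ioi 0)) (hC : ∀ r, 0 < r → |ζ r| ≤ C / r ^ 2) {f v : E → ℝ}
    (hf : ContDiff ℝ ∞ f) (hfc : HasCompactSupport f) (hv : ContDiff ℝ ∞ v)
    (hvc : HasCompactSupport v) :
    ∫ x, ζ ‖x‖ * (v x * angLap b n f x) = - ∫ x, ζ ‖x‖ * angGrad b f v x := by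
  have hg : ∀ i j, ContDiff ℝ ∞ (fun y => v y * rotDeriv (b i) (b j) f y) := fun i j =>
    hv.mul (contDiff_rotDeriv _ _ hf)
  have hgc : ∀ i j, HasCompactSupport (fun y => v y * rotDeriv (b i) (b j) f y) := fun i j =>
    hvc.mul_right
  have hint : ∀ i j, Integrable
      (fun x => ζ ‖x‖ * rotDeriv (b i) (b j) (fun y => v y * rotDeriv (b i) (b j) f y) x) :=
    fun i j => integrable_radial_mul hdim hζ hC (contDiff_rotDeriv _ _ (hg i j)).continuous
      (hasCompactSupport_rotDeriv _ _ (hgc i j))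
  have h1 : ∫ x, ζ ‖x‖ * (2 * (angGrad b f v x + v x * angLap b n f x)) = 0 := by
    simp_rw [← sum_rotDeriv_mul b hf hv hn, Finset.mul_sum]
    rw [integral_finsetSum _ fun i _ => integrable_finsetSum _ fun j _ => hint i j]
    refine Finset.sum_eq_zero fun i _ => ?_
    rw [integral_finsetSum _ fun j _ => hint i j]
    exact Finset.sum_eq_zero fun j _ =>
      integral_radial_mul_rotDeriv hdim hζ hC (hg i j) (hgc i j) _ _
  have i1 : Integrable (fun x => ζ ‖x‖ * angGrad b f v x) :=
    integrable_radial_mul hdim hζ hC (continuous_angGrad b hf hv) (hasCompactSupport_angGrad b v hfc)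
  have i2 : Integrable (fun x => ζ ‖x‖ * (v x * angLap b n f x)) :=
    integrable_radial_mul hdim hζ hC (hv.continuous.mul (continuous_angLap b n hf)) hvc.mul_right
  have e : ∀ x, ζ ‖x‖ * (2 * (angGrad b f v x + v x * angLap b n f x)) =
      2 * (ζ ‖x‖ * angGrad b f v x + ζ ‖x‖ * (v x * angLap b n f x)) := fun x => by ring
  simp_rw [e] at h1
  rw [integral_const_mul, integral_add i1 i2] at h1
  linarith

end Green

/-! ### Admissible radial weights, bounded measurable functions, and derivatives along rays. -/

section Weights

open scoped ContDiff

/-- A radial weight exponent `ϕ` with derivative `ψ`, whose right derivative is `ψ'`. -/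
structure RadialPhase (ϕ ψ ψ' : ℝ → ℝ) (B : ℝ) : Prop where
  cont_phase : ContinuousOn ϕ (Ici 0)
  cont_deriv : ContinuousOn ψ (Ici 0)
  deriv_phase : ∀ r, 0 < r → HasDerivWithinAt ϕ (ψ r) (Ioi r) r
  -- Only a right derivative is asked for, because the derivative of the phase has a corner at r =
  -- a.
  deriv_deriv : ∀ r, 0 < r → HasDerivWithinAt ψ (ψ' r) (Ioi r) r
  measurable : Measurable ψ'
  bound_phase : ∀ r, 0 < r → |ϕ r| ≤ B
  bound_deriv : ∀ r, 0 < r → |ψ r| ≤ B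
  bound_second : ∀ r, 0 < r → |ψ' r| ≤ B

/-- A radial multiplier `μ` with right derivative `μ'`. -/
structure RadialMultiplier (μ μ' : ℝ → ℝ) (B : ℝ) : Prop where
  cont : ContinuousOn μ (Ici 0)
  -- This makes the energy flux vanish at the origin, also in dimension three where no positive
  -- power of r helps.
  zero : μ 0 = 0
  deriv : ∀ r, 0 < r → HasDerivWithinAt μ (μ' r) (Ioi r) r
  measurable : Measurable μ'
  nonneg : ∀ r, 0 < r → 0 ≤ μ r
  bound : ∀ r, 0 < r → μ r ≤ B
  -- Linear growth keeps μ/r bounded and μ/r³ of order r⁻², as Green's formula requires.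
  bound_linear : ∀ r, 0 < r → μ r ≤ B * r
  bound_deriv : ∀ r, 0 < r → |μ' r| ≤ B
  -- This gives the coefficient 2μ/r - μ' of the spherical energy its sign.
  mul_deriv_le : ∀ r, 0 < r → r * μ' r ≤ 2 * μ r

variable {E : Type*} [NormedAddCommGroup E] [InnerProductSpace ℝ E] [FiniteDimensional ℝ E]
  [MeasurableSpace E] [BorelSpace E]

/-- Essentially bounded and measurable. -/
def BddMeas (g : E → ℝ) : Prop :=
  AEStronglyMeasurable g volume ∧ ∃ C, ∀ᵐ x, |g x| ≤ C

theorem BddMeas.add {f g : E → ℝ} (hf : BddMeas f) (hg : BddMeas g) :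
    BddMeas (fun x => f x + g x) := by
  obtain ⟨hf, C, hC⟩ := hf
  obtain ⟨hg, D, hD⟩ := hg
  refine ⟨hf.add hg, C + D, ?_⟩
  filter_upwards [hC, hD] with x h1 h2
  exact (abs_add_le _ _).trans (add_le_add h1 h2)

theorem BddMeas.neg {f : E → ℝ} (hf : BddMeas f) : BddMeas (fun x => -f x) := by
  obtain ⟨hf, C, hC⟩ := hf
  exact ⟨hf.neg, C, by simpa using hC⟩

theorem BddMeas.sub {f g : E → ℝ} (hf : BddMeas f) (hg : BddMeas g) :
    BddMeas (fun x => f x - g x) := by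
  simpa only [sub_eq_add_neg] using hf.add hg.neg

theorem BddMeas.mul {f g : E → ℝ} (hf : BddMeas f) (hg : BddMeas g) :
    BddMeas (fun x => f x * g x) := by
  obtain ⟨hf, C, hC⟩ := hf
  obtain ⟨hg, D, hD⟩ := hg
  refine ⟨hf.mul hg, C * D, ?_⟩
  filter_upwards [hC, hD] with x h1 h2
  rw [abs_mul]
  exact mul_le_mul h1 h2 (abs_nonneg _) ((abs_nonneg _).trans h1)

theorem BddMeas.pow {f : E → ℝ} (hf : BddMeas f) : BddMeas (fun x => f x ^ 2) := by
  simpa only [sq] using hf.mul hf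

theorem BddMeas.const (c : ℝ) : BddMeas (fun _ : E => c) :=
  ⟨aestronglyMeasurable_const, |c|, by simp⟩

theorem BddMeas.of_hasCompactSupport {g : E → ℝ} (hg : Continuous g) (hc : HasCompactSupport g) :
    BddMeas g := by
  obtain ⟨C, hC⟩ := hg.bounded_above_of_compact_support hc
  exact ⟨hg.aestronglyMeasurable, C, ae_of_all _ hC⟩

theorem ae_ne_zero (hdim : 3 ≤ Module.finrank ℝ E) : ∀ᵐ x ∂(volume : Measure E), x ≠ 0 := by
  have : Nontrivial E := Module.nontrivial_of_finrank_pos (R := ℝ) (by omega)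
  simp [ae_iff]

theorem BddMeas.of_continuousOn (hdim : 3 ≤ Module.finrank ℝ E) {ζ : ℝ → ℝ} {B : ℝ}
    (hζ : ContinuousOn ζ (Ioi 0)) (hB : ∀ r, 0 < r → |ζ r| ≤ B) : BddMeas (fun x : E => ζ ‖x‖) := by
  refine ⟨aestronglyMeasurable_comp_norm hdim hζ, B, ?_⟩
  filter_upwards [ae_ne_zero hdim] with x hx
  exact hB _ (norm_pos_iff.2 hx)

theorem BddMeas.of_measurable (hdim : 3 ≤ Module.finrank ℝ E) {ζ : ℝ → ℝ} {B : ℝ}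
    (hζ : Measurable ζ) (hB : ∀ r, 0 < r → |ζ r| ≤ B) : BddMeas (fun x : E => ζ ‖x‖) := by
  refine ⟨(hζ.comp measurable_norm).aestronglyMeasurable, B, ?_⟩
  filter_upwards [ae_ne_zero hdim] with x hx
  exact hB _ (norm_pos_iff.2 hx)

/-- Truncating g at its essential bound gives a bound at every nonzero point, the form needed by
`integrable_of_le_inv_sq`, without changing the integral. -/
theorem BddMeas.integrable_div_sq (hdim : 3 ≤ Module.finrank ℝ E) {g : E → ℝ} (hg : BddMeas g)
    {R : ℝ} (hR : ∀ x, R ≤ ‖x‖ → g x = 0) : Integrable (fun x => g x / ‖x‖ ^ 2) := by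
  obtain ⟨hm, C, hC⟩ := hg
  set g₁ : E → ℝ := fun x => max (min (g x) C) (-C) with hg₁
  have he : g =ᵐ[volume] g₁ := by
    filter_upwards [hC] with x hx
    rw [abs_le] at hx
    simp [hg₁, hx.1, hx.2]
  have hC0 : 0 ≤ C := by
    obtain ⟨x, hx⟩ := (hC.and (ae_ne_zero hdim)).exists
    exact (abs_nonneg _).trans hx.1
  have hm₁ : AEStronglyMeasurable g₁ volume := hm.congr he
  have hi : Integrable (fun x => g₁ x / ‖x‖ ^ 2) := by
    refine integrable_of_le_inv_sq hdim (C := C) (R := R) ?_ ?_ ?_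
    · exact (hm₁.aemeasurable.div (by fun_prop)).aestronglyMeasurable
    · intro x hx
      rw [abs_div, abs_of_nonneg (a := ‖x‖ ^ 2) (by positivity)]
      gcongr
      rw [abs_le]
      exact ⟨le_max_right _ _, max_le (min_le_right _ _) (by linarith)⟩
    · intro x hx
      simp [hg₁, hR x hx, hC0]
  refine hi.congr ?_
  filter_upwards [he] with x hx
  rw [hx]

variable {ϕ ψ ψ' μ μ' : ℝ → ℝ} {B : ℝ}

theorem RadialPhase.bddMeas_exp (hdim : 3 ≤ Module.finrank ℝ E) (h : RadialPhase ϕ ψ ψ' B) :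
    BddMeas (fun x : E => Real.exp (2 * ϕ ‖x‖)) := by
  refine BddMeas.of_continuousOn hdim (ζ := fun r => Real.exp (2 * ϕ r)) (B := Real.exp (2 * B)) ?_ ?_
  · exact ((h.cont_phase.mono Ioi_subset_Ici_self).const_mul 2).rexp
  · intro r hr
    rw [abs_of_pos (Real.exp_pos _)]
    have := (abs_le.1 (h.bound_phase r hr)).2
    gcongr

theorem RadialPhase.bddMeas_deriv (hdim : 3 ≤ Module.finrank ℝ E) (h : RadialPhase ϕ ψ ψ' B) :
    BddMeas (fun x : E => ψ ‖x‖) :=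
  BddMeas.of_continuousOn hdim (h.cont_deriv.mono Ioi_subset_Ici_self) h.bound_deriv

theorem RadialPhase.bddMeas_second (hdim : 3 ≤ Module.finrank ℝ E) (h : RadialPhase ϕ ψ ψ' B) :
    BddMeas (fun x : E => ψ' ‖x‖) :=
  BddMeas.of_measurable hdim h.measurable h.bound_second

theorem RadialMultiplier.bddMeas (hdim : 3 ≤ Module.finrank ℝ E) (h : RadialMultiplier μ μ' B) :
    BddMeas (fun x : E => μ ‖x‖) :=
  BddMeas.of_continuousOn hdim (h.cont.mono Ioi_subset_Ici_self) fun r hr => by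
    rw [abs_of_nonneg (h.nonneg r hr)]; exact h.bound r hr

theorem RadialMultiplier.bddMeas_div (hdim : 3 ≤ Module.finrank ℝ E)
    (h : RadialMultiplier μ μ' B) : BddMeas (fun x : E => μ ‖x‖ / ‖x‖) := by
  refine BddMeas.of_continuousOn hdim (ζ := fun r => μ r / r) (B := B) ?_ ?_
  · exact (h.cont.mono Ioi_subset_Ici_self).div continuousOn_id (fun x hx => ne_of_gt hx)
  · intro r hr
    rw [abs_of_nonneg (div_nonneg (h.nonneg r hr) hr.le), div_le_iff₀ hr]
    exact h.bound_linear r hr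

theorem RadialMultiplier.bddMeas_deriv (hdim : 3 ≤ Module.finrank ℝ E)
    (h : RadialMultiplier μ μ' B) : BddMeas (fun x : E => μ' ‖x‖) :=
  BddMeas.of_measurable hdim h.measurable h.bound_deriv

/-- The Euler field `x · ∇` applied to `f`. -/
noncomputable def euler (f : E → ℝ) (x : E) : ℝ := fderiv ℝ f x x

omit [FiniteDimensional ℝ E] [MeasurableSpace E] [BorelSpace E] in
theorem contDiff_euler {f : E → ℝ} (hf : ContDiff ℝ ∞ f) : ContDiff ℝ ∞ (euler f) :=
  (hf.fderiv_right (m := ∞) (by simp)).clm_apply contDiff_id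

omit [FiniteDimensional ℝ E] [MeasurableSpace E] [BorelSpace E] in
theorem HasCompactSupport.euler {f : E → ℝ} (hc : HasCompactSupport f) :
    HasCompactSupport (euler f) :=
  (hc.fderiv (𝕜 := ℝ)).mono fun x hx => by
    contrapose! hx
    simp only [Function.mem_support, not_not] at hx
    simp [_root_.euler, hx]

omit [FiniteDimensional ℝ E] [MeasurableSpace E] [BorelSpace E] in
theorem fderiv_euler {f : E → ℝ} (hf : ContDiff ℝ ∞ f) (x v : E) :
    fderiv ℝ (euler f) x v = fderiv ℝ (fderiv ℝ f) x v x + fderiv ℝ f x v := by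
  have h : DifferentiableAt ℝ (fderiv ℝ f) x :=
    ((hf.fderiv_right (m := ∞) (by simp)).differentiable (by simp)).differentiableAt
  have : euler f = fun y => fderiv ℝ f y y := rfl
  rw [this, fderiv_clm_apply h (by fun_prop)]
  simp [add_comm]

omit [FiniteDimensional ℝ E] [MeasurableSpace E] [BorelSpace E] in
theorem hasDerivAt_ray {f : E → ℝ} (hf : ContDiff ℝ ∞ f) (w : E) {r : ℝ} (hr : 0 < r) :
    HasDerivAt (fun r : ℝ => f (r • w)) (euler f (r • w) / r) r := by
  have h1 : HasDerivAt (fun r : ℝ => r • w) w r := by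
    simpa using (hasDerivAt_id r).smul_const w
  have h2 := ((hf.differentiable (by simp) (r • w)).hasFDerivAt).comp_hasDerivAt r h1
  have : euler f (r • w) / r = fderiv ℝ f (r • w) w := by
    rw [euler, map_smul, smul_eq_mul, mul_div_cancel_left₀ _ hr.ne']
  rw [this]
  exact h2

omit [FiniteDimensional ℝ E] [MeasurableSpace E] [BorelSpace E] in
theorem hasDerivAt_ray_euler {f : E → ℝ} (hf : ContDiff ℝ ∞ f) (w : E) {r : ℝ} (hr : 0 < r) :
    HasDerivAt (fun r : ℝ => euler f (r • w))
      ((fderiv ℝ (fderiv ℝ f) (r • w) (r • w) (r • w) + euler f (r • w)) / r) r := by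
  have := hasDerivAt_ray (contDiff_euler hf) w hr
  rwa [euler, fderiv_euler hf] at this

omit [FiniteDimensional ℝ E] [MeasurableSpace E] [BorelSpace E] in
-- The Euler field commutes with rotations, so r∂_r of |∇_S f|² is twice the spherical pairing of f
-- with its Euler derivative.
theorem hasDerivAt_ray_angGrad {ι : Type*} [Fintype ι] (b : OrthonormalBasis ι ℝ E) {f : E → ℝ}
    (hf : ContDiff ℝ ∞ f) {w : E} (hw : ‖w‖ = 1) {r : ℝ} (hr : 0 < r) :
    HasDerivAt (fun r : ℝ => angGrad b f f (r • w)) (2 * angGrad b f (euler f) (r • w) / r) r := by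
  have hsymm : ∀ x v z, fderiv ℝ (fderiv ℝ f) x v z = fderiv ℝ (fderiv ℝ f) x z v := fun x v z =>
    ((hf.of_le (m := 2) (WithTop.coe_le_coe.2 le_top)).contDiffAt.isSymmSndFDerivAt (by simp)).eq v z
  have h1 : ∀ i, HasDerivAt (fun r : ℝ => fderiv ℝ f (r • w) (b i))
      (fderiv ℝ (fderiv ℝ f) (r • w) (b i) (r • w) / r) r := by
    intro i
    have := hasDerivAt_ray (hf.fderiv_apply_const (b i)) w hr
    rwa [euler, fderiv_fderiv_apply hf, hsymm] at this
  have h2 := hasDerivAt_ray_euler hf w hr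
  have h3 := ((hasDerivAt_id r).pow 2).mul (HasDerivAt.fun_sum (u := Finset.univ) fun i _ =>
    (h1 i).mul (h1 i))
  have h4 := h3.sub (h2.mul h2)
  have e1 : ∀ r : ℝ, ‖r • w‖ ^ 2 = r ^ 2 := fun r => by rw [norm_smul, hw, mul_one]; simp
  refine (h4.congr_of_eventuallyEq (.of_forall fun s => ?_)).congr_deriv ?_
  · simp only [angGrad, e1, euler, Pi.mul_apply, Pi.sub_apply, Pi.pow_apply, id]
  · set A : ι → ℝ := fun i => fderiv ℝ f (r • w) (b i) with hA
    set H : ι → ℝ := fun i => fderiv ℝ (fderiv ℝ f) (r • w) (b i) (r • w) with hH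
    have s1 : ∑ i, (H i / r * A i + A i * (H i / r)) = 2 / r * ∑ i, A i * H i := by
      rw [Finset.mul_sum]
      exact Finset.sum_congr rfl fun i _ => by ring
    have s2 : ∑ i, A i * fderiv ℝ (euler f) (r • w) (b i) =
        ∑ i, A i * H i + ∑ i, A i * A i := by
      rw [← Finset.sum_add_distrib]
      exact Finset.sum_congr rfl fun i _ => by rw [fderiv_euler hf, hA, hH]; ring
    have s3 : angGrad b f (euler f) (r • w) = r ^ 2 * (∑ i, A i * H i + ∑ i, A i * A i) -
        euler f (r • w) *
          (fderiv ℝ (fderiv ℝ f) (r • w) (r • w) (r • w) + euler f (r • w)) := by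
      rw [angGrad, e1, s2, fderiv_euler hf]
      rfl
    rw [s3]
    change (2 * r ^ (2 - 1) * 1) * (∑ i, A i * A i) +
      r ^ 2 * (∑ i, (H i / r * A i + A i * (H i / r))) - _ = _
    rw [s1]
    field_simp
    ring

end Weights

/-! ### One-variable derivative identities for the fluxes along a ray. -/

section RayIdentities

variable {ϕ ψ μ q e Γ V : ℝ → ℝ} {ψ' μ' s Γ' V' r : ℝ} {N : ℕ}

/-- The form N r^N / r keeps r^N as a common factor and covers N = 0. -/
theorem hasDerivAt_pow_div (N : ℕ) {r : ℝ} (hr : 0 < r) :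
    HasDerivAt (fun r : ℝ => r ^ N) (N * r ^ N / r) r := by
  refine (hasDerivAt_pow N r).congr_deriv ?_
  cases N with
  | zero => simp
  | succ k => rw [pow_succ]; simp; field_simp

/-- Derivative of the radial energy along a ray. -/
theorem hasDerivWithinAt_ray_energy (hr : 0 < r)
    (hϕ : HasDerivWithinAt ϕ (ψ r) (Ioi r) r) (hψ : HasDerivWithinAt ψ ψ' (Ioi r) r)
    (hμ : HasDerivWithinAt μ μ' (Ioi r) r) (hq : HasDerivAt q (e r / r) r)
    (he : HasDerivAt e ((s + e r) / r) r) (hΓ : HasDerivAt Γ (2 * Γ' / r) r) {ν K : ℝ}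
    (hν : ν = N + 2) (hK : K = e r + ν / 2 * q r + ψ r * (r * q r)) :
    HasDerivWithinAt (fun r => r ^ N * (Real.exp (2 * ϕ r) * μ r *
      ((e r + ν / 2 * q r + ψ r * (r * q r)) ^ 2 + (ψ r * (r * q r)) ^ 2 -
        (ν * (ν - 2) / 4 * q r ^ 2 + Γ r))))
      (r ^ N * (Real.exp (2 * ϕ r) * ((μ' + 4 * (μ r * ψ r)) * K ^ 2 +
        (μ' * ψ r ^ 2 + 2 * (μ r * (ψ r * ψ'))) * (r * q r) ^ 2 +
        (2 * (μ r / r) - μ') * (ν * (ν - 2) / 4 * q r ^ 2 + Γ r) +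
        2 * (μ r * ψ') * ((r * q r) * K) + 2 * (μ r / r) * ((s + ν * e r) * K) -
        (μ r / r) * ((ν * Γ r + 2 * (ψ r * (r * Γ r))) + 2 * Γ')))) (Ioi r) r := by
  have h1 := (hasDerivAt_pow_div N hr).hasDerivWithinAt (s := Ioi r)
  have h2 := (hϕ.const_mul 2).exp
  have hqw := hq.hasDerivWithinAt (s := Ioi r)
  have hew := he.hasDerivWithinAt (s := Ioi r)
  have hΓw := hΓ.hasDerivWithinAt (s := Ioi r)
  have hid := hasDerivWithinAt_id r (Ioi r)
  have h3 := hψ.mul (hid.mul hqw)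
  have h4 := (hew.add (hqw.const_mul (ν / 2))).add h3
  have h5 := ((h4.pow 2).add (h3.pow 2)).sub (((hqw.pow 2).const_mul (ν * (ν - 2) / 4)).add hΓw)
  have h6 := h1.mul ((h2.mul hμ).mul h5)
  refine h6.congr_deriv ?_
  have hN : (N : ℝ) = ν - 2 := by rw [hν]; ring
  simp only [Pi.mul_apply, Pi.add_apply, Pi.sub_apply, Pi.pow_apply, id, hN]
  rw [hK]
  -- Only a rational identity in the values at r remains, so these become atoms.
  generalize r ^ N = P
  generalize Real.exp (2 * ϕ r) = X
  generalize q r = q₀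
  generalize e r = e₀
  generalize ψ r = ψ₀
  generalize μ r = μ₀
  generalize Γ r = Γ₀
  field_simp
  ring

/-- With D = ∂_r + ν/2r, this is the flux r^ν e^{2ϕ} f·Df. Its derivative contains (Df)² + 2ψ f Df,
which is completed to the square of Df + ψf, and f·D²f, where D² = ∂_r² + (ν/r)∂_r + ν(ν-2)/(4r²).
-/
theorem hasDerivWithinAt_ray_pairing (hr : 0 < r)
    (hϕ : HasDerivWithinAt ϕ (ψ r) (Ioi r) r) (hq : HasDerivAt q (e r / r) r)
    (he : HasDerivAt e ((s + e r) / r) r) {ν K : ℝ}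
    (hν : ν = N + 2) (hK : K = e r + ν / 2 * q r + ψ r * (r * q r)) :
    HasDerivWithinAt (fun r => r ^ N * (Real.exp (2 * ϕ r) * ((r * q r) * (e r + ν / 2 * q r))))
      (r ^ N * (Real.exp (2 * ϕ r) * (K ^ 2 - (ψ r * (r * q r)) ^ 2 + ν * (ν - 2) / 4 * q r ^ 2 +
        q r * (s + ν * e r)))) (Ioi r) r := by
  have h1 := (hasDerivAt_pow_div N hr).hasDerivWithinAt (s := Ioi r)
  have h2 := (hϕ.const_mul 2).exp
  have hqw := hq.hasDerivWithinAt (s := Ioi r)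
  have hew := he.hasDerivWithinAt (s := Ioi r)
  have hid := hasDerivWithinAt_id r (Ioi r)
  have h6 := h1.mul (h2.mul ((hid.mul hqw).mul (hew.add (hqw.const_mul (ν / 2)))))
  refine h6.congr_deriv ?_
  have hN : (N : ℝ) = ν - 2 := by rw [hν]; ring
  simp only [Pi.mul_apply, Pi.add_apply, id, hN]
  rw [hK]
  generalize r ^ N = P
  generalize Real.exp (2 * ϕ r) = X
  generalize q r = q₀
  generalize e r = e₀
  generalize ψ r = ψ₀
  field_simp
  ring

/-- The function r^ν e^{2ϕ} f² is the square of r^{ν/2} e^ϕ f, whose derivative is r^{ν/2} e^ϕ K/r.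
Hence differentiating both weights and f produces a single cross term with K. -/
theorem hasDerivWithinAt_ray_potential (hr : 0 < r)
    (hϕ : HasDerivWithinAt ϕ (ψ r) (Ioi r) r) (hμ : HasDerivWithinAt μ μ' (Ioi r) r)
    (hV : HasDerivWithinAt V V' (Ioi r) r) (hq : HasDerivAt q (e r / r) r) {ν K : ℝ}
    (hν : ν = N + 2) (hK : K = e r + ν / 2 * q r + ψ r * (r * q r)) :
    HasDerivWithinAt (fun r => r ^ N * (V r * (Real.exp (2 * ϕ r) * μ r * (r * q r) ^ 2)))
      (r ^ N * (V' * (Real.exp (2 * ϕ r) * μ r * (r * q r) ^ 2) + V r * (Real.exp (2 * ϕ r) *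
        (μ' * (r * q r) ^ 2 + 2 * μ r * ((r * q r) * K))))) (Ioi r) r := by
  have h1 := (hasDerivAt_pow_div N hr).hasDerivWithinAt (s := Ioi r)
  have h2 := (hϕ.const_mul 2).exp
  have hqw := hq.hasDerivWithinAt (s := Ioi r)
  have hid := hasDerivWithinAt_id r (Ioi r)
  have h6 := h1.mul (hV.mul ((h2.mul hμ).mul ((hid.mul hqw).pow 2)))
  refine h6.congr_deriv ?_
  have hN : (N : ℝ) = ν - 2 := by rw [hν]; ring
  simp only [Pi.mul_apply, Pi.pow_apply, id, hN]
  rw [hK]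
  generalize r ^ N = P
  generalize Real.exp (2 * ϕ r) = X
  generalize q r = q₀
  generalize e r = e₀
  generalize ψ r = ψ₀
  generalize μ r = μ₀
  generalize V r = V₀
  field_simp
  ring

end RayIdentities

/-! ### The elliptic and multiplier inequalities for real test functions. -/

section RealInequalities

open scoped ContDiff

variable {E : Type*} [NormedAddCommGroup E] [InnerProductSpace ℝ E]

/-- The symmetrised radial derivative `∂_r f + (ν / 2r) f`, with `ν = dim E - 1`. -/
noncomputable def radialDeriv {F : Type*} [NormedAddCommGroup F] [NormedSpace ℝ F] (ν : ℝ)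
    (f : E → F) (x : E) : F :=
  ‖x‖⁻¹ • (fderiv ℝ f x x + (ν / 2) • f x)

/-- The second radial derivative times `‖x‖²`. -/
noncomputable def radialSecond (f : E → ℝ) (x : E) : ℝ := fderiv ℝ (fderiv ℝ f) x x x

theorem contDiff_radialSecond {f : E → ℝ} (hf : ContDiff ℝ ∞ f) : ContDiff ℝ ∞ (radialSecond f) :=
  (((hf.fderiv_right (m := ∞) (by simp)).fderiv_right (m := ∞) (by simp)).clm_apply
    contDiff_id).clm_apply contDiff_id

theorem HasCompactSupport.radialSecond {f : E → ℝ} (hc : HasCompactSupport f) :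
    HasCompactSupport (radialSecond f) :=
  ((hc.fderiv (𝕜 := ℝ)).fderiv (𝕜 := ℝ)).mono fun x hx => by
    contrapose! hx
    simp only [Function.mem_support, not_not] at hx
    simp [_root_.radialSecond, hx]

theorem HasCompactSupport.exists_norm_bound_derivs {f : E → ℝ} (hc : HasCompactSupport f) :
    ∃ R, ∀ x, R ≤ ‖x‖ → f x = 0 ∧ fderiv ℝ f x = 0 ∧ fderiv ℝ (fderiv ℝ f) x = 0 := by
  obtain ⟨R, hR⟩ := hc.isCompact.isBounded.subset_ball 0
  refine ⟨R, fun x hx => ?_⟩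
  have hx' : x ∉ tsupport f := fun h => by
    have := hR h
    simp at this
    linarith
  refine ⟨image_eq_zero_of_notMem_tsupport hx', ?_, ?_⟩
  · by_contra h
    exact hx' (support_fderiv_subset ℝ h)
  · by_contra h
    exact hx' ((tsupport_fderiv_subset ℝ) (support_fderiv_subset ℝ h))

theorem continuousOn_ray {f : E → ℝ} (hf : Continuous f) (w : E) :
    ContinuousOn (fun r : ℝ => f (r • w)) (Ici 0) := by
  have : Continuous (fun r : ℝ => f (r • w)) := by fun_prop
  exact this.continuousOn

variable [FiniteDimensional ℝ E] [MeasurableSpace E] [BorelSpace E] {N : ℕ}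

/-- The radial measure is r^{N+2} dr, so dividing by ‖x‖² leaves r^N. Fluxes can then be written
with r f and x·∇f, without negative powers of r. -/
theorem integral_div_sq_nonneg_of_radial_deriv_le (hN : Module.finrank ℝ E = N + 3) {F G : E → ℝ}
    (hF : BddMeas F) (hG : BddMeas G) {R : ℝ} (hFR : ∀ x, R ≤ ‖x‖ → F x = 0)
    (hGR : ∀ x, R ≤ ‖x‖ → G x = 0)
    (h : ∀ w : E, ‖w‖ = 1 → ∃ g g' : ℝ → ℝ, ContinuousOn g (Ici 0) ∧ g 0 = 0 ∧
      (∀ r, 0 < r → g r = r ^ N * F (r • w)) ∧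
      ∀ r, 0 < r → HasDerivWithinAt g (g' r) (Ioi r) r ∧ g' r ≤ r ^ N * G (r • w)) :
    0 ≤ ∫ x, G x / ‖x‖ ^ 2 := by
  have hdim : 3 ≤ Module.finrank ℝ E := by omega
  refine integral_nonneg_of_radial_deriv_le (N := N + 2) hN (hF.integrable_div_sq hdim hFR)
    (hG.integrable_div_sq hdim hGR) fun w hw => ?_
  obtain ⟨g, g', h1, h2, h3, h4⟩ := h w hw
  have e : ∀ r : ℝ, 0 < r → ∀ y : ℝ, r ^ (N + 2) * (y / ‖r • w‖ ^ 2) = r ^ N * y := by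
    intro r hr y
    rw [norm_smul, hw, mul_one, Real.norm_eq_abs, sq_abs, pow_add]
    field_simp
  refine ⟨g, g', h1, h2, fun r hr => ?_, fun r hr => ?_⟩
  · rw [e r hr, h3 r hr]
  · rw [e r hr]; exact h4 r hr

variable {ϕ ψ ψ' μ μ' : ℝ → ℝ} {B : ℝ} {ι : Type*} [Fintype ι]

/-- The weighted elliptic estimate for the radial derivative. -/
theorem integral_sq_radialDeriv_le (b : OrthonormalBasis ι ℝ E)
    (hN : Module.finrank ℝ E = N + 3) {ν : ℝ} (hν : ν = N + 2) (hϕ : RadialPhase ϕ ψ ψ' B)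
    {f : E → ℝ} (hf : ContDiff ℝ ∞ f) (hc : HasCompactSupport f) :
    0 ≤ ∫ x, Real.exp (2 * ϕ ‖x‖) * (ψ ‖x‖ ^ 2 * f x ^ 2 - Δ f x * f x -
      (radialDeriv ν f x + ψ ‖x‖ * f x) ^ 2) := by
  have hdim : 3 ≤ Module.finrank ℝ E := by omega
  have hcard : (Fintype.card ι : ℝ) = ν + 1 := by
    rw [← Module.finrank_eq_card_basis b.toBasis, hN, hν]; push_cast; ring
  obtain ⟨R, hR⟩ := hc.exists_norm_bound_derivs
  set K : E → ℝ := fun x => euler f x + ν / 2 * f x + ψ ‖x‖ * (‖x‖ * f x) with hK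
  have bX := hϕ.bddMeas_exp (E := E) hdim
  have bψ := hϕ.bddMeas_deriv (E := E) hdim
  have bf : BddMeas (fun x => f x) := .of_hasCompactSupport hf.continuous hc
  have bxf : BddMeas (fun x => ‖x‖ * f x) :=
    .of_hasCompactSupport (continuous_norm.mul hf.continuous) hc.mul_left
  have be : BddMeas (fun x => euler f x) := .of_hasCompactSupport (contDiff_euler hf).continuous hc.euler
  have bs : BddMeas (fun x => radialSecond f x) :=
    .of_hasCompactSupport (contDiff_radialSecond hf).continuous hc.radialSecond
  have bK : BddMeas (fun x => K x) := (be.add ((BddMeas.const _).mul bf)).add (bψ.mul bxf)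
  set F : E → ℝ := fun x => Real.exp (2 * ϕ ‖x‖) * ((‖x‖ * f x) * (euler f x + ν / 2 * f x)) with hF
  set G : E → ℝ := fun x => Real.exp (2 * ϕ ‖x‖) * (K x ^ 2 - (ψ ‖x‖ * (‖x‖ * f x)) ^ 2 +
    ν * (ν - 2) / 4 * f x ^ 2 + f x * (radialSecond f x + ν * euler f x)) with hG
  have bF : BddMeas F := bX.mul (bxf.mul (be.add ((BddMeas.const _).mul bf)))
  have bG : BddMeas G := bX.mul (((bK.pow.sub (bψ.mul bxf).pow).add ((BddMeas.const _).mul bf.pow)).add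
    (bf.mul (bs.add ((BddMeas.const _).mul be))))
  have hGR : ∀ x, R ≤ ‖x‖ → G x = 0 := fun x hx => by
    obtain ⟨h1, h2, h3⟩ := hR x hx
    simp [hG, hK, h1, h2, h3, euler, radialSecond]
  have h1 : 0 ≤ ∫ x, (fun x => -G x) x / ‖x‖ ^ 2 := by
    refine integral_div_sq_nonneg_of_radial_deriv_le hN (F := fun x => -F x) bF.neg bG.neg (R := R)
      ?_ (fun x hx => by simp [hGR x hx]) fun w hw => ?_
    · intro x hx
      obtain ⟨h1, h2, h3⟩ := hR x hx
      simp [hF, h1]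
    · have hn : ∀ r : ℝ, 0 < r → ‖r • w‖ = r := fun r hr => by
        rw [norm_smul, hw, mul_one, Real.norm_eq_abs, abs_of_pos hr]
      refine ⟨fun r => -(r ^ N * (Real.exp (2 * ϕ r) * ((r * f (r • w)) *
        (euler f (r • w) + ν / 2 * f (r • w))))), fun r => -(r ^ N * G (r • w)), ?_, by simp, ?_, ?_⟩
      · have c1 := continuousOn_ray hf.continuous w
        have c2 := continuousOn_ray (contDiff_euler hf).continuous w
        have c3 := (hϕ.cont_phase.const_mul 2).rexp
        exact ((continuousOn_id.pow N).mul (c3.mul ((continuousOn_id.mul c1).mul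
          (c2.add (c1.const_mul _))))).neg
      · intro r hr
        simp only [hF, hn r hr]
        ring
      · intro r hr
        refine ⟨?_, le_of_eq (by ring)⟩
        refine ((hasDerivWithinAt_ray_pairing (ψ := ψ) hr (hϕ.deriv_phase r hr)
          (hasDerivAt_ray hf w hr)
          (hasDerivAt_ray_euler hf w hr) hν rfl).neg).congr_deriv ?_
        simp only [hG, hK, hn r hr]
        rfl
  -- This term cancels its counterpart in -G; it is nonnegative because ν ≥ 2.
  have hG2 : 0 ≤ ∫ x, (Real.exp (2 * ϕ ‖x‖) * (ν * (ν - 2) / 4 * f x ^ 2)) / ‖x‖ ^ 2 := by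
    refine integral_nonneg fun x => ?_
    have : 0 ≤ ν * (ν - 2) := by rw [hν]; ring_nf; positivity
    positivity
  have cζ : ContinuousOn (fun r => Real.exp (2 * ϕ r) / r ^ 2) (Ioi 0) :=
    ((hϕ.cont_phase.mono Ioi_subset_Ici_self).const_mul 2).rexp.div (continuousOn_id.pow 2)
      fun x hx => by have : (0 : ℝ) < x := hx; positivity
  have bζ : ∀ r, 0 < r → |Real.exp (2 * ϕ r) / r ^ 2| ≤ Real.exp (2 * B) / r ^ 2 := fun r hr => by
    rw [abs_of_nonneg (by positivity)]
    have := (abs_le.1 (hϕ.bound_phase r hr)).2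
    gcongr
  -- The angular part of -f Δf contributes |∇_S f|² ≥ 0 after Green's formula, so it may be added to
  -- complete the full Laplacian.
  have hgreen := integral_radial_mul_angLap b hcard hdim cζ bζ hf hc hf hc
  have hang : 0 ≤ ∫ x, Real.exp (2 * ϕ ‖x‖) / ‖x‖ ^ 2 * angGrad b f f x :=
    integral_nonneg fun x => mul_nonneg (by positivity) (angGrad_self_nonneg b f x)
  have i1 : Integrable (fun x => -G x / ‖x‖ ^ 2) := bG.neg.integrable_div_sq hdim (R := R)
    (fun x hx => by simp [hGR x hx])
  have i2 : Integrable (fun x => (Real.exp (2 * ϕ ‖x‖) * (ν * (ν - 2) / 4 * f x ^ 2)) / ‖x‖ ^ 2) :=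
    (bX.mul ((BddMeas.const _).mul bf.pow)).integrable_div_sq hdim (R := R)
      (fun x hx => by simp [(hR x hx).1])
  have i3 : Integrable (fun x => Real.exp (2 * ϕ ‖x‖) / ‖x‖ ^ 2 * (f x * angLap b ν f x)) :=
    integrable_radial_mul hdim cζ bζ (hf.continuous.mul (continuous_angLap b ν hf)) hc.mul_right
  have hsum : 0 ≤ ∫ x, ((-G x / ‖x‖ ^ 2 + (Real.exp (2 * ϕ ‖x‖) * (ν * (ν - 2) / 4 * f x ^ 2)) / ‖x‖ ^ 2) -
      Real.exp (2 * ϕ ‖x‖) / ‖x‖ ^ 2 * (f x * angLap b ν f x)) := by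
    rw [integral_sub (by exact i1.add i2) i3, integral_add i1 i2]
    linarith
  refine hsum.trans_eq (integral_congr_ae ?_)
  filter_upwards [ae_ne_zero hdim] with x hx
  have hx0 : ‖x‖ ≠ 0 := norm_ne_zero_iff.2 hx
  rw [laplacian_eq_sum_fderiv_fderiv b]
  simp only [hG, hK, angLap, radialDeriv, radialSecond, euler, smul_eq_mul]
  field_simp
  ring

/-- The weighted multiplier inequality, with a potential `W` whose radial derivative is bounded above
by `c`. -/
theorem integral_radial_multiplier_nonneg (b : OrthonormalBasis ι ℝ E)
    (hN : Module.finrank ℝ E = N + 3) {ν : ℝ} (hν : ν = N + 2) (hϕ : RadialPhase ϕ ψ ψ' B)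
    (hμ : RadialMultiplier μ μ' B) {W : E → ℝ} {c : ℝ → ℝ} (hW : BddMeas W)
    (hWr : ∀ w : E, ‖w‖ = 1 → ContinuousOn (fun r : ℝ => W (r • w)) (Ici 0) ∧
      ∀ r, 0 < r → ∃ d, d ≤ c r ∧ HasDerivWithinAt (fun r : ℝ => W (r • w)) d (Ioi r) r)
    (hcm : Measurable c) (hcb : ∀ r, 0 < r → |c r| ≤ B)
    {f : E → ℝ} (hf : ContDiff ℝ ∞ f) (hc : HasCompactSupport f) :
    0 ≤ ∫ x, Real.exp (2 * ϕ ‖x‖) *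
      (2 * μ ‖x‖ * (-Δ f x + W x * f x - ψ' ‖x‖ * f x) * (radialDeriv ν f x + ψ ‖x‖ * f x) -
      (μ' ‖x‖ + 4 * (μ ‖x‖ * ψ ‖x‖)) * (radialDeriv ν f x + ψ ‖x‖ * f x) ^ 2 -
      (μ' ‖x‖ * ψ ‖x‖ ^ 2 + 2 * (μ ‖x‖ * (ψ ‖x‖ * ψ' ‖x‖)) - μ' ‖x‖ * W x - c ‖x‖ * μ ‖x‖) *
        f x ^ 2) := by
  have hdim : 3 ≤ Module.finrank ℝ E := by omega
  have hcard : (Fintype.card ι : ℝ) = ν + 1 := by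
    rw [← Module.finrank_eq_card_basis b.toBasis, hN, hν]; push_cast; ring
  obtain ⟨R, hR⟩ := hc.exists_norm_bound_derivs
  set K : E → ℝ := fun x => euler f x + ν / 2 * f x + ψ ‖x‖ * (‖x‖ * f x) with hK
  set A : E → ℝ := fun x => ν * (ν - 2) / 4 * f x ^ 2 + angGrad b f f x with hA
  have bX := hϕ.bddMeas_exp (E := E) hdim
  have bψ := hϕ.bddMeas_deriv (E := E) hdim
  have bψ' := hϕ.bddMeas_second (E := E) hdim
  have bμ := hμ.bddMeas (E := E) hdim
  have bμd := hμ.bddMeas_div (E := E) hdim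
  have bμ' := hμ.bddMeas_deriv (E := E) hdim
  have bc : BddMeas (fun x : E => c ‖x‖) := BddMeas.of_measurable hdim hcm hcb
  have bf : BddMeas (fun x => f x) := .of_hasCompactSupport hf.continuous hc
  have bxf : BddMeas (fun x => ‖x‖ * f x) :=
    .of_hasCompactSupport (continuous_norm.mul hf.continuous) hc.mul_left
  have be : BddMeas (fun x => euler f x) := .of_hasCompactSupport (contDiff_euler hf).continuous hc.euler
  have bs : BddMeas (fun x => radialSecond f x) :=
    .of_hasCompactSupport (contDiff_radialSecond hf).continuous hc.radialSecond
  have cΓ := continuous_angGrad b hf hf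
  have hΓc := hasCompactSupport_angGrad b f hc
  have bΓ : BddMeas (fun x => angGrad b f f x) := .of_hasCompactSupport cΓ hΓc
  have bxΓ : BddMeas (fun x => ‖x‖ * angGrad b f f x) :=
    .of_hasCompactSupport (continuous_norm.mul cΓ) hΓc.mul_left
  have bΓ' : BddMeas (fun x => angGrad b f (euler f) x) :=
    .of_hasCompactSupport (continuous_angGrad b hf (contDiff_euler hf))
      (hasCompactSupport_angGrad b _ hc)
  have bK : BddMeas (fun x => K x) := (be.add ((BddMeas.const _).mul bf)).add (bψ.mul bxf)
  have bA : BddMeas (fun x => A x) := ((BddMeas.const _).mul bf.pow).add bΓ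
  have hA0 : ∀ x, 0 ≤ A x := fun x => by
    have h1 : 0 ≤ ν * (ν - 2) := by rw [hν]; ring_nf; positivity
    have h2 := angGrad_self_nonneg b f x
    simp only [hA]
    positivity
  have h0 : ∀ x, R ≤ ‖x‖ → angGrad b f f x = 0 ∧ angGrad b f (euler f) x = 0 ∧ A x = 0 ∧ K x = 0 ∧
      euler f x = 0 ∧ radialSecond f x = 0 := fun x hx => by
    obtain ⟨h1, h2, h3⟩ := hR x hx
    simp [hA, hK, h1, h2, h3, euler, radialSecond, angGrad]
  -- the energy
  set F₁ : E → ℝ := fun x => Real.exp (2 * ϕ ‖x‖) * μ ‖x‖ *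
    (K x ^ 2 + (ψ ‖x‖ * (‖x‖ * f x)) ^ 2 - A x) with hF₁
  set G₁ : E → ℝ := fun x => Real.exp (2 * ϕ ‖x‖) * ((μ' ‖x‖ + 4 * (μ ‖x‖ * ψ ‖x‖)) * K x ^ 2 +
        (μ' ‖x‖ * ψ ‖x‖ ^ 2 + 2 * (μ ‖x‖ * (ψ ‖x‖ * ψ' ‖x‖))) * (‖x‖ * f x) ^ 2 +
        (2 * (μ ‖x‖ / ‖x‖) - μ' ‖x‖) * A x +
        2 * (μ ‖x‖ * ψ' ‖x‖) * ((‖x‖ * f x) * K x) +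
        2 * (μ ‖x‖ / ‖x‖) * ((radialSecond f x + ν * euler f x) * K x) -
        (μ ‖x‖ / ‖x‖) * ((ν * angGrad b f f x + 2 * (ψ ‖x‖ * (‖x‖ * angGrad b f f x))) +
          2 * angGrad b f (euler f) x)) with hG₁
  have bF₁ : BddMeas F₁ := (bX.mul bμ).mul ((bK.pow.add (bψ.mul bxf).pow).sub bA)
  have b2 : BddMeas (fun _ : E => (2 : ℝ)) := BddMeas.const _
  have b4 : BddMeas (fun _ : E => (4 : ℝ)) := BddMeas.const _
  have bν : BddMeas (fun _ : E => ν) := BddMeas.const _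
  have bG₁ : BddMeas G₁ :=
    bX.mul ((((((bμ'.add (b4.mul (bμ.mul bψ))).mul bK.pow).add
      (((bμ'.mul bψ.pow).add (b2.mul (bμ.mul (bψ.mul bψ')))).mul bxf.pow)).add
      (((b2.mul bμd).sub bμ').mul bA)).add ((b2.mul (bμ.mul bψ')).mul (bxf.mul bK))).add
      ((b2.mul bμd).mul ((bs.add (bν.mul be)).mul bK)) |>.sub
      (bμd.mul (((bν.mul bΓ).add (b2.mul (bψ.mul bxΓ))).add (b2.mul bΓ'))))
  have hG₁R : ∀ x, R ≤ ‖x‖ → G₁ x = 0 := fun x hx => by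
    obtain ⟨h1, h2, h3, h4, h5, h6⟩ := h0 x hx
    simp [hG₁, h1, h2, h3, h4, (hR x hx).1]
  have hn : ∀ w : E, ‖w‖ = 1 → ∀ r : ℝ, 0 < r → ‖r • w‖ = r := fun w hw r hr => by
    rw [norm_smul, hw, mul_one, Real.norm_eq_abs, abs_of_pos hr]
  have h1 : 0 ≤ ∫ x, (fun x => -G₁ x) x / ‖x‖ ^ 2 := by
    refine integral_div_sq_nonneg_of_radial_deriv_le hN (F := fun x => -F₁ x) bF₁.neg bG₁.neg (R := R)
      ?_ (fun x hx => by simp [hG₁R x hx]) fun w hw => ?_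
    · intro x hx
      obtain ⟨h1, h2, h3, h4, h5, h6⟩ := h0 x hx
      simp [hF₁, h3, h4, (hR x hx).1]
    · refine ⟨fun r => -(r ^ N * (Real.exp (2 * ϕ r) * μ r *
        ((euler f (r • w) + ν / 2 * f (r • w) + ψ r * (r * f (r • w))) ^ 2 +
          (ψ r * (r * f (r • w))) ^ 2 -
        (ν * (ν - 2) / 4 * f (r • w) ^ 2 + angGrad b f f (r • w))))),
        fun r => -(r ^ N * G₁ (r • w)), ?_, by simp [hμ.zero], ?_, ?_⟩
      · have c1 := continuousOn_ray hf.continuous w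
        have c2 := continuousOn_ray (contDiff_euler hf).continuous w
        have c3 := (hϕ.cont_phase.const_mul 2).rexp
        have c4 := continuousOn_ray cΓ w
        have c5 := hϕ.cont_deriv.mul (continuousOn_id.mul c1)
        exact ((continuousOn_id.pow N).mul ((c3.mul hμ.cont).mul (((((c2.add (c1.const_mul _)).add
          c5).pow 2).add (c5.pow 2)).sub (((c1.pow 2).const_mul _).add c4)))).neg
      · intro r hr
        simp only [hF₁, hK, hA, hn w hw r hr]
        ring
      · intro r hr
        refine ⟨?_, le_of_eq (by ring)⟩
        refine ((hasDerivWithinAt_ray_energy hr (hϕ.deriv_phase r hr) (hϕ.deriv_deriv r hr)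
          (hμ.deriv r hr) (hasDerivAt_ray hf w hr) (hasDerivAt_ray_euler hf w hr)
          (hasDerivAt_ray_angGrad b hf hw hr) hν rfl).neg).congr_deriv ?_
        simp only [hG₁, hK, hA, hn w hw r hr]
        rfl
  -- the potential
  set F₃ : E → ℝ := fun x => W x * (Real.exp (2 * ϕ ‖x‖) * μ ‖x‖ * (‖x‖ * f x) ^ 2) with hF₃
  set G₃ : E → ℝ := fun x => c ‖x‖ * (Real.exp (2 * ϕ ‖x‖) * μ ‖x‖ * (‖x‖ * f x) ^ 2) +
    W x * (Real.exp (2 * ϕ ‖x‖) * (μ' ‖x‖ * (‖x‖ * f x) ^ 2 + 2 * μ ‖x‖ * ((‖x‖ * f x) * K x)))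
    with hG₃
  have bF₃ : BddMeas F₃ := hW.mul ((bX.mul bμ).mul bxf.pow)
  have bG₃ : BddMeas G₃ := (bc.mul ((bX.mul bμ).mul bxf.pow)).add
    (hW.mul (bX.mul ((bμ'.mul bxf.pow).add ((b2.mul bμ).mul (bxf.mul bK)))))
  have hG₃R : ∀ x, R ≤ ‖x‖ → G₃ x = 0 := fun x hx => by
    simp [hG₃, (hR x hx).1]
  have h3 : 0 ≤ ∫ x, G₃ x / ‖x‖ ^ 2 := by
    refine integral_div_sq_nonneg_of_radial_deriv_le hN bF₃ bG₃ (R := R)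
      (fun x hx => by simp [hF₃, (hR x hx).1]) hG₃R fun w hw => ?_
    obtain ⟨hWc, hWd⟩ := hWr w hw
    -- A derivative is chosen for every r at once; the value 0 for r ≤ 0 plays no role.
    have hWd' : ∀ r : ℝ, ∃ d, 0 < r →
        d ≤ c r ∧ HasDerivWithinAt (fun r : ℝ => W (r • w)) d (Ioi r) r := fun r => by
      by_cases hr : 0 < r
      · obtain ⟨d, hd⟩ := hWd r hr; exact ⟨d, fun _ => hd⟩
      · exact ⟨0, fun h => absurd h hr⟩
    choose d hd using hWd'
    refine ⟨fun r => r ^ N * (W (r • w) * (Real.exp (2 * ϕ r) * μ r * (r * f (r • w)) ^ 2)),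
      fun r => r ^ N * (d r * (Real.exp (2 * ϕ r) * μ r * (r * f (r • w)) ^ 2) + W (r • w) *
        (Real.exp (2 * ϕ r) * (μ' r * (r * f (r • w)) ^ 2 + 2 * μ r * ((r * f (r • w)) * K (r • w))))),
      ?_, by simp, ?_, ?_⟩
    · have c1 := continuousOn_ray hf.continuous w
      have c3 := (hϕ.cont_phase.const_mul 2).rexp
      exact (continuousOn_id.pow N).mul (hWc.mul ((c3.mul hμ.cont).mul
        ((continuousOn_id.mul c1).pow 2)))
    · intro r hr
      simp only [hF₃, hn w hw r hr]
    · intro r hr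
      refine ⟨?_, ?_⟩
      · refine (hasDerivWithinAt_ray_potential (ψ := ψ) (e := fun r => euler f (r • w)) hr (hϕ.deriv_phase r hr) (hμ.deriv r hr)
          (hd r hr).2 (hasDerivAt_ray hf w hr) hν rfl).congr_deriv ?_
        simp only [hK, hn w hw r hr]
      · simp only [hG₃, hn w hw r hr]
        have := hμ.nonneg r hr
        have := (hd r hr).1
        gcongr
  -- the angular part
  have cX : ContinuousOn (fun r => Real.exp (2 * ϕ r) * μ r) (Ioi 0) :=
    (((hϕ.cont_phase.mono Ioi_subset_Ici_self).const_mul 2).rexp).mul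
      (hμ.cont.mono Ioi_subset_Ici_self)
  have hXb : ∀ r, 0 < r → |Real.exp (2 * ϕ r) * μ r| ≤ Real.exp (2 * B) * (B * r) := fun r hr => by
    rw [abs_of_nonneg (mul_nonneg (Real.exp_pos _).le (hμ.nonneg r hr))]
    have := (abs_le.1 (hϕ.bound_phase r hr)).2
    exact mul_le_mul (by gcongr) (hμ.bound_linear r hr) (hμ.nonneg r hr) (Real.exp_pos _).le
  have cζ₁ : ContinuousOn (fun r => Real.exp (2 * ϕ r) * μ r * (2 * ψ r) / r ^ 2) (Ioi 0) :=
    (cX.mul ((hϕ.cont_deriv.mono Ioi_subset_Ici_self).const_mul 2)).div (continuousOn_id.pow 2)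
      fun x hx => by have : (0 : ℝ) < x := hx; positivity
  have cζ₂ : ContinuousOn (fun r => Real.exp (2 * ϕ r) * μ r / r ^ 3) (Ioi 0) :=
    cX.div (continuousOn_id.pow 3) fun x hx => by have : (0 : ℝ) < x := hx; positivity
  have bζ₂ : ∀ r, 0 < r → |Real.exp (2 * ϕ r) * μ r / r ^ 3| ≤ Real.exp (2 * B) * B / r ^ 2 := by
    intro r hr
    rw [abs_div, abs_of_nonneg (a := r ^ 3) (by positivity), div_le_iff₀ (by positivity)]
    refine (hXb r hr).trans_eq ?_
    field_simp
  have bζ₁ : ∀ r, 0 < r → |Real.exp (2 * ϕ r) * μ r * (2 * ψ r) / r ^ 2| ≤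
      Real.exp (2 * B) * B * (2 * B) / r ^ 2 := by
    intro r hr
    rw [abs_div, abs_of_nonneg (a := r ^ 2) (by positivity),
      abs_mul (Real.exp (2 * ϕ r) * μ r), abs_mul 2 (ψ r), abs_two]
    have h1 : |Real.exp (2 * ϕ r) * μ r| ≤ Real.exp (2 * B) * B := by
      rw [abs_of_nonneg (mul_nonneg (Real.exp_pos _).le (hμ.nonneg r hr))]
      have := (abs_le.1 (hϕ.bound_phase r hr)).2
      exact mul_le_mul (by gcongr) (hμ.bound r hr) (hμ.nonneg r hr) (Real.exp_pos _).le
    have h2 := hϕ.bound_deriv r hr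
    gcongr
    exact (abs_nonneg _).trans h1
  -- Green's formula is applied with v = f for the ψ and the ν/2 parts of K, and with v the Euler
  -- derivative for the rest. Together this supplies the angular part of 2(μ/r)·K·r²Δf and removes
  -- the Γ terms of the energy identity.
  have g1 := integral_radial_mul_angLap b hcard hdim cζ₁ bζ₁ hf hc hf hc
  have g2 := integral_radial_mul_angLap b hcard hdim cζ₂ bζ₂ hf hc hf hc
  have g3 := integral_radial_mul_angLap b hcard hdim cζ₂ bζ₂ hf hc (contDiff_euler hf) hc.euler
  have iL : ∀ {ζ : ℝ → ℝ} {C : ℝ} {v : E → ℝ}, ContinuousOn ζ (Ioi 0) →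
      (∀ r, 0 < r → |ζ r| ≤ C / r ^ 2) → ContDiff ℝ ∞ v → HasCompactSupport v →
      Integrable (fun x => ζ ‖x‖ * (v x * angLap b ν f x)) ∧
      Integrable (fun x => ζ ‖x‖ * angGrad b f v x) := fun h1 h2 h3 h4 =>
    ⟨integrable_radial_mul hdim h1 h2 (h3.continuous.mul (continuous_angLap b ν hf)) h4.mul_right,
     integrable_radial_mul hdim h1 h2 (continuous_angGrad b hf h3) (hasCompactSupport_angGrad b _ hc)⟩
  obtain ⟨j1, j1'⟩ := iL cζ₁ bζ₁ hf hc
  obtain ⟨j2, j2'⟩ := iL cζ₂ bζ₂ hf hc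
  obtain ⟨j3, j3'⟩ := iL cζ₂ bζ₂ (contDiff_euler hf) hc.euler
  have z1 := integral_add j1 j1'
  have z2 := integral_add j2 j2'
  have z3 := integral_add j3 j3'
  rw [g1, neg_add_cancel] at z1
  rw [g2, neg_add_cancel] at z2
  rw [g3, neg_add_cancel] at z3
  -- the sign of the angular term
  have iD : Integrable (fun x => (Real.exp (2 * ϕ ‖x‖) *
      ((2 * (μ ‖x‖ / ‖x‖) - μ' ‖x‖) * A x)) / ‖x‖ ^ 2) :=
    (bX.mul (((b2.mul bμd).sub bμ').mul bA)).integrable_div_sq hdim (R := R)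
      (fun x hx => by simp [(h0 x hx).2.2.1])
  have hD : 0 ≤ ∫ x, (Real.exp (2 * ϕ ‖x‖) *
      ((2 * (μ ‖x‖ / ‖x‖) - μ' ‖x‖) * A x)) / ‖x‖ ^ 2 := by
    refine integral_nonneg_of_ae ?_
    filter_upwards [ae_ne_zero hdim] with x hx
    have hx0 : 0 < ‖x‖ := norm_pos_iff.2 hx
    have h1 : 0 ≤ 2 * (μ ‖x‖ / ‖x‖) - μ' ‖x‖ := by
      have := hμ.mul_deriv_le ‖x‖ hx0
      rw [← mul_div_assoc, sub_nonneg, le_div_iff₀ hx0]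
      linarith
    have := hA0 x
    simp only [Pi.zero_apply]
    positivity
  have i1 : Integrable (fun x => -G₁ x / ‖x‖ ^ 2) := bG₁.neg.integrable_div_sq hdim (R := R)
    (fun x hx => by simp [hG₁R x hx])
  have i3 : Integrable (fun x => G₃ x / ‖x‖ ^ 2) := bG₃.integrable_div_sq hdim hG₃R
  have k1 := j1.add j1'
  have k2 := (j2.add j2').const_mul ν
  have k3 := (j3.add j3').const_mul 2
  have z2' : ∫ x, ν * (Real.exp (2 * ϕ ‖x‖) * μ ‖x‖ / ‖x‖ ^ 3 * (f x * angLap b ν f x) +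
      Real.exp (2 * ϕ ‖x‖) * μ ‖x‖ / ‖x‖ ^ 3 * angGrad b f f x) = 0 := by
    rw [integral_const_mul]
    exact mul_eq_zero_of_right _ z2
  have z3' : ∫ x, 2 * (Real.exp (2 * ϕ ‖x‖) * μ ‖x‖ / ‖x‖ ^ 3 * (euler f x * angLap b ν f x) +
      Real.exp (2 * ϕ ‖x‖) * μ ‖x‖ / ‖x‖ ^ 3 * angGrad b f (euler f) x) = 0 := by
    rw [integral_const_mul]
    exact mul_eq_zero_of_right _ z3
  have htot : 0 ≤ ∫ x, (-G₁ x / ‖x‖ ^ 2 + G₃ x / ‖x‖ ^ 2 + (Real.exp (2 * ϕ ‖x‖) *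
      ((2 * (μ ‖x‖ / ‖x‖) - μ' ‖x‖) * A x)) / ‖x‖ ^ 2 -
      (Real.exp (2 * ϕ ‖x‖) * μ ‖x‖ * (2 * ψ ‖x‖) / ‖x‖ ^ 2 * (f x * angLap b ν f x) +
        Real.exp (2 * ϕ ‖x‖) * μ ‖x‖ * (2 * ψ ‖x‖) / ‖x‖ ^ 2 * angGrad b f f x) -
      (ν * (Real.exp (2 * ϕ ‖x‖) * μ ‖x‖ / ‖x‖ ^ 3 * (f x * angLap b ν f x) +
        Real.exp (2 * ϕ ‖x‖) * μ ‖x‖ / ‖x‖ ^ 3 * angGrad b f f x) +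
      2 * (Real.exp (2 * ϕ ‖x‖) * μ ‖x‖ / ‖x‖ ^ 3 * (euler f x * angLap b ν f x) +
        Real.exp (2 * ϕ ‖x‖) * μ ‖x‖ / ‖x‖ ^ 3 * angGrad b f (euler f) x))) := by
    have e1 := integral_sub (((i1.add i3).add iD).sub k1) (k2.add k3)
    have e2 := integral_sub ((i1.add i3).add iD) k1
    have e3 := integral_add (i1.add i3) iD
    have e4 := integral_add i1 i3
    have e5 := integral_add k2 k3
    simp only [Pi.add_apply, Pi.sub_apply] at e1 e2 e3 e4 e5
    rw [e1, e2, e3, e4, e5, z2', z3', z1]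
    linarith
  refine htot.trans_eq (integral_congr_ae ?_)
  filter_upwards [ae_ne_zero hdim] with x hx
  have hx0 : ‖x‖ ≠ 0 := norm_ne_zero_iff.2 hx
  rw [laplacian_eq_sum_fderiv_fderiv b]
  simp only [hG₁, hG₃, hK, hA, angLap, radialDeriv, radialSecond, euler, smul_eq_mul]
  generalize Real.exp (2 * ϕ ‖x‖) = X
  generalize angGrad b f f x = Γ₀
  generalize angGrad b f (fun x => fderiv ℝ f x x) x = Γ₁
  generalize ∑ i, fderiv ℝ (fderiv ℝ f) x (b i) (b i) = S
  generalize fderiv ℝ (fderiv ℝ f) x x x = s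
  generalize fderiv ℝ f x x = e
  generalize f x = q
  generalize W x = W₀
  generalize μ ‖x‖ = μ₀
  generalize μ' ‖x‖ = μ₁
  generalize ψ ‖x‖ = ψ₀
  generalize ψ' ‖x‖ = ψ₁
  generalize c ‖x‖ = c₀
  generalize ‖x‖ = r at *
  field_simp
  ring

end RealInequalities

/-! ### Passing to L² limits in weighted inner products. -/

section SquareIntegrableLimits

variable {E : Type*} [NormedAddCommGroup E] [InnerProductSpace ℝ E] [FiniteDimensional ℝ E]
  [MeasurableSpace E] [BorelSpace E]

/-- Convergence in `L²` for sequences of functions. -/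
structure TendstoL2 (u : ℕ → E → ℂ) (v : E → ℂ) : Prop where
  memLp : ∀ j, MemLp (u j) 2 volume
  memLp_lim : MemLp v 2 volume
  tendsto : Tendsto (fun j => eLpNorm (u j - v) 2 volume) atTop (𝓝 0)

theorem BddMeas.memLp_smul {w : E → ℝ} (hw : BddMeas w) {u : E → ℂ} (hu : MemLp u 2 volume) :
    MemLp (fun x => w x • u x) 2 volume := by
  obtain ⟨h1, C, hC⟩ := hw
  refine hu.of_le_mul (c := C) (h1.smul hu.1) ?_
  filter_upwards [hC] with x hx
  rw [norm_smul]
  gcongr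
  exact hx

theorem TendstoL2.add {u u' : ℕ → E → ℂ} {v v' : E → ℂ} (h : TendstoL2 u v) (h' : TendstoL2 u' v') :
    TendstoL2 (fun j x => u j x + u' j x) (fun x => v x + v' x) := by
  refine ⟨fun j => (h.memLp j).add (h'.memLp j), h.memLp_lim.add h'.memLp_lim, ?_⟩
  have := h.tendsto.add h'.tendsto
  rw [add_zero] at this
  refine tendsto_of_tendsto_of_tendsto_of_le_of_le tendsto_const_nhds this (fun _ => zero_le) fun j => ?_
  have e : (fun x => u j x + u' j x) - (fun x => v x + v' x) = (u j - v) + (u' j - v') := by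
    funext x; simp only [Pi.sub_apply, Pi.add_apply]; ring
  simp only [e]
  exact eLpNorm_add_le ((h.memLp j).sub h.memLp_lim).1 ((h'.memLp j).sub h'.memLp_lim).1
    (by norm_num)

theorem TendstoL2.smul {w : E → ℝ} (hw : BddMeas w) {u : ℕ → E → ℂ} {v : E → ℂ}
    (h : TendstoL2 u v) : TendstoL2 (fun j x => w x • u j x) (fun x => w x • v x) := by
  refine ⟨fun j => hw.memLp_smul (h.memLp j), hw.memLp_smul h.memLp_lim, ?_⟩
  obtain ⟨h1, C, hC⟩ := hw
  have := ENNReal.Tendsto.const_mul h.tendsto (Or.inr (ENNReal.ofReal_ne_top (r := C)))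
  rw [mul_zero] at this
  refine tendsto_of_tendsto_of_tendsto_of_le_of_le tendsto_const_nhds this (fun _ => zero_le) fun j => ?_
  refine eLpNorm_le_mul_eLpNorm_of_ae_le_mul ?_ 2
  filter_upwards [hC] with x hx
  simp only [Pi.sub_apply]
  rw [← smul_sub, norm_smul]
  gcongr
  exact hx

theorem TendstoL2.neg {u : ℕ → E → ℂ} {v : E → ℂ} (h : TendstoL2 u v) :
    TendstoL2 (fun j x => -u j x) (fun x => -v x) := by
  simpa using h.smul (BddMeas.const (-1))

theorem integrable_mul_inner {w : E → ℝ} (hw : BddMeas w) {u v : E → ℂ} (hu : MemLp u 2 volume)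
    (hv : MemLp v 2 volume) : Integrable (fun x => w x * inner ℝ (u x) (v x)) := by
  have h := MeasureTheory.L2.integrable_inner (𝕜 := ℝ) ((hw.memLp_smul hu).toLp _) (hv.toLp v)
  refine h.congr ?_
  filter_upwards [(hw.memLp_smul hu).coeFn_toLp, hv.coeFn_toLp] with x h1 h2
  rw [h1, h2, real_inner_smul_left]

/-- Every term of the two inequalities is a bounded weight times an inner product of square
integrable functions, so this alone carries them from test functions to H². -/
theorem TendstoL2.tendsto_integral {w : E → ℝ} (hw : BddMeas w) {u u' : ℕ → E → ℂ} {v v' : E → ℂ}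
    (h : TendstoL2 u v) (h' : TendstoL2 u' v') :
    Tendsto (fun j => ∫ x, w x * inner ℝ (u j x) (u' j x)) atTop
      (𝓝 (∫ x, w x * inner ℝ (v x) (v' x))) := by
  have hs := h.smul hw
  have t1 := (Lp.tendsto_Lp_iff_tendsto_eLpNorm'' _ hs.memLp _ hs.memLp_lim).2 hs.tendsto
  have t2 := (Lp.tendsto_Lp_iff_tendsto_eLpNorm'' _ h'.memLp _ h'.memLp_lim).2 h'.tendsto
  have t3 := t1.inner (𝕜 := ℝ) t2
  have e : ∀ {a b : E → ℂ} (ha : MemLp (fun x => w x • a x) 2 volume) (hb : MemLp b 2 volume),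
      inner ℝ (ha.toLp _) (hb.toLp b) = ∫ x, w x * inner ℝ (a x) (b x) := by
    intro a b ha hb
    rw [MeasureTheory.L2.inner_def]
    refine integral_congr_ae ?_
    filter_upwards [ha.coeFn_toLp, hb.coeFn_toLp] with x h1 h2
    rw [h1, h2, real_inner_smul_left]
  simpa only [e] using t3

theorem integral_sub_sub {a b c : E → ℝ} (ha : Integrable a) (hb : Integrable b)
    (hc : Integrable c) : (∫ x, a x) - (∫ x, b x) - ∫ x, c x = ∫ x, (a x - b x - c x) := by
  rw [← integral_sub ha hb]
  exact (integral_sub (ha.sub hb) hc).symm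

end SquareIntegrableLimits

/-! ### Complex test functions, the radial derivative of an H² function, and the two inequalities
for it. -/

section ComplexInequalities

open scoped ContDiff

variable {E : Type*} [NormedAddCommGroup E] [InnerProductSpace ℝ E] [FiniteDimensional ℝ E]

omit [FiniteDimensional ℝ E] in
theorem radialDeriv_clm_comp {F : Type*} [NormedAddCommGroup F] [NormedSpace ℝ F] (L : F →L[ℝ] ℝ)
    {u : E → F} (hu : ContDiff ℝ ∞ u) (ν : ℝ) (x : E) :
    radialDeriv ν (fun x => L (u x)) x = L (radialDeriv ν u x) := by
  have h1 : fderiv ℝ (fun x => L (u x)) x = L.comp (fderiv ℝ u x) :=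
    (L.hasFDerivAt.comp x ((hu.differentiable (by simp)) x).hasFDerivAt).fderiv
  simp [radialDeriv, h1, smul_eq_mul, mul_add]

theorem laplacian_clm_comp {F : Type*} [NormedAddCommGroup F] [NormedSpace ℝ F] (L : F →L[ℝ] ℝ)
    {u : E → F} (hu : ContDiff ℝ ∞ u) (x : E) : Δ (fun x => L (u x)) x = L (Δ u x) :=
  (contDiff_infty.1 hu 2).contDiffAt.laplacian_CLM_comp_left (l := L)

omit [FiniteDimensional ℝ E] in
theorem radialDeriv_sub {u v : E → ℂ} (hu : ContDiff ℝ ∞ u) (hv : ContDiff ℝ ∞ v) (ν : ℝ) (x : E) :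
    radialDeriv ν (u - v) x = radialDeriv ν u x - radialDeriv ν v x := by
  have h1 : fderiv ℝ (u - v) x = fderiv ℝ u x - fderiv ℝ v x :=
    fderiv_sub ((hu.differentiable (by simp)) x) ((hv.differentiable (by simp)) x)
  simp only [radialDeriv, h1, sub_apply, Pi.sub_apply]
  module

variable [MeasurableSpace E] [BorelSpace E]

/-- The term (ν/2r)u is singular at the origin even for smooth u, but 1/r² is locally integrable in
dimension at least 3. -/
theorem memLp_radialDeriv (hdim : 3 ≤ Module.finrank ℝ E) {u : E → ℂ} (hu : ContDiff ℝ ∞ u)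
    (hc : HasCompactSupport u) (ν : ℝ) : MemLp (radialDeriv ν u) 2 volume := by
  have hcont : Continuous (fun x => fderiv ℝ u x x + (ν / 2) • u x) := by
    have h1 := (hu.continuous_fderiv (by simp)).clm_apply continuous_id
    have h2 := hu.continuous
    exact h1.add (by fun_prop)
  have hcs : HasCompactSupport (fun x => fderiv ℝ u x x + (ν / 2) • u x) := by
    refine HasCompactSupport.add ?_ (hc.smul_left (f := fun _ => ν / 2))
    exact (hc.fderiv (𝕜 := ℝ)).mono fun x hx => by
      contrapose! hx
      simp only [Function.mem_support, not_not] at hx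
      simp [hx]
  have hm : AEStronglyMeasurable (radialDeriv ν u) volume :=
    (measurable_norm.inv.aestronglyMeasurable).smul hcont.aestronglyMeasurable
  rw [memLp_two_iff_integrable_sq_norm hm]
  obtain ⟨R, hR⟩ := hcs.isCompact.isBounded.subset_ball 0
  have hb : BddMeas (fun x => ‖fderiv ℝ u x x + (ν / 2) • u x‖) :=
    .of_hasCompactSupport hcont.norm hcs.norm
  refine (hb.pow.integrable_div_sq hdim (R := R) fun x hx => ?_).congr (ae_of_all _ fun x => ?_)
  · have hx' : x ∉ tsupport (fun x => fderiv ℝ u x x + (ν / 2) • u x) := fun h => by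
      have := hR h
      simp at this
      linarith
    have := image_eq_zero_of_notMem_tsupport hx'
    simp only [this]
    simp
  · simp only [radialDeriv, norm_smul, norm_inv, norm_norm]
    ring

theorem memLp_laplacian {u : E → ℂ} (hu : ContDiff ℝ ∞ u) (hc : HasCompactSupport u) :
    MemLp (Δ u) 2 volume := by
  have e : Δ u = fun x => ∑ i, fderiv ℝ (fderiv ℝ u) x (stdOrthonormalBasis ℝ E i)
      (stdOrthonormalBasis ℝ E i) :=
    funext fun x => laplacian_eq_sum_fderiv_fderiv _ u x
  have h2 : Continuous (fderiv ℝ (fderiv ℝ u)) :=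
    (hu.fderiv_right (m := ∞) (by simp)).continuous_fderiv (by simp)
  have h3 : HasCompactSupport (Δ u) := by
    refine ((hc.fderiv (𝕜 := ℝ)).fderiv (𝕜 := ℝ)).mono fun x hx => ?_
    contrapose! hx
    simp only [Function.mem_support, not_not] at hx
    simp [e, hx]
  refine Continuous.memLp_of_hasCompactSupport ?_ h3
  rw [e]
  fun_prop

variable {ϕ ψ ψ' μ μ' : ℝ → ℝ} {B : ℝ} {ι : Type*} [Fintype ι] {N : ℕ}

theorem Complex.real_inner_eq (z w : ℂ) : inner ℝ z w = z.re * w.re + z.im * w.im := by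
  rw [Complex.inner]
  simp
  ring

theorem memLp_re {u : E → ℂ} (hu : MemLp u 2 volume) :
    MemLp (fun x => ((u x).re : ℂ)) 2 volume :=
  hu.of_le (Complex.continuous_ofReal.comp_aestronglyMeasurable
    (Complex.continuous_re.comp_aestronglyMeasurable hu.1)) (ae_of_all _ fun x => by
      simpa using Complex.abs_re_le_norm (u x))

theorem memLp_im {u : E → ℂ} (hu : MemLp u 2 volume) :
    MemLp (fun x => ((u x).im : ℂ)) 2 volume :=
  hu.of_le (Complex.continuous_ofReal.comp_aestronglyMeasurable
    (Complex.continuous_im.comp_aestronglyMeasurable hu.1)) (ae_of_all _ fun x => by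
      simpa using Complex.abs_im_le_norm (u x))

theorem integrable_mul_re_and_im {w : E → ℝ} (hw : BddMeas w) {u v : E → ℂ}
    (hu : MemLp u 2 volume) (hv : MemLp v 2 volume) :
    Integrable (fun x => w x * ((u x).re * (v x).re)) ∧
    Integrable (fun x => w x * ((u x).im * (v x).im)) := by
  have h1 := integrable_mul_inner hw (memLp_re hu) (memLp_re hv)
  have h2 := integrable_mul_inner hw (memLp_im hu) (memLp_im hv)
  simp only [Complex.real_inner_eq, Complex.ofReal_re, Complex.ofReal_im, mul_zero, add_zero] at h1 h2
  exact ⟨h1, h2⟩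

/-- All weights are real, so the real inequality for the real and imaginary parts can be added. Each
part must be integrable separately before the integrals are joined. -/
theorem integral_sq_radialDeriv_le_complex (b : OrthonormalBasis ι ℝ E)
    (hN : Module.finrank ℝ E = N + 3) {ν : ℝ} (hν : ν = N + 2) (hϕ : RadialPhase ϕ ψ ψ' B)
    {u : E → ℂ} (hu : ContDiff ℝ ∞ u) (hc : HasCompactSupport u) :
    0 ≤ ∫ x, Real.exp (2 * ϕ ‖x‖) * (ψ ‖x‖ ^ 2 * ‖u x‖ ^ 2 - inner ℝ (Δ u x) (u x) -
      ‖radialDeriv ν u x + ψ ‖x‖ • u x‖ ^ 2) := by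
  have hdim : 3 ≤ Module.finrank ℝ E := by omega
  have bX := hϕ.bddMeas_exp (E := E) hdim
  have bψ := hϕ.bddMeas_deriv (E := E) hdim
  have mu : MemLp u 2 volume := hu.continuous.memLp_of_hasCompactSupport hc
  have mD := memLp_laplacian hu hc
  have mQ : MemLp (fun x => radialDeriv ν u x + ψ ‖x‖ • u x) 2 volume :=
    (memLp_radialDeriv hdim hu hc ν).add (bψ.memLp_smul mu)
  obtain ⟨a1, a2⟩ := integrable_mul_re_and_im (bX.mul bψ.pow) mu mu
  obtain ⟨b1, b2⟩ := integrable_mul_re_and_im bX mD mu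
  obtain ⟨c1, c2⟩ := integrable_mul_re_and_im bX mQ mQ
  have h1 := integral_sq_radialDeriv_le b hN hν hϕ (f := fun x => Complex.reCLM (u x))
    (Complex.reCLM.contDiff.comp hu) (hc.comp_left (g := Complex.reCLM) (map_zero _))
  have h2 := integral_sq_radialDeriv_le b hN hν hϕ (f := fun x => Complex.imCLM (u x))
    (Complex.imCLM.contDiff.comp hu) (hc.comp_left (g := Complex.imCLM) (map_zero _))
  simp only [radialDeriv_clm_comp Complex.reCLM hu, laplacian_clm_comp Complex.reCLM hu] at h1
  simp only [radialDeriv_clm_comp Complex.imCLM hu, laplacian_clm_comp Complex.imCLM hu] at h2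
  simp only [Complex.reCLM_apply, Complex.imCLM_apply] at h1 h2
  refine (add_nonneg h1 h2).trans_eq ?_
  rw [← integral_add]
  · refine integral_congr_ae (ae_of_all _ fun x => ?_)
    simp only [Complex.real_inner_eq, Complex.sq_norm, Complex.normSq_apply, Complex.add_re,
      Complex.add_im, Complex.real_smul, Complex.re_ofReal_mul, Complex.im_ofReal_mul]
    ring
  · refine ((a1.sub b1).sub c1).congr (ae_of_all _ fun x => ?_)
    simp only [Pi.sub_apply, Complex.add_re, Complex.real_smul, Complex.re_ofReal_mul]
    ring
  · refine ((a2.sub b2).sub c2).congr (ae_of_all _ fun x => ?_)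
    simp only [Pi.sub_apply, Complex.add_im, Complex.real_smul, Complex.im_ofReal_mul]
    ring

theorem integral_radial_multiplier_nonneg_complex (b : OrthonormalBasis ι ℝ E)
    (hN : Module.finrank ℝ E = N + 3) {ν : ℝ} (hν : ν = N + 2) (hϕ : RadialPhase ϕ ψ ψ' B)
    (hμ : RadialMultiplier μ μ' B) {W : E → ℝ} {c : ℝ → ℝ} (hW : BddMeas W)
    (hWr : ∀ w : E, ‖w‖ = 1 → ContinuousOn (fun r : ℝ => W (r • w)) (Ici 0) ∧
      ∀ r, 0 < r → ∃ d, d ≤ c r ∧ HasDerivWithinAt (fun r : ℝ => W (r • w)) d (Ioi r) r)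
    (hcm : Measurable c) (hcb : ∀ r, 0 < r → |c r| ≤ B)
    {u : E → ℂ} (hu : ContDiff ℝ ∞ u) (hc : HasCompactSupport u) :
    0 ≤ ∫ x, Real.exp (2 * ϕ ‖x‖) *
      (2 * μ ‖x‖ * inner ℝ (-Δ u x + W x • u x - ψ' ‖x‖ • u x) (radialDeriv ν u x + ψ ‖x‖ • u x) -
      (μ' ‖x‖ + 4 * (μ ‖x‖ * ψ ‖x‖)) * ‖radialDeriv ν u x + ψ ‖x‖ • u x‖ ^ 2 -
      (μ' ‖x‖ * ψ ‖x‖ ^ 2 + 2 * (μ ‖x‖ * (ψ ‖x‖ * ψ' ‖x‖)) - μ' ‖x‖ * W x - c ‖x‖ * μ ‖x‖) *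
        ‖u x‖ ^ 2) := by
  have hdim : 3 ≤ Module.finrank ℝ E := by omega
  have bX := hϕ.bddMeas_exp (E := E) hdim
  have bψ := hϕ.bddMeas_deriv (E := E) hdim
  have bψ' := hϕ.bddMeas_second (E := E) hdim
  have bμ := hμ.bddMeas (E := E) hdim
  have bμ' := hμ.bddMeas_deriv (E := E) hdim
  have bc : BddMeas (fun x : E => c ‖x‖) := BddMeas.of_measurable hdim hcm hcb
  have b2 : BddMeas (fun _ : E => (2 : ℝ)) := BddMeas.const _
  have b4 : BddMeas (fun _ : E => (4 : ℝ)) := BddMeas.const _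
  have mu : MemLp u 2 volume := hu.continuous.memLp_of_hasCompactSupport hc
  have mD := memLp_laplacian hu hc
  have mQ : MemLp (fun x => radialDeriv ν u x + ψ ‖x‖ • u x) 2 volume :=
    (memLp_radialDeriv hdim hu hc ν).add (bψ.memLp_smul mu)
  have mH : MemLp (fun x => -Δ u x + W x • u x - ψ' ‖x‖ • u x) 2 volume :=
    (mD.neg.add (hW.memLp_smul mu)).sub (bψ'.memLp_smul mu)
  obtain ⟨a1, a2⟩ := integrable_mul_re_and_im (bX.mul (b2.mul bμ)) mH mQ
  obtain ⟨b1, b2'⟩ := integrable_mul_re_and_im (bX.mul (bμ'.add (b4.mul (bμ.mul bψ)))) mQ mQ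
  obtain ⟨c1, c2⟩ := integrable_mul_re_and_im (bX.mul ((((bμ'.mul bψ.pow).add
    (b2.mul (bμ.mul (bψ.mul bψ')))).sub (bμ'.mul hW)).sub (bc.mul bμ))) mu mu
  have h1 := integral_radial_multiplier_nonneg b hN hν hϕ hμ hW hWr hcm hcb
    (f := fun x => Complex.reCLM (u x))
    (Complex.reCLM.contDiff.comp hu) (hc.comp_left (g := Complex.reCLM) (map_zero _))
  have h2 := integral_radial_multiplier_nonneg b hN hν hϕ hμ hW hWr hcm hcb
    (f := fun x => Complex.imCLM (u x))
    (Complex.imCLM.contDiff.comp hu) (hc.comp_left (g := Complex.imCLM) (map_zero _))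
  simp only [radialDeriv_clm_comp Complex.reCLM hu, laplacian_clm_comp Complex.reCLM hu] at h1
  simp only [radialDeriv_clm_comp Complex.imCLM hu, laplacian_clm_comp Complex.imCLM hu] at h2
  simp only [Complex.reCLM_apply, Complex.imCLM_apply] at h1 h2
  refine (add_nonneg h1 h2).trans_eq ?_
  rw [← integral_add]
  · refine integral_congr_ae (ae_of_all _ fun x => ?_)
    simp only [Complex.real_inner_eq, Complex.sq_norm, Complex.normSq_apply, Complex.add_re,
      Complex.add_im, Complex.real_smul, Complex.re_ofReal_mul, Complex.im_ofReal_mul,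
      Complex.sub_re, Complex.sub_im, Complex.neg_re, Complex.neg_im]
    ring
  · refine ((a1.sub b1).sub c1).congr (ae_of_all _ fun x => ?_)
    simp only [Pi.sub_apply, Complex.add_re, Complex.real_smul, Complex.re_ofReal_mul,
      Complex.sub_re, Complex.neg_re]
    ring
  · refine ((a2.sub b2').sub c2).congr (ae_of_all _ fun x => ?_)
    simp only [Pi.sub_apply, Complex.add_im, Complex.real_smul, Complex.im_ofReal_mul,
      Complex.sub_im, Complex.neg_im]
    ring

/-- `d` is the radial derivative of the square integrable function `f` with Laplacian `g`, in the
sense of approximation by test functions. -/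
structure HasRadialDeriv (ν : ℝ) (f g d : E → ℂ) : Prop where
  exists_approx : ∃ u : ℕ → E → ℂ, (∀ j, ContDiff ℝ ∞ (u j) ∧ HasCompactSupport (u j)) ∧
    TendstoL2 u f ∧ TendstoL2 (fun j => Δ (u j)) g ∧ TendstoL2 (fun j => radialDeriv ν (u j)) d

/-- The elliptic inequality with trivial weight, applied to differences of approximants, bounds
‖D(u_i - u_j)‖² by ‖Δ(u_i - u_j)‖·‖u_i - u_j‖. The radial derivatives are therefore Cauchy, and no
separate control of the gradient of f is needed. -/
theorem exists_hasRadialDeriv (hN : Module.finrank ℝ E = N + 3) {ν : ℝ} (hν : ν = N + 2)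
    {f g : Lp ℂ 2 (volume : Measure E)}
    (hf : TemperedDistribution.MemSobolev 2 2 (f : 𝓢'(E, ℂ)))
    (hg : Δ (f : 𝓢'(E, ℂ)) = (g : 𝓢'(E, ℂ))) : ∃ d, HasRadialDeriv ν f g d := by
  have hdim : 3 ≤ Module.finrank ℝ E := by omega
  choose u hu hc hfu hgu using fun j : ℕ =>
    exists_contDiff_approx hf hg (ε := 1 / ((j : ℝ) + 1)) (by positivity)
  have mu : ∀ j, MemLp (u j) 2 volume := fun j => (hu j).continuous.memLp_of_hasCompactSupport (hc j)
  have mD := fun j => memLp_laplacian (hu j) (hc j)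
  have mR := fun j => memLp_radialDeriv hdim (hu j) (hc j) ν
  have hlim : Tendsto (fun j : ℕ => ENNReal.ofReal (1 / ((j : ℝ) + 1))) atTop (𝓝 0) := by
    have := (ENNReal.continuous_ofReal.tendsto 0).comp
      (tendsto_one_div_add_atTop_nhds_zero_nat (𝕜 := ℝ))
    rwa [ENNReal.ofReal_zero] at this
  have tu : TendstoL2 u f := ⟨mu, Lp.memLp f, tendsto_of_tendsto_of_tendsto_of_le_of_le
    tendsto_const_nhds hlim (fun _ => zero_le) hfu⟩
  have tD : TendstoL2 (fun j => Δ (u j)) g := ⟨mD, Lp.memLp g,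
    tendsto_of_tendsto_of_tendsto_of_le_of_le tendsto_const_nhds hlim (fun _ => zero_le) hgu⟩
  have hz : RadialPhase (fun _ => 0) (fun _ => 0) (fun _ => 0) 0 :=
    ⟨continuousOn_const, continuousOn_const, fun _ _ => hasDerivWithinAt_const _ _ _,
      fun _ _ => hasDerivWithinAt_const _ _ _, measurable_const, by simp, by simp, by simp⟩
  have hU : ∀ U : E → ℂ, ContDiff ℝ ∞ U → HasCompactSupport U →
      ∫ x, ‖radialDeriv ν U x‖ ^ 2 ≤ -∫ x, inner ℝ (Δ U x) (U x) := by
    intro U hU hUc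
    have h := integral_sq_radialDeriv_le_complex (stdOrthonormalBasis ℝ E) hN hν hz hU hUc
    have i1 : Integrable (fun x => ‖radialDeriv ν U x‖ ^ 2) :=
      (memLp_two_iff_integrable_sq_norm (memLp_radialDeriv hdim hU hUc ν).1).1
        (memLp_radialDeriv hdim hU hUc ν)
    have i2 : Integrable (fun x => inner ℝ (Δ U x) (U x)) :=
      (integrable_mul_inner (BddMeas.const 1) (memLp_laplacian hU hUc)
        (hU.continuous.memLp_of_hasCompactSupport hUc)).congr (ae_of_all _ fun x => one_mul _)
    have h' : 0 ≤ ∫ x, (-inner ℝ (Δ U x) (U x) - ‖radialDeriv ν U x‖ ^ 2) := by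
      refine h.trans_eq (integral_congr_ae (ae_of_all _ fun x => ?_))
      simp
    rw [integral_sub (by exact i2.neg) i1, integral_neg] at h'
    linarith
  have key : ∀ i j, ‖(mR i).toLp _ - (mR j).toLp _‖ ^ 2 ≤
      ‖(mD i).toLp _ - (mD j).toLp _‖ * ‖(mu i).toLp _ - (mu j).toLp _‖ := by
    intro i j
    have e1 : ‖(mR i).toLp _ - (mR j).toLp _‖ ^ 2 = ∫ x, ‖radialDeriv ν (u i - u j) x‖ ^ 2 := by
      rw [← real_inner_self_eq_norm_sq, MeasureTheory.L2.inner_def, ← MemLp.toLp_sub]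
      refine integral_congr_ae ?_
      filter_upwards [((mR i).sub (mR j)).coeFn_toLp] with x hx
      rw [hx, real_inner_self_eq_norm_sq, radialDeriv_sub (hu i) (hu j)]
      rfl
    have e2 : inner ℝ ((mD i).toLp _ - (mD j).toLp _) ((mu i).toLp _ - (mu j).toLp _) =
        ∫ x, inner ℝ (Δ (u i - u j) x) ((u i - u j) x) := by
      rw [MeasureTheory.L2.inner_def, ← MemLp.toLp_sub, ← MemLp.toLp_sub]
      refine integral_congr_ae ?_
      filter_upwards [((mD i).sub (mD j)).coeFn_toLp, ((mu i).sub (mu j)).coeFn_toLp] with x h1 h2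
      rw [h1, h2, (contDiff_infty.1 (hu i) 2).contDiffAt.laplacian_sub
        (contDiff_infty.1 (hu j) 2).contDiffAt]
      rfl
    have h' := hU (u i - u j) ((hu i).sub (hu j)) ((hc i).sub (hc j))
    rw [← e1, ← e2] at h'
    have h3 := abs_real_inner_le_norm ((mD i).toLp _ - (mD j).toLp _)
      ((mu i).toLp _ - (mu j).toLp _)
    have h4 := neg_abs_le (inner ℝ ((mD i).toLp _ - (mD j).toLp _) ((mu i).toLp _ - (mu j).toLp _))
    linarith
  have hb : ∀ {v : ℕ → E → ℂ} (hv : ∀ j, MemLp (v j) 2 volume) (l : Lp ℂ 2 (volume : Measure E)),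
      (∀ j, eLpNorm (fun x => v j x - l x) 2 volume ≤ ENNReal.ofReal (1 / ((j : ℝ) + 1))) →
      ∀ n i j : ℕ, n ≤ i → n ≤ j → ‖(hv i).toLp _ - (hv j).toLp _‖ ≤ 2 / ((n : ℝ) + 1) := by
    intro v hv l h n i j hi hj
    have h1 : ∀ i : ℕ, n ≤ i → ‖(hv i).toLp _ - l‖ ≤ 1 / ((n : ℝ) + 1) := fun i hi => by
      rw [Lp.norm_def]
      refine ENNReal.toReal_le_of_le_ofReal (by positivity) ?_
      have : eLpNorm ((hv i).toLp _ - l : Lp ℂ 2 (volume : Measure E)) 2 volume =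
          eLpNorm (fun x => v i x - l x) 2 volume := by
        refine eLpNorm_congr_ae ?_
        filter_upwards [Lp.coeFn_sub ((hv i).toLp _) l, (hv i).coeFn_toLp] with x h1 h2
        rw [h1, Pi.sub_apply, h2]
      rw [this]
      refine (h i).trans (ENNReal.ofReal_le_ofReal ?_)
      have : (n : ℝ) ≤ i := by exact_mod_cast hi
      gcongr
    have h2 := norm_sub_le_norm_sub_add_norm_sub ((hv i).toLp _) l ((hv j).toLp _)
    rw [norm_sub_rev l] at h2
    refine h2.trans ((add_le_add (h1 i hi) (h1 j hj)).trans_eq (by ring))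
  have hcau : CauchySeq (fun j => (mR j).toLp _) := by
    refine cauchySeq_of_le_tendsto_0' (fun n : ℕ => 2 / ((n : ℝ) + 1)) ?_ ?_
    · intro n j hnj
      rw [dist_eq_norm]
      have h1 := hb mu f hfu n n j le_rfl hnj
      have h2 := hb mD g hgu n n j le_rfl hnj
      refine abs_le_of_sq_le_sq' ((key n j).trans ?_) (by positivity) |>.2
      rw [sq]
      exact mul_le_mul h2 h1 (norm_nonneg _) (by positivity)
    · simpa [div_eq_mul_inv] using (tendsto_one_div_add_atTop_nhds_zero_nat (𝕜 := ℝ)).const_mul 2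
  obtain ⟨d, hd⟩ := cauchySeq_tendsto_of_complete hcau
  refine ⟨d, ⟨u, fun j => ⟨hu j, hc j⟩, tu, tD, ⟨mR, Lp.memLp d, ?_⟩⟩⟩
  have := (Lp.tendsto_Lp_iff_tendsto_eLpNorm'' _ mR _ (Lp.memLp d)).1 (by rwa [Lp.toLp_coeFn])
  exact this

theorem HasRadialDeriv.integral_sq_le {f g d : E → ℂ} {ν : ℝ} (h : HasRadialDeriv ν f g d)
    (hN : Module.finrank ℝ E = N + 3) (hν : ν = N + 2) (hϕ : RadialPhase ϕ ψ ψ' B) :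
    Integrable (fun x => Real.exp (2 * ϕ ‖x‖) * (ψ ‖x‖ ^ 2 * ‖f x‖ ^ 2 - inner ℝ (g x) (f x) -
      ‖d x + ψ ‖x‖ • f x‖ ^ 2)) ∧
    0 ≤ ∫ x, Real.exp (2 * ϕ ‖x‖) * (ψ ‖x‖ ^ 2 * ‖f x‖ ^ 2 - inner ℝ (g x) (f x) -
      ‖d x + ψ ‖x‖ • f x‖ ^ 2) := by
  have hdim : 3 ≤ Module.finrank ℝ E := by omega
  have bX := hϕ.bddMeas_exp (E := E) hdim
  have bψ := hϕ.bddMeas_deriv (E := E) hdim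
  obtain ⟨u, hu, tf, tg, td⟩ := h
  have tQ := td.add (tf.smul bψ)
  have t := ((tf.tendsto_integral (bX.mul bψ.pow) tf).sub (tg.tendsto_integral bX tf)).sub
    (tQ.tendsto_integral bX tQ)
  -- The regrouping is stated for arbitrary square integrable functions so that it serves both the
  -- approximants and the limit.
  have e : ∀ {f g q : E → ℂ}, MemLp f 2 volume → MemLp g 2 volume → MemLp q 2 volume →
      Integrable (fun x => Real.exp (2 * ϕ ‖x‖) * (ψ ‖x‖ ^ 2 * ‖f x‖ ^ 2 - inner ℝ (g x) (f x) -
        ‖q x‖ ^ 2)) ∧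
      (∫ x, Real.exp (2 * ϕ ‖x‖) * ψ ‖x‖ ^ 2 * inner ℝ (f x) (f x)) -
      (∫ x, Real.exp (2 * ϕ ‖x‖) * inner ℝ (g x) (f x)) -
      (∫ x, Real.exp (2 * ϕ ‖x‖) * inner ℝ (q x) (q x)) =
      ∫ x, Real.exp (2 * ϕ ‖x‖) * (ψ ‖x‖ ^ 2 * ‖f x‖ ^ 2 - inner ℝ (g x) (f x) - ‖q x‖ ^ 2) := by
    intro f g q hf hg hq
    have i1 := integrable_mul_inner (bX.mul bψ.pow) hf hf
    have i2 := integrable_mul_inner bX hg hf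
    have i3 := integrable_mul_inner bX hq hq
    rw [integral_sub_sub i1 i2 i3]
    refine ⟨((i1.sub i2).sub i3).congr (ae_of_all _ fun x => ?_),
      integral_congr_ae (ae_of_all _ fun x => ?_)⟩
    all_goals
      simp only [Pi.sub_apply, real_inner_self_eq_norm_sq]
      ring
  refine ⟨(e tf.memLp_lim tg.memLp_lim tQ.memLp_lim).1, ?_⟩
  rw [(e tf.memLp_lim tg.memLp_lim tQ.memLp_lim).2] at t
  refine ge_of_tendsto' t fun j => ?_
  rw [(e (tf.memLp j) (tg.memLp j) (tQ.memLp j)).2]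
  exact integral_sq_radialDeriv_le_complex (stdOrthonormalBasis ℝ E) hN hν hϕ (hu j).1 (hu j).2

theorem HasRadialDeriv.integral_multiplier_nonneg {f g d : E → ℂ} {ν : ℝ}
    (h : HasRadialDeriv ν f g d) (hN : Module.finrank ℝ E = N + 3) (hν : ν = N + 2)
    (hϕ : RadialPhase ϕ ψ ψ' B)
    (hμ : RadialMultiplier μ μ' B) {W : E → ℝ} {c : ℝ → ℝ} (hW : BddMeas W)
    (hWr : ∀ w : E, ‖w‖ = 1 → ContinuousOn (fun r : ℝ => W (r • w)) (Ici 0) ∧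
      ∀ r, 0 < r → ∃ d, d ≤ c r ∧ HasDerivWithinAt (fun r : ℝ => W (r • w)) d (Ioi r) r)
    (hcm : Measurable c) (hcb : ∀ r, 0 < r → |c r| ≤ B) :
    Integrable (fun x => Real.exp (2 * ϕ ‖x‖) *
      (2 * μ ‖x‖ * inner ℝ (-g x + W x • f x - ψ' ‖x‖ • f x) (d x + ψ ‖x‖ • f x) -
      (μ' ‖x‖ + 4 * (μ ‖x‖ * ψ ‖x‖)) * ‖d x + ψ ‖x‖ • f x‖ ^ 2 -
      (μ' ‖x‖ * ψ ‖x‖ ^ 2 + 2 * (μ ‖x‖ * (ψ ‖x‖ * ψ' ‖x‖)) - μ' ‖x‖ * W x - c ‖x‖ * μ ‖x‖) *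
        ‖f x‖ ^ 2)) ∧
    0 ≤ ∫ x, Real.exp (2 * ϕ ‖x‖) *
      (2 * μ ‖x‖ * inner ℝ (-g x + W x • f x - ψ' ‖x‖ • f x) (d x + ψ ‖x‖ • f x) -
      (μ' ‖x‖ + 4 * (μ ‖x‖ * ψ ‖x‖)) * ‖d x + ψ ‖x‖ • f x‖ ^ 2 -
      (μ' ‖x‖ * ψ ‖x‖ ^ 2 + 2 * (μ ‖x‖ * (ψ ‖x‖ * ψ' ‖x‖)) - μ' ‖x‖ * W x - c ‖x‖ * μ ‖x‖) *
        ‖f x‖ ^ 2) := by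
  have hdim : 3 ≤ Module.finrank ℝ E := by omega
  have bX := hϕ.bddMeas_exp (E := E) hdim
  have bψ := hϕ.bddMeas_deriv (E := E) hdim
  have bψ' := hϕ.bddMeas_second (E := E) hdim
  have bμ := hμ.bddMeas (E := E) hdim
  have bμ' := hμ.bddMeas_deriv (E := E) hdim
  have bc : BddMeas (fun x : E => c ‖x‖) := BddMeas.of_measurable hdim hcm hcb
  have b2 : BddMeas (fun _ : E => (2 : ℝ)) := BddMeas.const _
  have b4 : BddMeas (fun _ : E => (4 : ℝ)) := BddMeas.const _
  obtain ⟨u, hu, tf, tg, td⟩ := h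
  have tQ := td.add (tf.smul bψ)
  have tH := (tg.neg.add (tf.smul hW)).add (tf.smul bψ').neg
  simp only [← sub_eq_add_neg] at tH
  have w1 := bX.mul (b2.mul bμ)
  have w2 := bX.mul (bμ'.add (b4.mul (bμ.mul bψ)))
  have w3 := bX.mul ((((bμ'.mul bψ.pow).add
    (b2.mul (bμ.mul (bψ.mul bψ')))).sub (bμ'.mul hW)).sub (bc.mul bμ))
  have t := ((tH.tendsto_integral w1 tQ).sub (tQ.tendsto_integral w2 tQ)).sub
    (tf.tendsto_integral w3 tf)
  have e : ∀ {f H q : E → ℂ}, MemLp f 2 volume → MemLp H 2 volume → MemLp q 2 volume →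
      Integrable (fun x => Real.exp (2 * ϕ ‖x‖) * (2 * μ ‖x‖ * inner ℝ (H x) (q x) -
      (μ' ‖x‖ + 4 * (μ ‖x‖ * ψ ‖x‖)) * ‖q x‖ ^ 2 -
      (μ' ‖x‖ * ψ ‖x‖ ^ 2 + 2 * (μ ‖x‖ * (ψ ‖x‖ * ψ' ‖x‖)) - μ' ‖x‖ * W x - c ‖x‖ * μ ‖x‖) *
        ‖f x‖ ^ 2)) ∧
      (∫ x, Real.exp (2 * ϕ ‖x‖) * (2 * μ ‖x‖) * inner ℝ (H x) (q x)) -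
      (∫ x, Real.exp (2 * ϕ ‖x‖) * (μ' ‖x‖ + 4 * (μ ‖x‖ * ψ ‖x‖)) * inner ℝ (q x) (q x)) -
      (∫ x, Real.exp (2 * ϕ ‖x‖) * (μ' ‖x‖ * ψ ‖x‖ ^ 2 + 2 * (μ ‖x‖ * (ψ ‖x‖ * ψ' ‖x‖)) -
        μ' ‖x‖ * W x - c ‖x‖ * μ ‖x‖) * inner ℝ (f x) (f x)) =
      ∫ x, Real.exp (2 * ϕ ‖x‖) * (2 * μ ‖x‖ * inner ℝ (H x) (q x) -
      (μ' ‖x‖ + 4 * (μ ‖x‖ * ψ ‖x‖)) * ‖q x‖ ^ 2 -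
      (μ' ‖x‖ * ψ ‖x‖ ^ 2 + 2 * (μ ‖x‖ * (ψ ‖x‖ * ψ' ‖x‖)) - μ' ‖x‖ * W x - c ‖x‖ * μ ‖x‖) *
        ‖f x‖ ^ 2) := by
    intro f H q hf hH hq
    have i1 := integrable_mul_inner w1 hH hq
    have i2 := integrable_mul_inner w2 hq hq
    have i3 := integrable_mul_inner w3 hf hf
    rw [integral_sub_sub i1 i2 i3]
    refine ⟨((i1.sub i2).sub i3).congr (ae_of_all _ fun x => ?_),
      integral_congr_ae (ae_of_all _ fun x => ?_)⟩
    all_goals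
      simp only [Pi.sub_apply, real_inner_self_eq_norm_sq]
      ring
  refine ⟨(e tf.memLp_lim tH.memLp_lim tQ.memLp_lim).1, ?_⟩
  rw [(e tf.memLp_lim tH.memLp_lim tQ.memLp_lim).2] at t
  refine ge_of_tendsto' t fun j => ?_
  rw [(e (tf.memLp j) (tH.memLp j) (tQ.memLp j)).2]
  exact integral_radial_multiplier_nonneg_complex (stdOrthonormalBasis ℝ E) hN hν hϕ hμ hW hWr hcm
    hcb (hu j).1 (hu j).2

end ComplexInequalities

/-! ### The numerical conditions on the weight and the pointwise coercivity they give. -/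

section PointwiseBounds

theorem two_mul_mul_le_of_sq_le {X D B q Q : ℝ} (hD : 0 ≤ D) (hB : 0 ≤ B)
    (h : X ^ 2 ≤ B * D) (hq : 0 ≤ q) (hQ : 0 ≤ Q) : 2 * X * q * Q ≤ D * Q ^ 2 + B * q ^ 2 := by
  have h1 : X ≤ √B * √D := by
    rw [← Real.sqrt_mul hB]
    exact Real.le_sqrt_of_sq_le h
  have h2 : 0 ≤ (√D * Q - √B * q) ^ 2 := sq_nonneg _
  have h3 := Real.sq_sqrt hD
  have h4 := Real.sq_sqrt hB
  have h5 : X * (q * Q) ≤ √B * √D * (q * Q) := by gcongr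
  nlinarith

/-- The numbers D and B are chosen region by region below the true coefficients; the cross term is
absorbed once its squared coefficient is at most B·D. -/
theorem young_of_bound {X D B α γ q Q : ℝ} (hD : 0 ≤ D) (hB : 0 ≤ B) (h : X ^ 2 ≤ B * D)
    (hγ : B ≤ γ) (hα : D ≤ α) (hq : 0 ≤ q) (hQ : 0 ≤ Q) :
    0 ≤ α * Q ^ 2 + γ * q ^ 2 - 2 * X * q * Q := by
  have h1 := two_mul_mul_le_of_sq_le hD hB h hq hQ
  have h2 : D * Q ^ 2 ≤ α * Q ^ 2 := by gcongr
  have h3 : B * q ^ 2 ≤ γ * q ^ 2 := by gcongr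
  linarith

/-- The numerical relations between the parameters of the weight. -/
structure WeightBounds (E C S δ β h ε k a τ : ℝ) : Prop where
  E_pos : 0 < E
  C_pos : 0 < C
  S_pos : 0 < S
  h_pos : 0 < h
  h_lt : h < 1
  ε_pos : 0 < ε
  ε_le : ε ≤ 1
  k_pos : 0 < k
  k_le : k ≤ 1
  a_ge : 1 ≤ a
  τ_ge : 1 ≤ τ
  two_le : 2 ≤ (a + 1) ^ k
  -- This bound and the next three serve the inner region 2(r+1)^k ≤ (a+1)^k.
  phase_le : 2 * τ ^ 2 ≤ E / 6 * (a + 1) ^ k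
  long_le : ∀ R, 1 ≤ R → R * (C * R ^ (-β)) ≤ k * (E / 6 + τ ^ 2 / (4 * (R ^ k) ^ 4))
  short_le : ∀ R, 1 ≤ R → R * (S * R ^ (-δ)) ^ 2 * (R ^ k) ^ 5 ≤ k * (h * τ * τ ^ 2 / 4)
  h_mul_τ_le : h * τ ≤ E / 6
  -- The corresponding conditions for r < a with (a+1)^k ≤ 2(r+1)^k.
  phase_sq_le : 16 * τ ^ 2 ≤ E / 6 * ((a + 1) ^ k) ^ 2
  long_le_outer : ∀ R, 1 ≤ R → (a + 1) ^ k ≤ 2 * R ^ k → R * (C * R ^ (-β)) ≤ k * (E / 6)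
  short_le_outer : ∀ R, 1 ≤ R → (a + 1) ^ k ≤ 2 * R ^ k →
    2 * (R * (S * R ^ (-δ))) ^ 2 ≤ k ^ 2 * h ^ 2 * (E / 6)
  -- This bounds the growth of the multiplier beyond a, where it increases by at most ε⁻¹.
  inv_ε_le : ε⁻¹ ≤ ((a + 1) ^ k) ^ 2
  long_le_exterior : ∀ R, a + 1 ≤ R →
    C * R ^ (-β) * (2 * ((a + 1) ^ k) ^ 2) ≤ E / 6 * R ^ (-1 - ε)
  short_le_exterior : ∀ R, a + 1 ≤ R →
    8 * ((a + 1) ^ k) ^ 4 * (S * R ^ (-δ)) ^ 2 ≤ E / 6 * h ^ 2 * (R ^ (-1 - ε)) ^ 2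

/-- The radial multiplier. -/
noncomputable def multiplier (a k ε r : ℝ) : ℝ :=
  if r < a then (r + 1) ^ (2 * k) - 1
  else (a + 1) ^ (2 * k) - 1 + ε⁻¹ * ((a + 1) ^ (-ε) - (r + 1) ^ (-ε))

/-- The right derivative of the radial multiplier. -/
noncomputable def multiplierDeriv (a k ε r : ℝ) : ℝ :=
  if r < a then 2 * k * (r + 1) ^ (2 * k - 1) else (r + 1) ^ (-1 - ε)

/-- The right derivative of the derivative of the phase. -/
noncomputable def phaseSecond (a k τ r : ℝ) : ℝ :=
  if r < a then -(k * τ * (r + 1) ^ (-k - 1)) else 0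

/-- Here R = r + 1, P = R^k and Pa = (a+1)^k. The energy term is worth (k/R)(2E/3)P², of which the
phase, the long range part and the h φ'' part each take at most E/6. The positive phase term τ²/P²
is shared in quarters by the long range and short range errors. -/
theorem inner_bound {P Pa R k τ h E L s v : ℝ} (hk : 0 < k) (hk1 : k ≤ 1) (hP : 1 ≤ P)
    (hPR : P ≤ R) (hPa : 2 * P ≤ Pa) (hτ : 0 < τ) (hh : 0 < h) (hv : 0 ≤ v) (hvs : v ≤ s)
    (hE : 0 < E)
    (h1 : 2 * τ ^ 2 ≤ E / 6 * Pa) (h2 : R * L ≤ k * (E / 6 + τ ^ 2 / (4 * P ^ 4)))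
    (h3 : R * s ^ 2 * P ^ 5 ≤ k * (h * τ * τ ^ 2 / 4)) (h4 : h * τ ≤ E / 6) (hL : 0 ≤ L) :
    L * (P ^ 2 - 1) + (P ^ 2 - 1) * P * (v ^ 2 + h ^ 2 * (k * τ / (R * P)) ^ 2) / (h * τ) ≤
      2 * k * P ^ 2 / R * (τ * (1 / P - 1 / Pa)) ^ 2 -
        2 * (P ^ 2 - 1) * (τ * (1 / P - 1 / Pa)) * (k * τ / (R * P)) +
        E / 3 * (2 * k * P ^ 2 / R) := by
  have hP0 : 0 < P := by linarith
  have hR0 : 0 < R := by linarith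
  have hPa0 : 0 < Pa := by linarith
  have hK : 0 < k / R := by positivity
  -- The left side is the derivative of μφ'². The terms of size P cancel in the second factor on the
  -- right, leaving 1/P - P²/Pa.
  have eA : 2 * k * P ^ 2 / R * (τ * (1 / P - 1 / Pa)) ^ 2 -
        2 * (P ^ 2 - 1) * (τ * (1 / P - 1 / Pa)) * (k * τ / (R * P)) =
      k / R * (2 * τ ^ 2 * ((1 / P - 1 / Pa) * (1 / P - P ^ 2 / Pa))) := by
    field_simp
    ring
  have hx1 : 1 / (2 * P) ≤ 1 / P - 1 / Pa := by
    have : 1 / Pa ≤ 1 / (2 * P) := one_div_le_one_div_of_le (by linarith) hPa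
    have e : 1 / P = 1 / (2 * P) + 1 / (2 * P) := by field_simp; norm_num
    linarith
  have hx2 : 1 / P - 1 / Pa ≤ 1 / P := by
    have : 0 < 1 / Pa := by positivity
    linarith
  -- The second factor changes sign inside the region, so the lower or the upper bound on the first
  -- factor is used according to that sign.
  have hxy : 1 / (2 * P ^ 2) - P / Pa ≤ (1 / P - 1 / Pa) * (1 / P - P ^ 2 / Pa) := by
    rcases le_total 0 (1 / P - P ^ 2 / Pa) with hy | hy
    · have := mul_le_mul_of_nonneg_right hx1 hy
      refine le_trans ?_ this
      have e : 1 / (2 * P) * (1 / P - P ^ 2 / Pa) = 1 / (2 * P ^ 2) - P / Pa / 2 := by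
        field_simp
      rw [e]
      have : 0 < P / Pa := by positivity
      linarith
    · have := mul_le_mul_of_nonpos_right hx2 hy
      refine le_trans ?_ this
      have e : 1 / P * (1 / P - P ^ 2 / Pa) = 1 / (2 * P ^ 2) - P / Pa + 1 / (2 * P ^ 2) := by
        field_simp
        ring
      rw [e]
      have : 0 < 1 / (2 * P ^ 2) := by positivity
      linarith
  have hA : k / R * (τ ^ 2 / P ^ 2 - E / 6 * P ^ 2) ≤
      k / R * (2 * τ ^ 2 * ((1 / P - 1 / Pa) * (1 / P - P ^ 2 / Pa))) := by
    refine mul_le_mul_of_nonneg_left ?_ hK.le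
    have h5 : 2 * τ ^ 2 * (1 / (2 * P ^ 2) - P / Pa) ≤ _ :=
      mul_le_mul_of_nonneg_left hxy (by positivity)
    refine le_trans ?_ h5
    have h6 : 2 * τ ^ 2 * (P / Pa) ≤ E / 6 * P ^ 2 := by
      have : 2 * τ ^ 2 * (P / Pa) ≤ E / 6 * Pa * (P / Pa) := by gcongr
      refine this.trans ?_
      have e : E / 6 * Pa * (P / Pa) = E / 6 * P := by field_simp
      rw [e]
      have : P ≤ P ^ 2 := by nlinarith
      gcongr
    have e : 2 * τ ^ 2 * (1 / (2 * P ^ 2) - P / Pa) = τ ^ 2 / P ^ 2 - 2 * τ ^ 2 * (P / Pa) := by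
      field_simp
    rw [e]
    linarith
  have hL2 : L * (P ^ 2 - 1) ≤ k / R * (E / 6 * P ^ 2 + τ ^ 2 / P ^ 2 / 4) := by
    have : L ≤ k / R * (E / 6 + τ ^ 2 / (4 * P ^ 4)) := by
      rw [div_mul_eq_mul_div, le_div_iff₀ hR0]
      linarith
    calc L * (P ^ 2 - 1) ≤ L * P ^ 2 := by nlinarith
      _ ≤ k / R * (E / 6 + τ ^ 2 / (4 * P ^ 4)) * P ^ 2 := by gcongr
      _ = _ := by field_simp
  have hB : (P ^ 2 - 1) * P * (v ^ 2 + h ^ 2 * (k * τ / (R * P)) ^ 2) / (h * τ) ≤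
      k / R * (τ ^ 2 / P ^ 2 / 4 + E / 6 * P ^ 2) := by
    have e1 : P ^ 3 * s ^ 2 / (h * τ) ≤ k / R * (τ ^ 2 / P ^ 2 / 4) := by
      rw [div_le_iff₀ (by positivity)]
      have : P ^ 3 * s ^ 2 = R * s ^ 2 * P ^ 5 / (R * P ^ 2) := by field_simp
      rw [this, div_le_iff₀ (by positivity)]
      refine h3.trans_eq ?_
      field_simp
    have e2 : P ^ 3 * (h ^ 2 * (k * τ / (R * P)) ^ 2) / (h * τ) ≤ k / R * (E / 6 * P ^ 2) := by
      have e : P ^ 3 * (h ^ 2 * (k * τ / (R * P)) ^ 2) / (h * τ) =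
          k / R * (h * τ * (k * P / R)) := by
        field_simp
      rw [e]
      refine mul_le_mul_of_nonneg_left ?_ hK.le
      have : k * P / R ≤ 1 := by
        rw [div_le_one hR0]
        exact (mul_le_of_le_one_left hP0.le hk1).trans hPR
      have hP2 : 1 ≤ P ^ 2 := one_le_pow₀ hP
      calc h * τ * (k * P / R) ≤ h * τ := mul_le_of_le_one_right (by positivity) this
        _ ≤ E / 6 := h4
        _ ≤ E / 6 * P ^ 2 := le_mul_of_one_le_right (by positivity) hP2
    calc (P ^ 2 - 1) * P * (v ^ 2 + h ^ 2 * (k * τ / (R * P)) ^ 2) / (h * τ)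
        ≤ P ^ 2 * P * (s ^ 2 + h ^ 2 * (k * τ / (R * P)) ^ 2) / (h * τ) := by
          have h0 : P ^ 2 - 1 ≤ P ^ 2 := by linarith
          have h1 : v ^ 2 ≤ s ^ 2 := by gcongr
          refine div_le_div_of_nonneg_right ?_ (by positivity)
          exact mul_le_mul (mul_le_mul_of_nonneg_right h0 hP0.le) (by linarith) (by positivity)
            (by positivity)
      _ = P ^ 3 * s ^ 2 / (h * τ) + P ^ 3 * (h ^ 2 * (k * τ / (R * P)) ^ 2) / (h * τ) := by ring
      _ ≤ _ := by linarith
  have hfin : E / 3 * (2 * k * P ^ 2 / R) = k / R * (2 * E / 3 * P ^ 2) := by ring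
  rw [eA, hfin]
  have h7 : 0 ≤ k / R * (τ ^ 2 / P ^ 2 / 2 + E / 6 * P ^ 2) := by positivity
  have e8 : k / R * (2 * E / 3 * P ^ 2) + k / R * (τ ^ 2 / P ^ 2 - E / 6 * P ^ 2) =
      k / R * (E / 6 * P ^ 2 + τ ^ 2 / P ^ 2 / 4) + k / R * (τ ^ 2 / P ^ 2 / 4 + E / 6 * P ^ 2) +
      k / R * (τ ^ 2 / P ^ 2 / 2 + E / 6 * P ^ 2) := by ring
  linarith

/-- Here P and Pa are comparable, so the phase term can be negative but is at most of size τ², which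
is small compared with E P². The coercivity in Q comes from h²μ'/2, which explains the denominator
h²(kP²/R). -/
theorem outer_bound {P Pa R k τ h E L s v : ℝ} (hk : 0 < k) (hP : 1 ≤ P)
    (hPR : P ≤ R) (hPa : Pa ≤ 2 * P) (hPPa : P ≤ Pa) (hτ : 0 < τ) (hh : 0 < h) (hv : 0 ≤ v)
    (hvs : v ≤ s) (h1 : 16 * τ ^ 2 ≤ E / 6 * Pa ^ 2) (h2 : R * L ≤ k * (E / 6))
    (h3 : 2 * (R * s) ^ 2 ≤ k ^ 2 * h ^ 2 * (E / 6)) (hL : 0 ≤ L) :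
    L * (P ^ 2 - 1) + 2 * (P ^ 2 - 1) ^ 2 * (v ^ 2 + h ^ 2 * (k * τ / (R * P)) ^ 2) /
        (h ^ 2 * (k * P ^ 2 / R)) ≤
      2 * k * P ^ 2 / R * (τ * (1 / P - 1 / Pa)) ^ 2 -
        2 * (P ^ 2 - 1) * (τ * (1 / P - 1 / Pa)) * (k * τ / (R * P)) +
        E / 3 * (2 * k * P ^ 2 / R) := by
  have hP0 : 0 < P := by linarith
  have hR0 : 0 < R := by linarith
  have hPa0 : 0 < Pa := by linarith
  have hK : 0 < k / R := by positivity
  have hE : 0 < E := by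
    by_contra hE
    have : 0 < 16 * τ ^ 2 := by positivity
    have : E / 6 * Pa ^ 2 ≤ 0 := mul_nonpos_of_nonpos_of_nonneg (by linarith) (by positivity)
    linarith
  have hτP : 4 * τ ^ 2 ≤ E / 6 * P ^ 2 := by
    have : Pa ^ 2 ≤ (2 * P) ^ 2 := by gcongr
    have : E / 6 * Pa ^ 2 ≤ E / 6 * (2 * P) ^ 2 := by gcongr
    linarith
  have eA : 2 * k * P ^ 2 / R * (τ * (1 / P - 1 / Pa)) ^ 2 -
        2 * (P ^ 2 - 1) * (τ * (1 / P - 1 / Pa)) * (k * τ / (R * P)) =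
      k / R * (2 * τ ^ 2 * ((1 / P - 1 / Pa) * (1 / P - P ^ 2 / Pa))) := by
    field_simp
    ring
  have hx0 : 0 ≤ 1 / P - 1 / Pa := by
    have := one_div_le_one_div_of_le hP0 hPPa
    linarith
  have hx1 : 1 / P - 1 / Pa ≤ 1 / Pa := by
    have : 1 / P ≤ 2 / Pa := by
      rw [div_le_div_iff₀ hP0 hPa0]; linarith
    have e : 2 / Pa = 1 / Pa + 1 / Pa := by ring
    linarith
  have hxy : -1 ≤ (1 / P - 1 / Pa) * (1 / P - P ^ 2 / Pa) := by
    have h5 : (1 / P - 1 / Pa) * (P ^ 2 / Pa) ≤ 1 / Pa * (P ^ 2 / Pa) := by gcongr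
    have h6 : 1 / Pa * (P ^ 2 / Pa) ≤ 1 := by
      have e : 1 / Pa * (P ^ 2 / Pa) = P ^ 2 / Pa ^ 2 := by field_simp
      rw [e, div_le_one (by positivity)]
      gcongr
    have h7 : 0 ≤ (1 / P - 1 / Pa) * (1 / P) := by positivity
    linarith [mul_sub (1 / P - 1 / Pa) (1 / P) (P ^ 2 / Pa)]
  have hA : k / R * (-(E / 12 * P ^ 2)) ≤
      k / R * (2 * τ ^ 2 * ((1 / P - 1 / Pa) * (1 / P - P ^ 2 / Pa))) := by
    refine mul_le_mul_of_nonneg_left ?_ hK.le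
    have h5 : 2 * τ ^ 2 * (-1) ≤ _ := mul_le_mul_of_nonneg_left hxy (by positivity)
    linarith
  have hL2 : L * (P ^ 2 - 1) ≤ k / R * (E / 6 * P ^ 2) := by
    have : L ≤ k / R * (E / 6) := by
      rw [div_mul_eq_mul_div, le_div_iff₀ hR0]
      linarith
    calc L * (P ^ 2 - 1) ≤ L * P ^ 2 := by nlinarith
      _ ≤ k / R * (E / 6) * P ^ 2 := by gcongr
      _ = _ := by ring
  have hB : 2 * (P ^ 2 - 1) ^ 2 * (v ^ 2 + h ^ 2 * (k * τ / (R * P)) ^ 2) /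
        (h ^ 2 * (k * P ^ 2 / R)) ≤ k / R * (E / 6 * P ^ 2 + E / 12 * P ^ 2) := by
    have hP1 : 0 ≤ P ^ 2 - 1 := by nlinarith
    calc _ ≤ 2 * (P ^ 2) ^ 2 * (s ^ 2 + h ^ 2 * (k * τ / (R * P)) ^ 2) /
          (h ^ 2 * (k * P ^ 2 / R)) := by
          gcongr
          linarith
      _ = k / R * (2 * (R * s) ^ 2 / (k ^ 2 * h ^ 2) * P ^ 2 + 2 * τ ^ 2) := by
          field_simp
      _ ≤ _ := by
          have : 2 * (R * s) ^ 2 / (k ^ 2 * h ^ 2) ≤ E / 6 := by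
            rw [div_le_iff₀ (by positivity)]
            linarith
          exact mul_le_mul_of_nonneg_left (add_le_add (by gcongr) (by linarith)) hK.le
  have hfin : E / 3 * (2 * k * P ^ 2 / R) = k / R * (2 * E / 3 * P ^ 2) := by ring
  rw [eA, hfin]
  have h7 : 0 ≤ k / R * (E / 6 * P ^ 2) := by positivity
  have e8 : k / R * (2 * E / 3 * P ^ 2) + k / R * (-(E / 12 * P ^ 2)) =
      k / R * (E / 6 * P ^ 2) + k / R * (E / 6 * P ^ 2 + E / 12 * P ^ 2) +
      k / R * (E / 6 * P ^ 2) := by ring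
  linarith

theorem multiplier_of_lt {a k ε r : ℝ} (hr : 0 < r) (hra : r < a) :
    multiplier a k ε r = ((r + 1) ^ k) ^ 2 - 1 := by
  rw [multiplier, if_pos hra, two_mul, Real.rpow_add (by linarith), sq]

theorem multiplierDeriv_of_lt {a k ε r : ℝ} (hr : 0 < r) (hra : r < a) :
    multiplierDeriv a k ε r = 2 * k * ((r + 1) ^ k) ^ 2 / (r + 1) := by
  rw [multiplierDeriv, if_pos hra, Real.rpow_sub_one (by linarith), two_mul k,
    Real.rpow_add (by linarith), sq]
  ring

theorem phaseDeriv_of_lt {a k τ r : ℝ} (hr : 0 < r) (hra : r < a) :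
    Carleman.phaseDeriv a k τ r = τ * (1 / (r + 1) ^ k - 1 / (a + 1) ^ k) := by
  rw [Carleman.phaseDeriv, if_pos hra.le, Real.rpow_neg (by linarith), Real.rpow_neg (by linarith)]
  ring

theorem phaseSecond_of_lt {a k τ r : ℝ} (hr : 0 < r) (hra : r < a) :
    phaseSecond a k τ r = -(k * τ / ((r + 1) * (r + 1) ^ k)) := by
  rw [phaseSecond, if_pos hra, Real.rpow_sub_one (by linarith), Real.rpow_neg (by linarith)]
  field_simp

theorem phaseDeriv_of_le {a k τ r : ℝ} (hra : a ≤ r) : Carleman.phaseDeriv a k τ r = 0 := by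
  rw [Carleman.phaseDeriv]
  split_ifs with h
  · rw [le_antisymm h hra, sub_self]
  · rfl

theorem phaseSecond_of_le {a k τ r : ℝ} (hra : a ≤ r) : phaseSecond a k τ r = 0 := by
  rw [phaseSecond, if_neg (not_lt.2 hra)]

theorem multiplierDeriv_of_le {a k ε r : ℝ} (hra : a ≤ r) :
    multiplierDeriv a k ε r = (r + 1) ^ (-1 - ε) := by
  rw [multiplierDeriv, if_neg (not_lt.2 hra)]

theorem multiplier_of_le {a k ε r : ℝ} (ha : 1 ≤ a) (hra : a ≤ r) :
    multiplier a k ε r =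
      ((a + 1) ^ k) ^ 2 - 1 + ε⁻¹ * ((a + 1) ^ (-ε) - (r + 1) ^ (-ε)) := by
  rw [multiplier, if_neg (not_lt.2 hra), two_mul, Real.rpow_add (by linarith), sq]

namespace WeightBounds

variable {E C S δ β h ε k a τ : ℝ}

theorem multiplier_nonneg (hb : WeightBounds E C S δ β h ε k a τ) {r : ℝ} (hr : 0 < r) :
    0 ≤ multiplier a k ε r := by
  have ha := hb.a_ge
  rcases lt_or_ge r a with hra | hra
  · rw [multiplier_of_lt hr hra]
    have := Real.one_le_rpow (x := r + 1) (z := k) (by linarith) hb.k_pos.le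
    nlinarith
  · rw [multiplier_of_le ha hra]
    have h1 := Real.one_le_rpow (x := a + 1) (z := k) (by linarith) hb.k_pos.le
    have h2 : (r + 1) ^ (-ε) ≤ (a + 1) ^ (-ε) :=
      Real.rpow_le_rpow_of_nonpos (by linarith) (by linarith) (by linarith [hb.ε_pos])
    have h3 := mul_nonneg (inv_nonneg.2 hb.ε_pos.le) (sub_nonneg.2 h2)
    nlinarith

/-- For r ≥ a the added part is at most ε⁻¹, which `inv_ε_le` keeps below (a+1)^{2k}. -/
theorem multiplier_le (hb : WeightBounds E C S δ β h ε k a τ) {r : ℝ} (hr : 0 < r) :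
    multiplier a k ε r ≤ 2 * ((a + 1) ^ k) ^ 2 := by
  have ha := hb.a_ge
  rcases lt_or_ge r a with hra | hra
  · rw [multiplier_of_lt hr hra]
    have h1 : (r + 1) ^ k ≤ (a + 1) ^ k :=
      Real.rpow_le_rpow (by linarith) (by linarith) hb.k_pos.le
    have h0 := Real.rpow_nonneg (x := r + 1) (by linarith) k
    nlinarith
  · rw [multiplier_of_le ha hra]
    have h1 : (a + 1) ^ (-ε) ≤ 1 :=
      Real.rpow_le_one_of_one_le_of_nonpos (by linarith) (by linarith [hb.ε_pos])
    have h2 : 0 ≤ (r + 1) ^ (-ε) := Real.rpow_nonneg (by linarith) _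
    have h3 : ε⁻¹ * ((a + 1) ^ (-ε) - (r + 1) ^ (-ε)) ≤ ε⁻¹ * 1 :=
      mul_le_mul_of_nonneg_left (by linarith) (inv_nonneg.2 hb.ε_pos.le)
    have := hb.inv_ε_le
    linarith

/-- This brings in the weight (r+1)^{-2s} with 2s = 1 + ε of the final estimate. -/
theorem le_multiplierDeriv (hb : WeightBounds E C S δ β h ε k a τ) {r : ℝ} (hr : 0 < r) :
    k * (r + 1) ^ (-1 - ε) ≤ multiplierDeriv a k ε r := by
  have h0 : 0 ≤ (r + 1) ^ (-1 - ε) := Real.rpow_nonneg (by linarith) _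
  have hk := hb.k_pos
  rcases lt_or_ge r a with hra | hra
  · rw [multiplierDeriv, if_pos hra]
    have : (r + 1) ^ (-1 - ε) ≤ (r + 1) ^ (2 * k - 1) :=
      Real.rpow_le_rpow_of_exponent_le (by linarith) (by linarith [hb.ε_pos])
    nlinarith
  · rw [multiplierDeriv_of_le hra]
    nlinarith [hb.k_le]

/-- The right side is the quadratic form left by the multiplier inequality after scaling by h², with
v standing for |V - U|. Half of h²μ'Q² and the part (E/3)μ'q² survive; the rest pays for the long
range term and, by Young's inequality, for the cross term. -/
theorem pointwise_lower_bound (hb : WeightBounds E C S δ β h ε k a τ) {r q Q v u : ℝ} (hr : 0 < r)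
    (hq : 0 ≤ q) (hQ : 0 ≤ Q) (hv : 0 ≤ v) (hvs : v ≤ S * (r + 1) ^ (-δ)) (hu : u ≤ E / 3) :
    h ^ 2 * multiplierDeriv a k ε r / 2 * Q ^ 2 + E / 3 * multiplierDeriv a k ε r * q ^ 2 ≤
      (h ^ 2 * multiplierDeriv a k ε r +
        4 * h * (multiplier a k ε r * Carleman.phaseDeriv a k τ r)) * Q ^ 2 +
      (multiplierDeriv a k ε r * Carleman.phaseDeriv a k τ r ^ 2 +
        2 * (multiplier a k ε r * (Carleman.phaseDeriv a k τ r * phaseSecond a k τ r)) +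
        multiplierDeriv a k ε r * (E - u) - C * (r + 1) ^ (-β) * multiplier a k ε r) * q ^ 2 -
      2 * (multiplier a k ε r * (v + h * |phaseSecond a k τ r|)) * q * Q := by
  obtain ⟨hE, hC, hS, hh, hh1, hε, hε1, hk, hk1, ha, hτ1, -, hphase, hlong, hshort, hhτ, hphase2,
    hlongo, hshorto, hεi, hlonge, hshorte⟩ := id hb
  have hR1 : 1 ≤ r + 1 := by linarith
  have hL : 0 ≤ C * (r + 1) ^ (-β) := mul_nonneg hC.le (Real.rpow_nonneg (by linarith) _)
  have hsq : ∀ x y : ℝ, (x + y) ^ 2 ≤ 2 * (x ^ 2 + y ^ 2) := fun x y => by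
    nlinarith [sq_nonneg (x - y)]
  have hm0 := hb.multiplier_nonneg hr
  have hm1 : 0 ≤ multiplierDeriv a k ε r :=
    (mul_nonneg hk.le (Real.rpow_nonneg (by linarith) _)).trans (hb.le_multiplierDeriv hr)
  have hEu : multiplierDeriv a k ε r * (2 * E / 3) ≤ multiplierDeriv a k ε r * (E - u) :=
    mul_le_mul_of_nonneg_left (by linarith) hm1
  suffices main : ∃ D B : ℝ, 0 ≤ D ∧ 0 ≤ B ∧
      (multiplier a k ε r * (v + h * |phaseSecond a k τ r|)) ^ 2 ≤ B * D ∧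
      D ≤ h ^ 2 * multiplierDeriv a k ε r / 2 +
        4 * h * (multiplier a k ε r * Carleman.phaseDeriv a k τ r) ∧
      C * (r + 1) ^ (-β) * multiplier a k ε r + B ≤
        multiplierDeriv a k ε r * Carleman.phaseDeriv a k τ r ^ 2 +
        2 * (multiplier a k ε r * (Carleman.phaseDeriv a k τ r * phaseSecond a k τ r)) +
        E / 3 * multiplierDeriv a k ε r by
    obtain ⟨D, B, hD, hB, h1, h2, h3⟩ := main
    have h4 := young_of_bound hD hB h1 (γ := multiplierDeriv a k ε r * Carleman.phaseDeriv a k τ r ^ 2 +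
        2 * (multiplier a k ε r * (Carleman.phaseDeriv a k τ r * phaseSecond a k τ r)) +
        multiplierDeriv a k ε r * (E - u) - C * (r + 1) ^ (-β) * multiplier a k ε r -
        E / 3 * multiplierDeriv a k ε r) (by linarith) h2 hq hQ
    exact sub_nonneg.1 (h4.trans_eq (by ring))
  clear hEu
  rcases lt_or_ge r a with hra | hra
  · have hP1 : 1 ≤ (r + 1) ^ k := Real.one_le_rpow hR1 hk.le
    have hPR : (r + 1) ^ k ≤ r + 1 := by
      simpa using Real.rpow_le_rpow_of_exponent_le hR1 hk1
    have hPPa : (r + 1) ^ k ≤ (a + 1) ^ k := Real.rpow_le_rpow (by linarith) (by linarith) hk.le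
    have hlong' := hlong _ hR1
    have hshort' := hshort _ hR1
    have hlongo' := hlongo _ hR1
    have hshorto' := hshorto _ hR1
    rw [multiplier_of_lt hr hra] at hm0 ⊢
    rw [multiplierDeriv_of_lt hr hra] at hm1 ⊢
    rw [phaseDeriv_of_lt hr hra, phaseSecond_of_lt hr hra, abs_neg] 
    have hpos : 0 ≤ k * τ / ((r + 1) * (r + 1) ^ k) := by positivity
    rw [abs_of_nonneg hpos] 
    generalize S * (r + 1) ^ (-δ) = s at *
    generalize C * (r + 1) ^ (-β) = L at *
    generalize (r + 1) ^ k = P at *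
    generalize (a + 1) ^ k = Pa at *
    generalize r + 1 = R at *
    have hP0 : 0 < P := by linarith
    have hR0 : 0 < R := by linarith
    have hτ0 : 0 < τ := by linarith
    have hx := hsq v (h * (k * τ / (R * P)))
    rw [mul_pow h] at hx
    set Y := v ^ 2 + h ^ 2 * (k * τ / (R * P)) ^ 2 with hY
    have hY0 : 0 ≤ Y := by positivity
    have hx' : ((P ^ 2 - 1) * (v + h * (k * τ / (R * P)))) ^ 2 ≤ 2 * (P ^ 2 - 1) ^ 2 * Y := by
      rw [mul_pow]
      calc (P ^ 2 - 1) ^ 2 * (v + h * (k * τ / (R * P))) ^ 2 ≤ (P ^ 2 - 1) ^ 2 * (2 * Y) := by gcongr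
        _ = _ := by ring
    -- In the inner case φ' ≥ τ/(2P), so D is taken from 4hμφ'. In the outer case φ' may nearly
    -- vanish and D is h²μ'/2. Each B is fixed by B·D = 2(P²-1)²Y.
    rcases le_total (2 * P) Pa with hin | hout
    · have hg : τ / (2 * P) ≤ τ * (1 / P - 1 / Pa) := by
        have h1 : 1 / Pa ≤ 1 / (2 * P) := one_div_le_one_div_of_le (by linarith) hin
        have h2 : τ / (2 * P) = τ * (1 / P - 1 / (2 * P)) := by field_simp; norm_num
        rw [h2]
        gcongr
      refine ⟨2 * h * (P ^ 2 - 1) * τ / P, (P ^ 2 - 1) * P * Y / (h * τ), by positivity,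
        by positivity, hx'.trans_eq (by field_simp), ?_, ?_⟩
      · have h1 : 4 * h * ((P ^ 2 - 1) * (τ / (2 * P))) ≤
            4 * h * ((P ^ 2 - 1) * (τ * (1 / P - 1 / Pa))) := by gcongr
        have h2 : 2 * h * (P ^ 2 - 1) * τ / P = 4 * h * ((P ^ 2 - 1) * (τ / (2 * P))) := by
          field_simp; ring
        have h3 : 0 ≤ h ^ 2 * (2 * k * P ^ 2 / R) / 2 := by positivity
        linarith
      · refine (inner_bound hk hk1 hP1 hPR hin hτ0 hh hv hvs hE hphase hlong' hshort' hhτ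
          hL).trans_eq ?_
        ring
    · refine ⟨h ^ 2 * (k * P ^ 2 / R), 2 * (P ^ 2 - 1) ^ 2 * Y / (h ^ 2 * (k * P ^ 2 / R)),
        by positivity, by positivity, hx'.trans_eq ?_, ?_, ?_⟩
      · rw [div_mul_cancel₀]
        positivity
      · have h1 : 0 ≤ τ * (1 / P - 1 / Pa) :=
          mul_nonneg hτ0.le (sub_nonneg.2 (one_div_le_one_div_of_le hP0 hPPa))
        have h2 : 0 ≤ 4 * h * ((P ^ 2 - 1) * (τ * (1 / P - 1 / Pa))) := by positivity
        have h3 : h ^ 2 * (2 * k * P ^ 2 / R) / 2 = h ^ 2 * (k * P ^ 2 / R) := by ring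
        linarith
      · refine (outer_bound hk hP1 hPR hout hPPa hτ0 hh hv hvs hphase2 (hlongo' hout)
          (hshorto' hout) hL).trans_eq ?_
        ring
  · have hR : a + 1 ≤ r + 1 := by linarith
    have h8 := hlonge _ hR
    have h9 := hshorte _ hR
    have hml := hb.multiplier_le hr
    have hw : 0 < (r + 1) ^ (-1 - ε) := Real.rpow_pos_of_pos (by linarith) _
    rw [multiplierDeriv_of_le hra] at hm1 ⊢
    rw [phaseDeriv_of_le hra, phaseSecond_of_le hra] 
    generalize S * (r + 1) ^ (-δ) = s at *
    generalize C * (r + 1) ^ (-β) = L at *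
    generalize (r + 1) ^ (-1 - ε) = w at *
    generalize (a + 1) ^ k = Pa at *
    generalize multiplier a k ε r = m at *
    -- Beyond a the phase derivatives vanish, and (E/3)μ' is split equally between the long range
    -- term and B.
    refine ⟨h ^ 2 * w / 2, E / 6 * w, by positivity, by positivity, ?_, by simp, ?_⟩
    · have h1 : (m * (v + h * |0|)) ^ 2 ≤ (2 * Pa ^ 2 * s) ^ 2 := by
        rw [abs_zero, mul_zero, add_zero]
        gcongr
      refine h1.trans ?_
      have : 8 * Pa ^ 4 * s ^ 2 = 2 * (2 * Pa ^ 2 * s) ^ 2 := by ring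
      linarith
    · have : L * m ≤ L * (2 * Pa ^ 2) := by gcongr
      linarith

end WeightBounds

end PointwiseBounds

/-! ### The phase and the multiplier meet the regularity requirements. -/

section WeightRegularity

variable {ϕ ψ ψ' μ μ' : ℝ → ℝ} {B B' : ℝ}

theorem RadialPhase.mono (h : RadialPhase ϕ ψ ψ' B) (hB : B ≤ B') : RadialPhase ϕ ψ ψ' B' :=
  ⟨h.1, h.2, h.3, h.4, h.5, fun r hr => (h.6 r hr).trans hB, fun r hr => (h.7 r hr).trans hB,
    fun r hr => (h.8 r hr).trans hB⟩

theorem RadialMultiplier.mono (h : RadialMultiplier μ μ' B) (hB : B ≤ B') :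
    RadialMultiplier μ μ' B' :=
  ⟨h.1, h.2, h.3, h.4, h.5, fun r hr => (h.6 r hr).trans hB,
    fun r hr => (h.7 r hr).trans (by gcongr), fun r hr => (h.8 r hr).trans hB, h.9⟩

variable {a k ε τ : ℝ}

/-- The derivative of the phase, extended to a continuous function on the line. -/
noncomputable def phaseDerivExt (a k τ r : ℝ) : ℝ :=
  τ * (min (max r 0) a + 1) ^ (-k) - τ * (a + 1) ^ (-k)

theorem min_max_add_one_pos (ha : 1 ≤ a) (r : ℝ) : 0 < min (max r 0) a + 1 := by
  have : 0 ≤ min (max r 0) a := le_min (le_max_right _ _) (by linarith)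
  linarith

theorem continuous_phaseDerivExt (ha : 1 ≤ a) : Continuous (phaseDerivExt a k τ) := by
  have h : Continuous fun r : ℝ => min (max r 0) a + 1 := by fun_prop
  exact ((h.rpow_const fun r => Or.inl (min_max_add_one_pos ha r).ne').const_mul _).sub
    continuous_const

theorem phaseDeriv_eq_ext {r : ℝ} (hr : 0 ≤ r) :
    Carleman.phaseDeriv a k τ r = phaseDerivExt a k τ r := by
  rw [Carleman.phaseDeriv, phaseDerivExt, max_eq_left hr]
  split_ifs with h
  · rw [min_eq_left h]
  · rw [min_eq_right (by linarith), sub_self]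

theorem phase_eq_ext {r : ℝ} (hr : 0 ≤ r) :
    Carleman.phase a k τ r = ∫ σ in (0 : ℝ)..r, phaseDerivExt a k τ σ := by
  refine intervalIntegral.integral_congr fun σ hσ => ?_
  rw [uIcc_of_le hr] at hσ
  exact phaseDeriv_eq_ext hσ.1

theorem phaseDeriv_nonneg (hk : 0 < k) (hτ : 0 ≤ τ) {r : ℝ} (hr : 0 ≤ r) :
    0 ≤ Carleman.phaseDeriv a k τ r := by
  rw [Carleman.phaseDeriv]
  split_ifs with h
  · have : (a + 1) ^ (-k) ≤ (r + 1) ^ (-k) :=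
      Real.rpow_le_rpow_of_nonpos (by linarith) (by linarith) (by linarith)
    rw [← mul_sub]
    exact mul_nonneg hτ (by linarith)
  · rfl

theorem phaseDeriv_le (ha : 1 ≤ a) (hk : 0 < k) (hτ : 0 ≤ τ) {r : ℝ} (hr : 0 ≤ r) :
    Carleman.phaseDeriv a k τ r ≤ τ := by
  rw [Carleman.phaseDeriv]
  split_ifs with h
  · have h1 : (r + 1) ^ (-k) ≤ 1 :=
      Real.rpow_le_one_of_one_le_of_nonpos (by linarith) (by linarith)
    have h2 : 0 ≤ τ * (a + 1) ^ (-k) := mul_nonneg hτ (Real.rpow_nonneg (by linarith) _)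
    nlinarith
  · exact hτ

theorem hasDerivAt_integral_phaseDerivExt (ha : 1 ≤ a) (r : ℝ) :
    HasDerivAt (fun r => ∫ σ in (0 : ℝ)..r, phaseDerivExt a k τ σ) (phaseDerivExt a k τ r) r :=
  ((continuous_phaseDerivExt ha).integral_hasStrictDerivAt 0 r).hasDerivAt

/-- The slope lies between 0 and τ and vanishes beyond a, so the phase is constant there. -/
theorem abs_phase_le (ha : 1 ≤ a) (hk : 0 < k) (hτ : 0 ≤ τ) {r : ℝ} (hr : 0 ≤ r) :
    |Carleman.phase a k τ r| ≤ τ * a := by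
  have hle : ∀ r, 0 ≤ r → r ≤ a → |Carleman.phase a k τ r| ≤ τ * a := by
    intro r hr hra
    rw [Carleman.phase]
    have := intervalIntegral.norm_integral_le_of_norm_le_const (a := 0) (b := r) (C := τ)
      (f := Carleman.phaseDeriv a k τ) fun x hx => by
        rw [uIoc_of_le hr] at hx
        rw [Real.norm_eq_abs, abs_of_nonneg (phaseDeriv_nonneg hk hτ hx.1.le)]
        exact phaseDeriv_le ha hk hτ hx.1.le
    rw [sub_zero, abs_of_nonneg hr] at this
    exact this.trans (by gcongr)
  rcases le_total r a with h | h
  · exact hle r hr h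
  · have hc := continuous_phaseDerivExt (k := k) (τ := τ) ha
    have e : Carleman.phase a k τ r = Carleman.phase a k τ a := by
      rw [phase_eq_ext hr, phase_eq_ext (by linarith : 0 ≤ a),
        ← intervalIntegral.integral_add_adjacent_intervals (hc.intervalIntegrable 0 a)
          (hc.intervalIntegrable a r), add_eq_left]
      refine (intervalIntegral.integral_congr (g := fun _ => (0 : ℝ)) fun σ hσ => ?_).trans (by simp)
      rw [uIcc_of_le h] at hσ
      change phaseDerivExt a k τ σ = 0
      rw [← phaseDeriv_eq_ext (by linarith [hσ.1]), phaseDeriv_of_le hσ.1]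
    rw [e]
    exact hle a (by linarith) le_rfl

theorem hasDerivWithinAt_phaseDeriv {r : ℝ} (hr : 0 < r) :
    HasDerivWithinAt (Carleman.phaseDeriv a k τ) (phaseSecond a k τ r) (Ioi r) r := by
  rcases lt_or_ge r a with hra | hra
  · have h1 : HasDerivAt (fun r : ℝ => τ * (r + 1) ^ (-k) - τ * (a + 1) ^ (-k))
        (τ * (-k * (r + 1) ^ (-k - 1))) r := by
      have := ((((hasDerivAt_id r).add_const 1).rpow_const (p := -k)
        (Or.inl (by simp only [id]; linarith))).const_mul τ).sub_const (τ * (a + 1) ^ (-k))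
      refine this.congr_deriv ?_
      simp only [id]
      ring
    rw [phaseSecond, if_pos hra]
    refine (h1.congr_of_eventuallyEq ?_).hasDerivWithinAt.congr_deriv (by ring)
    filter_upwards [Iio_mem_nhds hra] with x hx
    rw [Carleman.phaseDeriv, if_pos (le_of_lt hx)]
  · rw [phaseSecond_of_le hra]
    refine (hasDerivWithinAt_const r (Ioi r) (0 : ℝ)).congr (fun x hx => ?_) (phaseDeriv_of_le hra)
    exact phaseDeriv_of_le (hra.trans (le_of_lt hx))

theorem measurable_phaseSecond : Measurable (phaseSecond a k τ) :=
  Measurable.ite measurableSet_Iio (by fun_prop) measurable_const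

theorem abs_phaseSecond_le (hk : 0 < k) (hk1 : k ≤ 1) (hτ : 0 ≤ τ) {r : ℝ} (hr : 0 < r) :
    |phaseSecond a k τ r| ≤ τ := by
  rw [phaseSecond]
  split_ifs with h
  · have h1 : (r + 1) ^ (-k - 1) ≤ 1 :=
      Real.rpow_le_one_of_one_le_of_nonpos (by linarith) (by linarith)
    have h2 : 0 ≤ (r + 1) ^ (-k - 1) := Real.rpow_nonneg (by linarith) _
    rw [abs_neg, abs_of_nonneg (by positivity)]
    calc k * τ * (r + 1) ^ (-k - 1) ≤ 1 * τ * 1 := by gcongr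
      _ = τ := by ring
  · simpa using hτ

theorem radialPhase_div (ha : 1 ≤ a) (hk : 0 < k) (hk1 : k ≤ 1) (hτ : 0 ≤ τ) {h : ℝ} (hh : 0 < h) :
    RadialPhase (fun r => Carleman.phase a k τ r / h) (fun r => Carleman.phaseDeriv a k τ r / h)
      (fun r => phaseSecond a k τ r / h) (τ * a / h) := by
  have hτa : τ ≤ τ * a := le_mul_of_one_le_right hτ ha
  refine ⟨ContinuousOn.div_const ?_ _, ContinuousOn.div_const ?_ _, fun r hr => ?_,
    fun r hr => (hasDerivWithinAt_phaseDeriv hr).div_const h,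
    measurable_phaseSecond.div_const h, fun r hr => ?_, fun r hr => ?_, fun r hr => ?_⟩
  · have : ContinuousOn (fun r => ∫ σ in (0 : ℝ)..r, phaseDerivExt a k τ σ) (Ici 0) :=
      fun r _ => (hasDerivAt_integral_phaseDerivExt ha r).continuousAt.continuousWithinAt
    exact this.congr fun r hr => phase_eq_ext hr
  · exact (continuous_phaseDerivExt ha).continuousOn.congr fun r hr => phaseDeriv_eq_ext hr
  · refine HasDerivWithinAt.div_const ?_ h
    rw [phaseDeriv_eq_ext hr.le]
    exact (hasDerivAt_integral_phaseDerivExt ha r).hasDerivWithinAt.congr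
      (fun x hx => phase_eq_ext (hr.le.trans (le_of_lt hx))) (phase_eq_ext hr.le)
  · rw [abs_div, abs_of_pos hh]
    have := abs_phase_le ha hk hτ hr.le
    gcongr
  · rw [abs_div, abs_of_pos hh, abs_of_nonneg (phaseDeriv_nonneg hk hτ hr.le)]
    have := (phaseDeriv_le ha hk hτ hr.le).trans hτa
    gcongr
  · rw [abs_div, abs_of_pos hh]
    have := (abs_phaseSecond_le (a := a) hk hk1 hτ hr).trans hτa
    gcongr

theorem hasDerivWithinAt_multiplier (hε : 0 < ε) {r : ℝ} (hr : 0 < r) :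
    HasDerivWithinAt (multiplier a k ε) (multiplierDeriv a k ε r) (Ioi r) r := by
  rcases lt_or_ge r a with hra | hra
  · have h1 : HasDerivAt (fun r : ℝ => (r + 1) ^ (2 * k) - 1) (2 * k * (r + 1) ^ (2 * k - 1)) r := by
      have := (((hasDerivAt_id r).add_const 1).rpow_const (p := 2 * k)
        (Or.inl (by simp only [id]; linarith))).sub_const 1
      refine this.congr_deriv ?_
      simp only [id]
      ring
    rw [multiplierDeriv, if_pos hra]
    refine (h1.congr_of_eventuallyEq ?_).hasDerivWithinAt
    filter_upwards [Iio_mem_nhds hra] with x hx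
    rw [multiplier, if_pos (show x < a from hx)]
  · rw [multiplierDeriv_of_le hra]
    have h1 : HasDerivAt (fun r : ℝ => (a + 1) ^ (2 * k) - 1 + ε⁻¹ * ((a + 1) ^ (-ε) -
        (r + 1) ^ (-ε))) ((r + 1) ^ (-1 - ε)) r := by
      have := (((((hasDerivAt_id r).add_const 1).rpow_const (p := -ε)
        (Or.inl (by simp only [id]; linarith))).const_sub ((a + 1) ^ (-ε))).const_mul ε⁻¹).const_add
        ((a + 1) ^ (2 * k) - 1)
      refine this.congr_deriv ?_
      simp only [id]
      rw [show -ε - 1 = -1 - ε by ring]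
      field_simp
    have e : ∀ x, a ≤ x → multiplier a k ε x = (a + 1) ^ (2 * k) - 1 + ε⁻¹ * ((a + 1) ^ (-ε) -
        (x + 1) ^ (-ε)) := fun x hx => by rw [multiplier, if_neg (not_lt.2 hx)]
    exact h1.hasDerivWithinAt.congr (fun x hx => e x (hra.trans (le_of_lt hx))) (e r hra)

theorem continuousOn_multiplier (ha : 1 ≤ a) : ContinuousOn (multiplier a k ε) (Ici 0) := by
  have h : Continuous fun r : ℝ => min (max r 0) a + 1 := by fun_prop
  have h' : Continuous fun r : ℝ => max r a + 1 := by fun_prop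
  have h1 : Continuous fun r : ℝ => (min (max r 0) a + 1) ^ (2 * k) - 1 +
      ε⁻¹ * ((a + 1) ^ (-ε) - (max r a + 1) ^ (-ε)) :=
    ((h.rpow_const fun r => Or.inl (min_max_add_one_pos ha r).ne').sub continuous_const).add
      ((continuous_const.sub (h'.rpow_const fun r => Or.inl
        (by have := le_max_right r a; linarith))).const_mul _)
  refine h1.continuousOn.congr fun r hr => ?_
  simp only [multiplier, max_eq_left (show (0 : ℝ) ≤ r from hr)]
  split_ifs with hra
  · rw [min_eq_left hra.le, max_eq_right hra.le, sub_self, mul_zero, add_zero]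
  · rw [min_eq_right (not_lt.1 hra), max_eq_left (not_lt.1 hra)]

theorem measurable_multiplierDeriv : Measurable (multiplierDeriv a k ε) :=
  Measurable.ite measurableSet_Iio (by fun_prop) (by fun_prop)

/-- For r < a, Bernoulli's inequality for the concave power gives (r+1)^{-k} ≤ 1 - k r/(r+1), and
(r+1)^{-2k} is smaller still. For r ≥ a, r μ' ≤ 1 while μ ≥ (a+1)^{2k} - 1 ≥ 3. -/
theorem mul_multiplierDeriv_le (ha : 1 ≤ a) (hk : 0 < k) (hk1 : k ≤ 1) (hε : 0 < ε)
    (h2 : 2 ≤ (a + 1) ^ k) {r : ℝ} (hr : 0 < r) :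
    r * multiplierDeriv a k ε r ≤ 2 * multiplier a k ε r := by
  rcases lt_or_ge r a with hra | hra
  · rw [multiplierDeriv_of_lt hr hra, multiplier_of_lt hr hra]
    have hR : 0 < r + 1 := by linarith
    have hP1 : 1 ≤ (r + 1) ^ k := Real.one_le_rpow (by linarith) hk.le
    have hB := rpow_one_add_le_one_add_mul_self (s := -(r / (r + 1))) (p := k)
      (by rw [neg_le_neg_iff, div_le_one hR]; linarith) hk.le hk1
    rw [show 1 + -(r / (r + 1)) = (r + 1)⁻¹ by field_simp; ring, Real.inv_rpow hR.le] at hB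
    generalize (r + 1) ^ k = P at *
    have hP0 : 0 < P := by linarith
    have h3 : (P ^ 2)⁻¹ ≤ P⁻¹ := inv_anti₀ hP0 (by nlinarith)
    have h4 : (P ^ 2)⁻¹ ≤ 1 + k * -(r / (r + 1)) := h3.trans hB
    have h5 := mul_le_mul_of_nonneg_left h4 (sq_nonneg P)
    rw [mul_inv_cancel₀ (by positivity)] at h5
    have e : r * (2 * k * P ^ 2 / (r + 1)) = 2 * (P ^ 2 * (k * (r / (r + 1)))) := by ring
    rw [e]
    linarith
  · rw [multiplierDeriv_of_le hra, multiplier_of_le ha hra]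
    have h3 : (r + 1) ^ (-ε) ≤ (a + 1) ^ (-ε) :=
      Real.rpow_le_rpow_of_nonpos (by linarith) (by linarith) (by linarith)
    have h4 := mul_nonneg (inv_nonneg.2 hε.le) (sub_nonneg.2 h3)
    have h5 : r * (r + 1) ^ (-1 - ε) ≤ 1 := by
      have : (r + 1) ^ (-1 - ε) ≤ (r + 1) ^ (-1 : ℝ) :=
        Real.rpow_le_rpow_of_exponent_le (by linarith) (by linarith)
      rw [Real.rpow_neg_one] at this
      calc r * (r + 1) ^ (-1 - ε) ≤ r * (r + 1)⁻¹ := by gcongr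
        _ ≤ 1 := by rw [← div_eq_mul_inv, div_le_one (by linarith)]; linarith
    nlinarith

/-- In the bound, 2(a+1) accounts for the slope on r < a and 2(a+1)^{2k} for the size of the
multiplier. -/
theorem WeightBounds.radialMultiplier {E C S δ β h : ℝ} (hb : WeightBounds E C S δ β h ε k a τ) :
    RadialMultiplier (multiplier a k ε) (multiplierDeriv a k ε)
      (2 * (a + 1) + 2 * ((a + 1) ^ k) ^ 2) := by
  have ha := hb.a_ge
  have hk := hb.k_pos
  have hk1 := hb.k_le
  have hε := hb.ε_pos
  refine ⟨continuousOn_multiplier ha, ?_, fun r hr => hasDerivWithinAt_multiplier hε hr,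
    measurable_multiplierDeriv, fun r hr => hb.multiplier_nonneg hr, fun r hr => ?_, fun r hr => ?_,
    fun r hr => ?_, fun r hr => mul_multiplierDeriv_le ha hk hk1 hε hb.two_le hr⟩
  · rw [multiplier, if_pos (by linarith)]
    simp
  · have := hb.multiplier_le hr
    linarith
  · rcases lt_or_ge r a with hra | hra
    · have h1 : (r + 1) ^ (2 * k) ≤ (r + 1) ^ (2 : ℝ) :=
        Real.rpow_le_rpow_of_exponent_le (by linarith) (by linarith)
      rw [Real.rpow_two] at h1
      rw [multiplier, if_pos hra]
      have h2 : 0 ≤ 2 * ((a + 1) ^ k) ^ 2 * r := by positivity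
      nlinarith
    · have h1 := hb.multiplier_le hr
      have h2 : 2 * ((a + 1) ^ k) ^ 2 ≤ 2 * ((a + 1) ^ k) ^ 2 * r :=
        le_mul_of_one_le_right (by positivity) (by linarith)
      nlinarith
  · have h0 : 0 ≤ multiplierDeriv a k ε r :=
      (mul_nonneg hk.le (Real.rpow_nonneg (by linarith) _)).trans (hb.le_multiplierDeriv hr)
    rw [abs_of_nonneg h0]
    have h3 : 0 ≤ 2 * ((a + 1) ^ k) ^ 2 := by positivity
    rcases lt_or_ge r a with hra | hra
    · rw [multiplierDeriv, if_pos hra]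
      have h1 : (r + 1) ^ (2 * k - 1) ≤ (r + 1) ^ (1 : ℝ) :=
        Real.rpow_le_rpow_of_exponent_le (by linarith) (by linarith)
      rw [Real.rpow_one] at h1
      calc 2 * k * (r + 1) ^ (2 * k - 1) ≤ 2 * 1 * (a + 1) := by
            have : r + 1 ≤ a + 1 := by linarith
            gcongr
            exact h1.trans this
        _ ≤ _ := by linarith
    · rw [multiplierDeriv_of_le hra]
      have := Real.rpow_le_one_of_one_le_of_nonpos (x := r + 1) (z := -1 - ε) (by linarith)
        (by linarith)
      linarith

end WeightRegularity

/-! ### Exponent arithmetic and the choice of τ₀, t and h. -/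

section Parameters

open Carleman

/-- The relations between the limits `ks`, `ms` of the exponents `k`, `m` and the rate `γ`. -/
structure ExponentRelations (δ β ks ms γ : ℝ) : Prop where
  ks_pos : 0 < ks
  ks_le : ks ≤ 1
  ms_pos : 0 < ms
  γ_pos : 0 < γ
  -- One unit pays for lowering k, one for the term quadratic in ε, and one remains as a gain.
  γ_mul : 3 ≤ γ * ks
  ms_mul : 2 / 3 ≤ ms * ks
  -- At leading order this says a^{2k-(δ-1)} ≤ h, the short range condition beyond a.
  short : 1 ≤ ms * (δ - 1 - 2 * ks)
  long : 2 * ks ≤ β - 1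
  -- This keeps the power R^{1-2δ+5k} in the inner short range condition bounded.
  short' : 5 * ks ≤ 2 * δ - 1

/-- The three cases share the shape m = ms(1 + εγt), k = ks - εt. The values of (ks, γ) are (1, 3),
((β-1)/2, 6/(β-1)) and (2/(3m₁), 6m₁), after which no case distinction is needed. -/
theorem exists_exponentRelations {δ β : ℝ} (hδ : 1 < δ) (hβ : 1 < β) :
    ∃ ks ms γ, ExponentRelations δ β ks ms γ ∧
      ∀ t h, mExp δ β t h = ms * (1 + eps h * γ * t) ∧ kExp δ β t h = ks - eps h * t := by
  by_cases h3 : 3 < δ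
  · by_cases hb3 : 3 ≤ β
    · have h1 : 2 / 3 ≤ m₀ δ := le_max_left _ _
      have h2 : 1 / (δ - 3) ≤ m₀ δ := le_max_right _ _
      rw [div_le_iff₀ (by linarith)] at h2
      refine ⟨1, m₀ δ, 3, ⟨one_pos, le_rfl, by linarith, by norm_num, by norm_num, by linarith,
        by linarith, by linarith, by linarith⟩, fun t h => ?_⟩
      simp only [mExp, kExp, if_pos h3, if_pos hb3]
      exact ⟨by ring, trivial⟩
    · have h1 : 1 / (δ - β) ≤ m₂ δ β := le_max_left _ _
      have h2 : 4 / (3 * (β - 1)) ≤ m₂ δ β := le_max_right _ _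
      have hb : 0 < β - 1 := by linarith
      have hm : 0 < m₂ δ β := lt_of_lt_of_le (by positivity) h2
      rw [div_le_iff₀ (by linarith)] at h1
      rw [div_le_iff₀ (by linarith)] at h2
      refine ⟨(β - 1) / 2, m₂ δ β, 6 / (β - 1), ⟨by linarith, by linarith, hm, by positivity,
        le_of_eq (by field_simp; norm_num), by linarith, by linarith, by linarith, by linarith⟩,
        fun t h => ?_⟩
      simp only [mExp, kExp, if_pos h3, if_neg hb3]
      refine ⟨?_, trivial⟩
      field_simp
  · have h1 : 7 / (3 * (δ - 1)) ≤ m₁ δ β := le_max_left _ _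
    have h2 : 4 / (3 * (β - 1)) ≤ m₁ δ β := le_max_right _ _
    have hb : 0 < β - 1 := by linarith
    have hd : 0 < δ - 1 := by linarith
    have hm : 0 < m₁ δ β := lt_of_lt_of_le (by positivity) h2
    rw [div_le_iff₀ (by linarith)] at h1
    rw [div_le_iff₀ (by linarith)] at h2
    have e1 : m₁ δ β * (2 / (3 * m₁ δ β)) = 2 / 3 := by field_simp
    have e2 : 2 / (3 * m₁ δ β) ≤ 2 * (δ - 1) / 7 := by
      rw [div_le_div_iff₀ (by positivity) (by norm_num)]; linarith
    have e3 : 2 * (2 / (3 * m₁ δ β)) ≤ β - 1 := by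
      rw [← mul_div_assoc, div_le_iff₀ (by positivity)]; linarith
    refine ⟨2 / (3 * m₁ δ β), m₁ δ β, 6 * m₁ δ β, ⟨by positivity, by linarith, hm, by positivity,
      by linarith, e1.ge, ?_, e3, by linarith⟩, fun t h => ?_⟩
    · have : m₁ δ β * (δ - 1 - 2 * (2 / (3 * m₁ δ β))) =
        m₁ δ β * (δ - 1) - 2 * (m₁ δ β * (2 / (3 * m₁ δ β))) := by ring
      rw [this, e1]
      linarith
    · simp only [mExp, kExp, if_neg h3]
      exact ⟨by ring, trivial⟩

theorem eps_pos {h : ℝ} (h0 : 0 < h) (h1 : h < 1) : 0 < eps h :=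
  inv_pos.2 (Real.log_pos (by rw [lt_div_iff₀ h0]; linarith))

/-- Since ε log h = -1, corrections of order ε in an exponent of h become factors independent of h.
This is how t acts. -/
theorem rpow_eps_mul {h : ℝ} (h0 : 0 < h) (h1 : h < 1) (x : ℝ) : h ^ (eps h * x) = Real.exp (-x) := by
  have hl : Real.log h < 0 := Real.log_neg h0 h1
  rw [Real.rpow_def_of_pos h0, eps, one_div, Real.log_inv]
  congr 1
  field_simp [hl.ne]

theorem tendsto_eps : Tendsto eps (𝓝[>] 0) (𝓝 0) := by
  have h1 : Tendsto (fun h : ℝ => Real.log (1 / h)) (𝓝[>] 0) atTop := by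
    simp only [one_div]
    exact Real.tendsto_log_atTop.comp tendsto_inv_nhdsGT_zero
  exact tendsto_inv_atTop_zero.comp h1

theorem tendsto_rpow_nhdsGT_zero {α : ℝ} (hα : 0 < α) :
    Tendsto (fun h : ℝ => h ^ α) (𝓝[>] 0) (𝓝 0) := by
  have : Tendsto (fun h : ℝ => h ^ α) (𝓝 0) (𝓝 (0 ^ α)) :=
    (Real.continuousAt_rpow_const 0 α (Or.inr hα.le)).tendsto
  rw [Real.zero_rpow hα.ne'] at this
  exact this.mono_left nhdsWithin_le_nhds

variable {δ β ks ms γ : ℝ}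

/-- The product mk is ms·ks + ms·εt(γ·ks - 1 - γεt) ≥ 2/3 + ms·εt, and the last summand becomes the
factor exp(ms t). -/
theorem ExponentRelations.le_rpow (hr : ExponentRelations δ β ks ms γ) {h t : ℝ} (h0 : 0 < h)
    (h1 : h < 1) (ht : 0 ≤ t) (hγ : γ * (eps h * t) ≤ 1) :
    h ^ (-(2 / 3) : ℝ) * Real.exp (ms * t) ≤
      (h ^ (-(ms * (1 + eps h * γ * t)))) ^ (ks - eps h * t) := by
  have hε := eps_pos h0 h1
  have e : Real.exp (ms * t) = h ^ (eps h * -(ms * t)) := by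
    rw [rpow_eps_mul h0 h1, neg_neg]
  rw [e, ← Real.rpow_add h0, ← Real.rpow_mul h0.le]
  refine Real.rpow_le_rpow_of_exponent_ge h0 h1.le ?_
  have h2 : 0 ≤ ms * (eps h * t) := mul_nonneg hr.ms_pos.le (mul_nonneg hε.le ht)
  have h3 : 1 ≤ γ * ks - 1 - γ * (eps h * t) := by linarith [hr.γ_mul]
  have h4 := mul_le_mul_of_nonneg_left h3 h2
  have e2 : -(ms * (1 + eps h * γ * t)) * (ks - eps h * t) =
      -(ms * ks) - ms * (eps h * t) * (γ * ks - 1 - γ * (eps h * t)) := by ring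
  rw [e2]
  linarith [hr.ms_mul]

/-- The exponent of a is at most -εt: lowering k gains 2εt, and the extra ε costs at most εt because
t ≥ 1. -/
theorem ExponentRelations.rpow_long_le (hr : ExponentRelations δ β ks ms γ) {h t : ℝ} (h0 : 0 < h)
    (h1 : h < 1) (ht : 1 ≤ t) :
    (h ^ (-(ms * (1 + eps h * γ * t)))) ^ (2 * (ks - eps h * t) - (β - 1) + eps h) ≤
      Real.exp (-(ms * t)) := by
  have hε := eps_pos h0 h1
  rw [← rpow_eps_mul h0 h1, ← Real.rpow_mul h0.le]
  refine Real.rpow_le_rpow_of_exponent_ge h0 h1.le ?_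
  have h2 : eps h * t ≤ -(2 * (ks - eps h * t) - (β - 1) + eps h) := by
    nlinarith [hr.long]
  have h3 : ms ≤ ms * (1 + eps h * γ * t) := by
    have : 0 ≤ ms * (eps h * γ * t) := by
      have := hr.ms_pos; have := hr.γ_pos; positivity
    linarith
  have h4 := mul_le_mul h3 h2 (by positivity) (hr.ms_pos.le.trans h3)
  linarith

/-- The leading exponent already gives one power of h, and the factor 1 + εγt in m then yields
exp(-γt). -/
theorem ExponentRelations.rpow_short_le (hr : ExponentRelations δ β ks ms γ) {h t : ℝ} (h0 : 0 < h)
    (h1 : h < 1) (ht : 1 ≤ t) :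
    (h ^ (-(ms * (1 + eps h * γ * t)))) ^ (2 * (ks - eps h * t) - (δ - 1) + eps h) ≤
      h * Real.exp (-(γ * t)) := by
  have hε := eps_pos h0 h1
  have e : h * Real.exp (-(γ * t)) = h ^ (1 + eps h * (γ * t)) := by
    rw [Real.rpow_add h0, Real.rpow_one, rpow_eps_mul h0 h1]
  rw [e, ← Real.rpow_mul h0.le]
  refine Real.rpow_le_rpow_of_exponent_ge h0 h1.le ?_
  have h2 : δ - 1 - 2 * ks ≤ -(2 * (ks - eps h * t) - (δ - 1) + eps h) := by
    nlinarith
  have hγ : 0 ≤ 1 + eps h * γ * t := by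
    have := hr.γ_pos; positivity
  have h4 := mul_le_mul_of_nonneg_left h2 (mul_nonneg hr.ms_pos.le hγ)
  have h5 := mul_le_mul_of_nonneg_right hr.short hγ
  nlinarith

set_option maxHeartbeats 2000000 in
-- Conditions with τ₀ settle the inner region, those with exp(ms t) or exp(-γt) settle the phase and
-- the exterior, and smallness of powers of h settles the outer region. Replacing k by its lower
-- bound ks/2 keeps the conditions free of h.
theorem ExponentRelations.weightBounds (hr : ExponentRelations δ β ks ms γ)
    {E C S τ₀ t R₀ h : ℝ} (hE : 0 < E) (hC : 0 < C) (hS : 0 < S) (hδ : 1 < δ) (hβ : 1 < β)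
    (hR₀ : 1 ≤ R₀) (hR₀L : ∀ R, R₀ ≤ R → R * (C * R ^ (-β)) ≤ ks / 2 * (E / 6))
    (hτ₀ : 1 ≤ τ₀) (hτ₀C : C ≤ ks / 2 * (τ₀ ^ 2 / (4 * R₀ ^ 4)))
    (hτ₀S : S ^ 2 ≤ ks / 2 * (τ₀ ^ 3 / 4))
    (ht : 1 ≤ t) (ht1 : 2 * τ₀ ^ 2 ≤ E / 6 * Real.exp (ms * t))
    (ht2 : 2 * C * Real.exp (-(ms * t)) ≤ E / 6)
    (ht3 : 8 * S ^ 2 * Real.exp (-(γ * t)) ≤ E / 6)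
    (h0 : 0 < h) (h1 : h < 1) (hε1 : eps h ≤ 1) (hεt : eps h * t ≤ ks / 2)
    (hγ : γ * (eps h * t) ≤ 1)
    (hh1 : h ^ (2 / 3 : ℝ) ≤ 1 / 8) (hh2 : h ^ (2 / 3 : ℝ) * (2 * R₀) ≤ 1)
    (hh3 : τ₀ * h ^ (2 / 3 : ℝ) ≤ E / 6)
    (hh4 : 2 * (S * ((2 : ℝ) ^ (2 * (δ - 1) / ks) * h ^ (4 / 3 : ℝ))) ^ 2 ≤ (ks / 2) ^ 2 * (E / 6)) :
    WeightBounds E C S δ β h (eps h) (ks - eps h * t) (h ^ (-(ms * (1 + eps h * γ * t))))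
      (tauPar τ₀ h) := by
  have hε := eps_pos h0 h1
  have p1 := hr.le_rpow h0 h1 (by linarith) hγ
  have p2 := hr.rpow_long_le h0 h1 ht
  have p3 := hr.rpow_short_le h0 h1 ht
  have hk2 : ks / 2 ≤ ks - eps h * t := by linarith
  have hk1 : ks - eps h * t ≤ 1 := by
    have : 0 ≤ eps h * t := by positivity
    linarith [hr.ks_le]
  have hk5 : 5 * (ks - eps h * t) ≤ 2 * δ - 1 := by
    have : 0 ≤ eps h * t := by positivity
    linarith [hr.short']
  have hexpδ : 2 * (ks - eps h * t) - (δ - 1) + eps h ≤ 0 := by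
    have : 0 < δ - 1 - 2 * ks := by
      by_contra hcon
      have := mul_nonneg hr.ms_pos.le (neg_nonneg.2 (not_lt.1 hcon))
      linarith [hr.short]
    nlinarith
  have hexpβ : 2 * (ks - eps h * t) - (β - 1) + eps h ≤ 0 := by
    nlinarith [hr.long]
  have hkp : 0 < ks - eps h * t := by linarith [hr.ks_pos]
  have hks := hr.ks_pos
  have ha : 1 ≤ h ^ (-(ms * (1 + eps h * γ * t))) := by
    have := hr.ms_pos
    have := hr.γ_pos
    exact Real.one_le_rpow_of_pos_of_le_one_of_nonpos h0 h1.le (by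
      have : 0 ≤ ms * (1 + eps h * γ * t) := by positivity
      linarith)
  generalize ks - eps h * t = k at *
  generalize h ^ (-(ms * (1 + eps h * γ * t))) = a at *
  have ha0 : 0 < a := by linarith
  have ha1 : 0 < a + 1 := by linarith
  have hX : 0 < h ^ (2 / 3 : ℝ) := Real.rpow_pos_of_pos h0 _
  have hneg : h ^ (-(2 / 3) : ℝ) = (h ^ (2 / 3 : ℝ))⁻¹ := Real.rpow_neg h0.le _
  have hexp1 : 1 ≤ Real.exp (ms * t) := Real.one_le_exp (by have := hr.ms_pos; positivity)
  have hexp2 : Real.exp (-(γ * t)) ≤ 1 :=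
    Real.exp_le_one_iff.2 (by have := hr.γ_pos; have : 0 ≤ γ * t := by positivity
                              linarith)
  have hPaa : a ^ k ≤ (a + 1) ^ k := Real.rpow_le_rpow ha0.le (by linarith) hkp.le
  have hPa : (h ^ (2 / 3 : ℝ))⁻¹ * Real.exp (ms * t) ≤ (a + 1) ^ k := by
    rw [← hneg]; exact p1.trans hPaa
  have hPa' : (h ^ (2 / 3 : ℝ))⁻¹ ≤ (a + 1) ^ k :=
    le_trans (le_mul_of_one_le_right (inv_nonneg.2 hX.le) hexp1) hPa
  have h8 : 8 ≤ (a + 1) ^ k := by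
    refine le_trans ?_ hPa'
    rw [le_inv_comm₀ (by norm_num) hX]
    linarith
  have hτ : tauPar τ₀ h = τ₀ * h ^ (-(1 / 3) : ℝ) := rfl
  have hτ2 : tauPar τ₀ h ^ 2 = τ₀ ^ 2 * (h ^ (2 / 3 : ℝ))⁻¹ := by
    rw [hτ, mul_pow, ← hneg, ← Real.rpow_natCast (h ^ (-(1 / 3) : ℝ)) 2, ← Real.rpow_mul h0.le]
    norm_num
  have hthird : 1 ≤ h ^ (-(1 / 3) : ℝ) :=
    Real.one_le_rpow_of_pos_of_le_one_of_nonpos h0 h1.le (by norm_num)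
  have hττ₀ : τ₀ ≤ tauPar τ₀ h := by
    rw [hτ]; exact le_mul_of_one_le_right (by linarith) hthird
  have hhτ : h * tauPar τ₀ h = τ₀ * h ^ (2 / 3 : ℝ) := by
    have : h * h ^ (-(1 / 3) : ℝ) = h ^ (2 / 3 : ℝ) := by
      nth_rewrite 1 [← Real.rpow_one h]
      rw [← Real.rpow_add h0]
      norm_num
    rw [hτ, mul_left_comm, this]
  -- The exponent -1/3 in τ is chosen for this: the short range condition in the inner region no
  -- longer involves h.
  have hhτ3 : h * tauPar τ₀ h * tauPar τ₀ h ^ 2 = τ₀ ^ 3 := by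
    rw [hhτ, hτ2]
    field_simp
  have hphase : 2 * tauPar τ₀ h ^ 2 ≤ E / 6 * (a + 1) ^ k := by
    rw [hτ2]
    calc 2 * (τ₀ ^ 2 * (h ^ (2 / 3 : ℝ))⁻¹) = (h ^ (2 / 3 : ℝ))⁻¹ * (2 * τ₀ ^ 2) := by ring
      _ ≤ (h ^ (2 / 3 : ℝ))⁻¹ * (E / 6 * Real.exp (ms * t)) := by gcongr
      _ = E / 6 * ((h ^ (2 / 3 : ℝ))⁻¹ * Real.exp (ms * t)) := by ring
      _ ≤ _ := by gcongr
  have hRpow : ∀ {R x y : ℝ}, 1 ≤ R → x ≤ y → R ^ x ≤ R ^ y := fun hR hxy =>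
    Real.rpow_le_rpow_of_exponent_le hR hxy
  have hRk : ∀ R : ℝ, 1 ≤ R → R ^ k ≤ R := fun R hR => by
    simpa using hRpow hR hk1
  have hCk : ∀ R, R₀ ≤ R → R * (C * R ^ (-β)) ≤ k * (E / 6) := fun R hR =>
    (hR₀L R hR).trans (by gcongr)
  have hdec : ∀ {R x : ℝ}, a + 1 ≤ R → x ≤ 0 → R ^ x ≤ (a + 1) ^ x := fun hR hx =>
    Real.rpow_le_rpow_of_nonpos ha1 hR hx
  refine ⟨hE, hC, hS, h0, h1, hε, hε1, hkp, hk1, ha, hτ₀.trans hττ₀, by linarith, hphase,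
    fun R hR => ?_, fun R hR => ?_, by rw [hhτ]; exact hh3, ?_, fun R hR hPR => ?_,
    fun R hR hPR => ?_, ?_, fun R hR => ?_, fun R hR => ?_⟩
  -- Far out the decay R^{1-β} is beaten by the energy; on the bounded range R ≤ R₀ the large factor
  -- τ₀² takes over.
  · rcases le_total R₀ R with hRR | hRR
    · refine (hCk R hRR).trans ?_
      have : 0 ≤ k * (tauPar τ₀ h ^ 2 / (4 * (R ^ k) ^ 4)) := by positivity
      linarith [mul_add k (E / 6) (tauPar τ₀ h ^ 2 / (4 * (R ^ k) ^ 4))]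
    · have e1 : R * (C * R ^ (-β)) ≤ C := by
        have : R * R ^ (-β) = R ^ (1 - β) := by
          rw [sub_eq_add_neg, Real.rpow_add (by linarith), Real.rpow_one]
        rw [mul_left_comm, this]
        exact mul_le_of_le_one_right hC.le
          (Real.rpow_le_one_of_one_le_of_nonpos hR (by linarith))
      have e2 : τ₀ ^ 2 / (4 * R₀ ^ 4) ≤ tauPar τ₀ h ^ 2 / (4 * (R ^ k) ^ 4) := by
        have := (hRk R hR).trans hRR
        have : 0 < R ^ k := Real.rpow_pos_of_pos (by linarith) _
        gcongr
      calc _ ≤ C := e1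
        _ ≤ _ := hτ₀C
        _ ≤ k * (tauPar τ₀ h ^ 2 / (4 * (R ^ k) ^ 4)) := by gcongr
        _ ≤ _ := by gcongr; linarith
  · rw [hhτ3]
    have e1 : R * (S * R ^ (-δ)) ^ 2 * (R ^ k) ^ 5 = S ^ 2 * R ^ (1 - 2 * δ + 5 * k) := by
      have hR0 : 0 < R := by linarith
      rw [show 1 - 2 * δ + 5 * k = 1 + (-δ) * (2 : ℕ) + k * (5 : ℕ) by push_cast; ring,
        Real.rpow_add hR0, Real.rpow_add hR0, Real.rpow_one, Real.rpow_mul hR0.le,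
        Real.rpow_mul hR0.le, Real.rpow_natCast, Real.rpow_natCast]
      ring
    rw [e1]
    calc S ^ 2 * R ^ (1 - 2 * δ + 5 * k) ≤ S ^ 2 * 1 := by
          gcongr
          exact Real.rpow_le_one_of_one_le_of_nonpos hR (by linarith)
      _ ≤ ks / 2 * (τ₀ ^ 3 / 4) := by linarith
      _ ≤ _ := by gcongr
  · nlinarith
  · refine hCk R ?_
    have h5 := hRk R hR
    have h6 : 2 * R₀ ≤ (h ^ (2 / 3 : ℝ))⁻¹ := by
      rw [← one_div, le_div_iff₀ hX]; linarith
    linarith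
  · have hR0 : 0 < R := by linarith
    have e1 : R * (S * R ^ (-δ)) = S * R ^ (1 - δ) := by
      rw [sub_eq_add_neg, Real.rpow_add hR0, Real.rpow_one]; ring
    -- Since R^k ≥ (a+1)^k/2, R^{1-δ} is at most a constant times a^{1-δ}. Writing a^{1-δ} as
    -- a^{2k-(δ-1)+ε}·a^{-ε}·a^{-2k} gives the factor h and, from a^{-k} ≤ h^{2/3}, the additional
    -- smallness h^{4/3}.
    have e2 : R ^ (1 - δ) ≤ (2 : ℝ) ^ (2 * (δ - 1) / ks) * h ^ (4 / 3 : ℝ) * h := by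
      have f1 : R ^ (1 - δ) = (R ^ k) ^ ((1 - δ) / k) := by
        rw [← Real.rpow_mul hR0.le]; field_simp
      have f2 : (R ^ k) ^ ((1 - δ) / k) ≤ ((a + 1) ^ k / 2) ^ ((1 - δ) / k) :=
        Real.rpow_le_rpow_of_nonpos (by positivity) (by linarith)
          (div_nonpos_of_nonpos_of_nonneg (by linarith) hkp.le)
      have f3 : ((a + 1) ^ k / 2) ^ ((1 - δ) / k) = 2 ^ ((δ - 1) / k) * (a + 1) ^ (1 - δ) := by
        rw [Real.div_rpow (by positivity) (by norm_num), ← Real.rpow_mul ha1.le,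
          show k * ((1 - δ) / k) = 1 - δ by field_simp, show (1 - δ) / k = -((δ - 1) / k) by ring,
          Real.rpow_neg (by norm_num : (0 : ℝ) ≤ 2), div_inv_eq_mul, mul_comm]
      have f4 : (2 : ℝ) ^ ((δ - 1) / k) ≤ 2 ^ (2 * (δ - 1) / ks) := by
        refine hRpow (by norm_num) ?_
        rw [div_le_div_iff₀ hkp hks]
        nlinarith
      have f5 : (a + 1) ^ (1 - δ) ≤ a ^ (1 - δ) :=
        Real.rpow_le_rpow_of_nonpos ha0 (by linarith) (by linarith)
      have f6 : a ^ (1 - δ) ≤ h ^ (4 / 3 : ℝ) * h := by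
        have g1 : a ^ (1 - δ) = a ^ (2 * k - (δ - 1) + eps h) * a ^ (-eps h) * ((a ^ k)⁻¹) ^ 2 := by
          rw [← Real.rpow_neg ha0.le, ← Real.rpow_natCast (a ^ (-k)) 2, ← Real.rpow_mul ha0.le,
            ← Real.rpow_add ha0, ← Real.rpow_add ha0]
          congr 1
          push_cast
          ring
        have g2 : a ^ (-eps h) ≤ 1 := Real.rpow_le_one_of_one_le_of_nonpos ha (by linarith)
        have g3 : (a ^ k)⁻¹ ≤ h ^ (2 / 3 : ℝ) := by
          rw [inv_le_comm₀ (by positivity) hX, ← hneg]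
          exact le_trans (le_mul_of_one_le_right (by positivity) hexp1) p1
        have g4 : h ^ (4 / 3 : ℝ) = (h ^ (2 / 3 : ℝ)) ^ 2 := by
          rw [← Real.rpow_natCast (h ^ (2 / 3 : ℝ)) 2, ← Real.rpow_mul h0.le]
          norm_num
        have g5 : a ^ (2 * k - (δ - 1) + eps h) ≤ h :=
          p3.trans (mul_le_of_le_one_right h0.le hexp2)
        rw [g1, g4]
        calc a ^ (2 * k - (δ - 1) + eps h) * a ^ (-eps h) * ((a ^ k)⁻¹) ^ 2
            ≤ h * 1 * (h ^ (2 / 3 : ℝ)) ^ 2 := by gcongr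
          _ = _ := by ring
      rw [f1]
      refine f2.trans ?_
      rw [f3, mul_assoc]
      exact mul_le_mul f4 (f5.trans f6) (by positivity) (by positivity)
    rw [e1]
    calc 2 * (S * R ^ (1 - δ)) ^ 2
        ≤ 2 * (S * ((2 : ℝ) ^ (2 * (δ - 1) / ks) * h ^ (4 / 3 : ℝ) * h)) ^ 2 := by gcongr
      _ = 2 * (S * ((2 : ℝ) ^ (2 * (δ - 1) / ks) * h ^ (4 / 3 : ℝ))) ^ 2 * h ^ 2 := by ring
      _ ≤ (ks / 2) ^ 2 * (E / 6) * h ^ 2 := by gcongr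
      _ = (ks / 2) ^ 2 * h ^ 2 * (E / 6) := by ring
      _ ≤ _ := by gcongr
  -- The logarithm log(1/h) is below 1/h, hence below h^{-4/3} ≤ (a+1)^{2k}.
  · have e1 : (eps h)⁻¹ ≤ h⁻¹ := by
      rw [eps, inv_inv, one_div]
      exact (Real.log_le_sub_one_of_pos (inv_pos.2 h0)).trans (by linarith)
    have e2 : h⁻¹ ≤ ((h ^ (2 / 3 : ℝ))⁻¹) ^ 2 := by
      rw [← hneg, ← Real.rpow_neg_one, ← Real.rpow_natCast (h ^ (-(2 / 3) : ℝ)) 2,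
        ← Real.rpow_mul h0.le]
      exact Real.rpow_le_rpow_of_exponent_ge h0 h1.le (by norm_num)
    exact e1.trans (e2.trans (by gcongr))
  · have hR0 : 0 < R := by linarith
    have e1 : R ^ (-β) = R ^ (-1 - eps h) * R ^ (1 + eps h - β) := by
      rw [← Real.rpow_add hR0]; congr 1; ring
    have e2 : ((a + 1) ^ k) ^ 2 * R ^ (1 + eps h - β) ≤ Real.exp (-(ms * t)) := by
      calc ((a + 1) ^ k) ^ 2 * R ^ (1 + eps h - β)
          ≤ ((a + 1) ^ k) ^ 2 * (a + 1) ^ (1 + eps h - β) := by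
            exact mul_le_mul_of_nonneg_left (hdec hR (by linarith)) (by positivity)
        _ = (a + 1) ^ (2 * k - (β - 1) + eps h) := by
            rw [← Real.rpow_natCast ((a + 1) ^ k) 2, ← Real.rpow_mul ha1.le, ← Real.rpow_add ha1]
            congr 1
            push_cast
            ring
        _ ≤ a ^ (2 * k - (β - 1) + eps h) :=
            Real.rpow_le_rpow_of_nonpos ha0 (by linarith) hexpβ
        _ ≤ _ := p2
    rw [e1]
    calc C * (R ^ (-1 - eps h) * R ^ (1 + eps h - β)) * (2 * ((a + 1) ^ k) ^ 2)
        = 2 * C * (((a + 1) ^ k) ^ 2 * R ^ (1 + eps h - β)) * R ^ (-1 - eps h) := by ring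
      _ ≤ 2 * C * Real.exp (-(ms * t)) * R ^ (-1 - eps h) := by gcongr
      _ ≤ _ := by gcongr
  · have hR0 : 0 < R := by linarith
    have e1 : R ^ (-δ) = R ^ (-1 - eps h) * R ^ (1 + eps h - δ) := by
      rw [← Real.rpow_add hR0]; congr 1; ring
    have e2 : ((a + 1) ^ k) ^ 2 * R ^ (1 + eps h - δ) ≤ h * Real.exp (-(γ * t)) := by
      calc ((a + 1) ^ k) ^ 2 * R ^ (1 + eps h - δ)
          ≤ ((a + 1) ^ k) ^ 2 * (a + 1) ^ (1 + eps h - δ) := by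
            exact mul_le_mul_of_nonneg_left (hdec hR (by linarith)) (by positivity)
        _ = (a + 1) ^ (2 * k - (δ - 1) + eps h) := by
            rw [← Real.rpow_natCast ((a + 1) ^ k) 2, ← Real.rpow_mul ha1.le, ← Real.rpow_add ha1]
            congr 1
            push_cast
            ring
        _ ≤ a ^ (2 * k - (δ - 1) + eps h) :=
            Real.rpow_le_rpow_of_nonpos ha0 (by linarith) hexpδ
        _ ≤ _ := p3
    rw [e1]
    calc 8 * ((a + 1) ^ k) ^ 4 * (S * (R ^ (-1 - eps h) * R ^ (1 + eps h - δ))) ^ 2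
        = 8 * S ^ 2 * (((a + 1) ^ k) ^ 2 * R ^ (1 + eps h - δ)) ^ 2 * (R ^ (-1 - eps h)) ^ 2 := by
          ring
      _ ≤ 8 * S ^ 2 * (h * Real.exp (-(γ * t))) ^ 2 * (R ^ (-1 - eps h)) ^ 2 := by gcongr
      _ = 8 * S ^ 2 * Real.exp (-(γ * t)) * Real.exp (-(γ * t)) * h ^ 2 *
            (R ^ (-1 - eps h)) ^ 2 := by ring
      _ ≤ 8 * S ^ 2 * Real.exp (-(γ * t)) * 1 * h ^ 2 * (R ^ (-1 - eps h)) ^ 2 := by gcongr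
      _ ≤ _ := by rw [mul_one]; gcongr

/-- For all large `τ₀`, all large `t` and all small `h`, the parameters of the weight satisfy the
relations needed for the estimate. -/
theorem eventually_weightBounds {E C S : ℝ} (hE : 0 < E) (hC : 0 < C) (hS : 0 < S) (hδ : 1 < δ)
    (hβ : 1 < β) : ∃ κ > 0, ∃ τs ≥ 1, ∀ τ₀ ≥ τs, ∃ ts > 1, ∀ t ≥ ts, ∀ᶠ h in 𝓝[>] 0,
      κ ≤ kExp δ β t h ∧
      WeightBounds E C S δ β h (eps h) (kExp δ β t h) (aRad δ β t h) (tauPar τ₀ h) := by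
  obtain ⟨ks, ms, γ, hr, hmk⟩ := exists_exponentRelations hδ hβ
  have hks := hr.ks_pos
  obtain ⟨R₁, hR₁⟩ : ∃ R₁ : ℝ, ∀ R, R₁ ≤ R → R * (C * R ^ (-β)) ≤ ks / 2 * (E / 6) := by
    have h1 : Tendsto (fun R : ℝ => C * R ^ (-(β - 1))) atTop (𝓝 (C * 0)) :=
      (tendsto_rpow_neg_atTop (by linarith)).const_mul C
    rw [mul_zero] at h1
    have h2 := (h1.eventually (gt_mem_nhds (show 0 < ks / 2 * (E / 6) by positivity))).and
      (eventually_gt_atTop 0)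
    obtain ⟨R₁, h3⟩ := eventually_atTop.1 h2
    refine ⟨R₁, fun R hR => ?_⟩
    obtain ⟨h4, h5⟩ := h3 R hR
    refine le_of_eq_of_le ?_ h4.le
    rw [neg_sub, sub_eq_add_neg, Real.rpow_add h5, Real.rpow_one]
    ring
  set R₀ := max R₁ 1 with hR₀
  have hR₀1 : 1 ≤ R₀ := le_max_right _ _
  have hR₀L : ∀ R, R₀ ≤ R → R * (C * R ^ (-β)) ≤ ks / 2 * (E / 6) := fun R hR =>
    hR₁ R ((le_max_left _ _).trans hR)
  -- The conditions need τ₀² or τ₀³ large; thresholds linear in τ₀ suffice because τ₀ ≥ 1.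
  refine ⟨ks / 2, by positivity, max 1 (max (8 * R₀ ^ 4 * C / ks) (8 * S ^ 2 / ks)), le_max_left _ _,
    fun τ₀ hτ₀ => ?_⟩
  have hτ1 : 1 ≤ τ₀ := (le_max_left _ _).trans hτ₀
  have hτ2 : C ≤ ks / 2 * (τ₀ ^ 2 / (4 * R₀ ^ 4)) := by
    have h1 : 8 * R₀ ^ 4 * C / ks ≤ τ₀ := ((le_max_left _ _).trans (le_max_right _ _)).trans hτ₀
    rw [div_le_iff₀ hks] at h1
    have h2 : τ₀ ≤ τ₀ ^ 2 := by nlinarith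
    have h3 : τ₀ * ks ≤ τ₀ ^ 2 * ks := by gcongr
    rw [← mul_div_assoc, le_div_iff₀ (by positivity)]
    linarith
  have hτ3 : S ^ 2 ≤ ks / 2 * (τ₀ ^ 3 / 4) := by
    have h1 : 8 * S ^ 2 / ks ≤ τ₀ := ((le_max_right _ _).trans (le_max_right _ _)).trans hτ₀
    rw [div_le_iff₀ hks] at h1
    have h2 : τ₀ ≤ τ₀ ^ 3 := le_self_pow₀ hτ1 (by norm_num)
    have h3 : τ₀ * ks ≤ τ₀ ^ 3 * ks := by gcongr
    linarith
  have hexp : ∀ {c : ℝ}, 0 < c → Tendsto (fun t => Real.exp (c * t)) atTop atTop := fun hc =>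
    Real.tendsto_exp_atTop.comp (tendsto_id.const_mul_atTop hc)
  -- The threshold 12τ₀²/E is the one place where t must be large depending on τ₀.
  obtain ⟨ts, hts⟩ := eventually_atTop.1 (((hexp hr.ms_pos).eventually_ge_atTop
    (max (12 * τ₀ ^ 2 / E) (12 * C / E))).and
    ((hexp hr.γ_pos).eventually_ge_atTop (48 * S ^ 2 / E)))
  refine ⟨max ts 2, lt_of_lt_of_le (by norm_num) (le_max_right _ _), fun t ht => ?_⟩
  have ht1 : 1 ≤ t := by
    have := (le_max_right ts 2).trans ht
    linarith
  obtain ⟨h1, h2⟩ := hts t ((le_max_left _ _).trans ht)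
  rw [max_le_iff, div_le_iff₀ hE, div_le_iff₀ hE] at h1
  rw [div_le_iff₀ hE] at h2
  have q2 : 2 * C * Real.exp (-(ms * t)) ≤ E / 6 := by
    rw [Real.exp_neg, ← div_eq_mul_inv, div_le_iff₀ (Real.exp_pos _)]
    linarith [h1.2]
  have q3 : 8 * S ^ 2 * Real.exp (-(γ * t)) ≤ E / 6 := by
    rw [Real.exp_neg, ← div_eq_mul_inv, div_le_iff₀ (Real.exp_pos _)]
    linarith
  have lt_of : ∀ {u : ℝ → ℝ} {c : ℝ}, Tendsto u (𝓝[>] 0) (𝓝 0) → 0 < c →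
      ∀ᶠ h in 𝓝[>] 0, u h ≤ c := fun hu hc =>
    (hu.eventually (gt_mem_nhds hc)).mono fun _ h => h.le
  have t23 := tendsto_rpow_nhdsGT_zero (α := 2 / 3) (by norm_num)
  have t43 := tendsto_rpow_nhdsGT_zero (α := 4 / 3) (by norm_num)
  have a1 := lt_of tendsto_eps one_pos
  have a2 := lt_of (by simpa using tendsto_eps.mul_const t) (show 0 < ks / 2 by positivity)
  have a3 := lt_of (by simpa using (tendsto_eps.mul_const t).const_mul γ) one_pos
  have b1 := lt_of t23 (show (0 : ℝ) < 1 / 8 by norm_num)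
  have b2 := lt_of (by simpa using t23.mul_const (2 * R₀)) one_pos
  have b3 := lt_of (by simpa using t23.const_mul τ₀) (show 0 < E / 6 by positivity)
  have t43' := (((t43.const_mul ((2 : ℝ) ^ (2 * (δ - 1) / ks))).const_mul S).pow 2).const_mul 2
  have b4 := lt_of (by simpa using t43') (show 0 < (ks / 2) ^ 2 * (E / 6) by positivity)
  filter_upwards [a1, a2, a3, b1, b2, b3, b4, Ioo_mem_nhdsGT (show (0 : ℝ) < 1 by norm_num)]
    with h a1 a2 a3 b1 b2 b3 b4 hh
  obtain ⟨em, ek⟩ := hmk t h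
  rw [aRad, em, ek]
  refine ⟨by linarith, hr.weightBounds hE hC hS hδ hβ hR₀1 hR₀L hτ1 hτ2 hτ3 ht1 (by linarith [h1.1])
    q2 q3 hh.1 hh.2 a1 a2 a3 b1 b2 b3 b4⟩

end Parameters

/-! ### Cutting off the long range part near the origin. -/

section LongRange

/-- A Lipschitz cutoff, equal to `0` below `r₁` and to `1` above `r₁ + 1`. -/
noncomputable def ramp (r₁ r : ℝ) : ℝ := max 0 (min 1 (r - r₁))

theorem ramp_nonneg (r₁ r : ℝ) : 0 ≤ ramp r₁ r := le_max_left _ _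

theorem ramp_le_one (r₁ r : ℝ) : ramp r₁ r ≤ 1 := max_le zero_le_one (min_le_left _ _)

theorem ramp_of_le {r₁ r : ℝ} (h : r ≤ r₁) : ramp r₁ r = 0 :=
  max_eq_left ((min_le_right _ _).trans (by linarith))

theorem ramp_of_ge {r₁ r : ℝ} (h : r₁ + 1 ≤ r) : ramp r₁ r = 1 := by
  rw [ramp, min_eq_left (by linarith), max_eq_right zero_le_one]

theorem ramp_of_mem {r₁ r : ℝ} (h : r₁ ≤ r) (h' : r ≤ r₁ + 1) : ramp r₁ r = r - r₁ := by
  rw [ramp, min_eq_right (by linarith), max_eq_right (by linarith)]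

theorem continuous_ramp (r₁ : ℝ) : Continuous (ramp r₁) := by
  unfold ramp; fun_prop

theorem hasDerivWithinAt_ramp {r₁ r : ℝ} (h : r₁ ≤ r) :
    HasDerivWithinAt (ramp r₁) (if r < r₁ + 1 then 1 else 0) (Ioi r) r := by
  split_ifs with h'
  · have h1 : HasDerivWithinAt (fun x : ℝ => x - r₁) 1 (Ioi r) r :=
      (hasDerivWithinAt_id r _).sub_const r₁
    refine h1.congr_of_eventuallyEq ?_ (ramp_of_mem h h'.le)
    filter_upwards [self_mem_nhdsWithin, mem_nhdsWithin_of_mem_nhds (Iio_mem_nhds h')] with x hx hx'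
    exact ramp_of_mem (h.trans (le_of_lt hx)) (le_of_lt hx')
  · exact (hasDerivWithinAt_const r (Ioi r) (1 : ℝ)).congr
      (fun x hx => ramp_of_ge ((not_lt.1 h').trans (le_of_lt hx))) (ramp_of_ge (not_lt.1 h'))

variable {X : Type*} [NormedAddCommGroup X] [InnerProductSpace ℝ X] [FiniteDimensional ℝ X]
  [MeasurableSpace X] [BorelSpace X]

theorem exists_ae_norm_le {V : X → ℝ} (hV : MemLp V ∞ volume) : ∃ B, 0 ≤ B ∧ ∀ᵐ x, |V x| ≤ B := by
  refine ⟨(eLpNormEssSup V volume).toReal, ENNReal.toReal_nonneg, ?_⟩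
  have hfin : eLpNormEssSup V volume < ∞ := by simpa using hV.2
  filter_upwards [ae_le_eLpNormEssSup (f := V) (μ := volume)] with x hx
  have := ENNReal.toReal_mono hfin.ne hx
  simpa using this

/-- The long range part can be cut off near the origin, so that it becomes small from above and
one-sidedly differentiable along rays. -/
theorem exists_longRange_modification {V VL VS : X → ℝ} {p : ℝ → ℝ} {E δ β r₀ C₁ C₂ : ℝ}
    (hE : 0 < E) (hδ : 0 < δ) (hβ : 0 < β) (hr₀ : 0 < r₀) (hC₁ : 0 < C₁) (hC₂ : 0 < C₂)
    (hV : MemLp V ∞ volume) (hsplit : ∀ x, V x = VL x + VS x)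
    (hVS_meas : AEStronglyMeasurable VS volume)
    (hVS : ∀ᵐ x, |VS x| ≤ C₁ * (‖x‖ + 1) ^ (-δ))
    (hVL_C1 : ∀ w : X, ‖w‖ = 1 → ContDiffOn ℝ 1 (fun r : ℝ => VL (r • w)) (Ici r₀))
    (hp_lim : Tendsto p atTop (𝓝 0))
    (hVL : ∀ x, r₀ ≤ ‖x‖ → VL x ≤ p ‖x‖)
    (hVL_deriv : ∀ w : X, ‖w‖ = 1 → ∀ r, r₀ ≤ r →
      derivWithin (fun r : ℝ => VL (r • w)) (Ici r₀) r ≤ C₂ * (r + 1) ^ (-β)) :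
    ∃ (U : X → ℝ) (C S : ℝ), 0 < C ∧ 0 < S ∧ BddMeas U ∧ (∀ x, U x ≤ E / 3) ∧
      (∀ w : X, ‖w‖ = 1 → ContinuousOn (fun r : ℝ => U (r • w)) (Ici 0) ∧ ∀ r, 0 < r →
        ∃ d, d ≤ C * (r + 1) ^ (-β) ∧ HasDerivWithinAt (fun r : ℝ => U (r • w)) d (Ioi r) r) ∧
      ∀ᵐ x, |V x - U x| ≤ S * (‖x‖ + 1) ^ (-δ) := by
  obtain ⟨r₂, hr₂⟩ := eventually_atTop.1 (hp_lim.eventually (gt_mem_nhds (show 0 < E / 3 by linarith)))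
  -- Beyond r₂ the bound p is below E/3. The margin over r₀ places r₁ in the interior of the half
  -- line where V_L is C¹ along rays.
  set r₁ := max r₂ (r₀ + 1) with hr₁
  have hr₁₀ : r₀ < r₁ := lt_of_lt_of_le (by linarith) (le_max_right _ _)
  have hp : ∀ r, r₁ ≤ r → p r ≤ E / 3 := fun r hr => (hr₂ r ((le_max_left _ _).trans hr)).le
  obtain ⟨B, hB0, hB⟩ := exists_ae_norm_le hV
  have hdecay : ∀ x : X, (‖x‖ + 1) ^ (-δ) ≤ 1 := fun x =>
    Real.rpow_le_one_of_one_le_of_nonpos (by linarith [norm_nonneg x]) (by linarith)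
  have hVLb : ∀ᵐ x, |VL x| ≤ B + C₁ := by
    filter_upwards [hB, hVS] with x h1 h2
    have e : VL x = V x - VS x := by rw [hsplit]; ring
    rw [e]
    refine (abs_sub _ _).trans (add_le_add h1 (h2.trans ?_))
    exact mul_le_of_le_one_right hC₁.le (hdecay x)
  have hVLm : AEStronglyMeasurable VL volume := by
    have e : VL = fun x => V x - VS x := by funext x; rw [hsplit]; ring
    rw [e]
    exact hV.1.sub hVS_meas
  have hrb : BddMeas (fun x : X => ramp r₁ ‖x‖) :=
    ⟨((continuous_ramp r₁).comp continuous_norm).aestronglyMeasurable, 1, ae_of_all _ fun x => by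
      rw [abs_of_nonneg (ramp_nonneg _ _)]; exact ramp_le_one _ _⟩
  have hK : 1 ≤ (r₁ + 2) ^ β := Real.one_le_rpow (by linarith) hβ.le
  -- The slope of the ramp adds at most V_L ≤ E/3 to the radial derivative on r₁ ≤ r < r₁ + 1, and
  -- an upper bound is enough there. The remainder is at most 2B + C₁ for ‖x‖ ≤ r₁ + 1. The factors
  -- (r₁+2)^β and (r₁+2)^δ convert these constants into the required decay.
  refine ⟨fun x => ramp r₁ ‖x‖ * VL x, C₂ + E / 3 * (r₁ + 2) ^ β,
    C₁ + (2 * B + C₁) * (r₁ + 2) ^ δ, by positivity, by positivity, hrb.mul ⟨hVLm, _, hVLb⟩,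
    fun x => ?_, fun w hw => ?_, ?_⟩
  · rcases le_total ‖x‖ r₁ with hx | hx
    · simp only [ramp_of_le hx, zero_mul]
      linarith
    · have h1 := (hVL x (by linarith)).trans (hp _ hx)
      have h2 := ramp_nonneg r₁ ‖x‖
      have h3 := ramp_le_one r₁ ‖x‖
      calc ramp r₁ ‖x‖ * VL x ≤ ramp r₁ ‖x‖ * (E / 3) := by gcongr
        _ ≤ E / 3 := mul_le_of_le_one_left (by linarith) h3
  · have hn : ∀ r : ℝ, 0 ≤ r → ‖r • w‖ = r := fun r hr => by
      rw [norm_smul, hw, mul_one, Real.norm_eq_abs, abs_of_nonneg hr]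
    have hcongr : ∀ r : ℝ, 0 ≤ r → ramp r₁ ‖r • w‖ * VL (r • w) = ramp r₁ r * VL (r • w) :=
      fun r hr => by rw [hn r hr]
    refine ⟨ContinuousOn.congr (f := fun r : ℝ => ramp r₁ r * VL (r • w)) ?_ hcongr, fun r hr => ?_⟩
    · intro r hr
      refine ContinuousAt.continuousWithinAt ?_
      rcases lt_or_ge r r₁ with h | h
      · refine (continuousAt_const (y := (0 : ℝ))).congr ?_
        filter_upwards [Iio_mem_nhds h] with x hx
        rw [ramp_of_le (le_of_lt hx), zero_mul]
      · exact (continuous_ramp r₁).continuousAt.mul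
          ((hVL_C1 w hw).continuousOn.continuousAt (Ici_mem_nhds (by linarith)))
    · have hsub : ∀ x ∈ Ioi r, 0 ≤ x := fun x hx => hr.le.trans (le_of_lt hx)
      suffices ∃ d, d ≤ (C₂ + E / 3 * (r₁ + 2) ^ β) * (r + 1) ^ (-β) ∧
          HasDerivWithinAt (fun r : ℝ => ramp r₁ r * VL (r • w)) d (Ioi r) r by
        obtain ⟨d, hd, hd'⟩ := this
        exact ⟨d, hd, hd'.congr (fun x hx => hcongr x (hsub x hx)) (hcongr r hr.le)⟩
      have hw0 : 0 ≤ (r + 1) ^ (-β) := Real.rpow_nonneg (by linarith) _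
      rcases lt_or_ge r r₁ with h | h
      · refine ⟨0, by positivity, ?_⟩
        refine ((hasDerivAt_const r (0 : ℝ)).congr_of_eventuallyEq ?_).hasDerivWithinAt
        filter_upwards [Iio_mem_nhds h] with x hx
        rw [ramp_of_le (le_of_lt hx), zero_mul]
      · have hd := ((((hVL_C1 w hw).differentiableOn one_ne_zero) r (show r₀ ≤ r by
          linarith)).hasDerivWithinAt).mono (fun x (hx : r < x) => show r₀ ≤ x by linarith)
        refine ⟨_, ?_, (hasDerivWithinAt_ramp h).mul hd⟩
        have h1 := hVL_deriv w hw r (by linarith)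
        have h2 := ramp_nonneg r₁ r
        have h3 := ramp_le_one r₁ r
        have h4 : ramp r₁ r * derivWithin (fun r : ℝ => VL (r • w)) (Ici r₀) r ≤
            C₂ * (r + 1) ^ (-β) :=
          (mul_le_mul_of_nonneg_left h1 h2).trans (mul_le_of_le_one_left (by positivity) h3)
        have h5 : (if r < r₁ + 1 then (1 : ℝ) else 0) * VL (r • w) ≤
            E / 3 * (r₁ + 2) ^ β * (r + 1) ^ (-β) := by
          split_ifs with h'
          · have h6 : VL (r • w) ≤ E / 3 := by
              have := hVL (r • w) (by rw [hn r hr.le]; linarith)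
              rw [hn r hr.le] at this
              exact this.trans (hp r h)
            have h7 : (1 : ℝ) ≤ (r₁ + 2) ^ β * (r + 1) ^ (-β) := by
              rw [Real.rpow_neg (by linarith), ← div_eq_mul_inv, one_le_div (by positivity)]
              exact Real.rpow_le_rpow (by linarith) (by linarith) hβ.le
            rw [one_mul, mul_assoc]
            exact h6.trans (le_mul_of_one_le_right (by linarith) h7)
          · rw [zero_mul]
            positivity
        rw [add_mul]
        linarith
  · filter_upwards [hVS, hVLb, hB] with x h1 h2 h3
    have hx0 := norm_nonneg x
    have hw0 : 0 ≤ (‖x‖ + 1) ^ (-δ) := Real.rpow_nonneg (by linarith) _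
    rw [add_mul]
    rcases le_total (r₁ + 1) ‖x‖ with hx | hx
    · rw [ramp_of_ge hx, hsplit, one_mul, add_sub_cancel_left]
      have : 0 ≤ (2 * B + C₁) * (r₁ + 2) ^ δ * (‖x‖ + 1) ^ (-δ) := by positivity
      linarith
    · have h4 : |V x - ramp r₁ ‖x‖ * VL x| ≤ 2 * B + C₁ := by
        refine (abs_sub _ _).trans ?_
        rw [abs_mul, abs_of_nonneg (ramp_nonneg _ _)]
        have : ramp r₁ ‖x‖ * |VL x| ≤ |VL x| :=
          mul_le_of_le_one_left (abs_nonneg _) (ramp_le_one _ _)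
        linarith
      have h7 : (1 : ℝ) ≤ (r₁ + 2) ^ δ * (‖x‖ + 1) ^ (-δ) := by
        rw [Real.rpow_neg (by linarith), ← div_eq_mul_inv, one_le_div (by positivity)]
        exact Real.rpow_le_rpow (by linarith) (by linarith) hδ.le
      have h8 : 2 * B + C₁ ≤ (2 * B + C₁) * ((r₁ + 2) ^ δ * (‖x‖ + 1) ^ (-δ)) :=
        le_mul_of_one_le_right (by linarith) h7
      have : 0 ≤ C₁ * (‖x‖ + 1) ^ (-δ) := by positivity
      linarith

end LongRange

/-! ### The weighted integral inequality for an H² function. -/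

section IntegralEstimate

/-- Here Y = ‖Q‖, G = ‖F‖ and A = a^{2k}. The θ cross term is bounded by (8θA/h)(q² + h²Y²), and its
Y² part is cancelled by the elliptic inequality with the same factor. That factor is at most 8, so
the G·q term it brings costs only (E/12)kw q², reducing E/3 to E/4. -/
theorem absorption_bound {h k w E m m' A θ D q Y G : ℝ} (hh : 0 < h) (hk : 0 < k) (hw : 0 < w)
    (hE : 0 < E) (hm' : k * w ≤ m') (hm : 0 ≤ m) (hmA : m ≤ 8 * A) (hA : 0 ≤ A) (hθ : 0 ≤ θ)
    (hθA : θ * A ≤ h) (hq : 0 ≤ q) (hY : 0 ≤ Y) (hG : 0 ≤ G) :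
    -(h ^ 2 * m' / 2 * Y ^ 2) - E / 3 * m' * q ^ 2 + 2 * m * G * Y + 2 * m * θ * q * Y +
      8 * θ * A / h * (G * q + D * q ^ 2 - h ^ 2 * Y ^ 2) ≤
    -(E / 4 * k * w * q ^ 2) + (128 * A ^ 2 / (h ^ 2 * k) + 192 / (E * k)) * (w⁻¹ * G ^ 2) +
      8 * θ * A / h * (D + 1) * q ^ 2 := by
  have hm'0 : 0 < m' := lt_of_lt_of_le (by positivity) hm'
  have h1 : 2 * m * G * Y ≤ h ^ 2 * m' / 2 * Y ^ 2 + 128 * A ^ 2 / (h ^ 2 * k) * (w⁻¹ * G ^ 2) := by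
    have h2 := two_mul_mul_le_of_sq_le (X := m) (D := h ^ 2 * m' / 2)
      (B := 128 * A ^ 2 / (h ^ 2 * k) * w⁻¹) (q := G) (Q := Y) (by positivity) (by positivity) ?_ hG hY
    · linarith
    · have e : 128 * A ^ 2 / (h ^ 2 * k) * w⁻¹ * (h ^ 2 * m' / 2) =
          64 * A ^ 2 * (m' / (k * w)) := by
        field_simp
        ring
      rw [e]
      have h3 : 1 ≤ m' / (k * w) := (one_le_div (by positivity)).2 hm'
      calc m ^ 2 ≤ (8 * A) ^ 2 := by gcongr
        _ = 64 * A ^ 2 * 1 := by ring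
        _ ≤ _ := by gcongr
  have h2 : 2 * m * θ * q * Y ≤ 8 * θ * A / h * (q ^ 2 + h ^ 2 * Y ^ 2) := by
    calc 2 * m * θ * q * Y ≤ 2 * (8 * A) * θ * q * Y := by gcongr
      _ = 8 * θ * A / h * (2 * q * (h * Y)) := by field_simp
      _ ≤ 8 * θ * A / h * (q ^ 2 + h ^ 2 * Y ^ 2) := by
          gcongr
          nlinarith [sq_nonneg (q - h * Y)]
  have h3 : 8 * θ * A / h * (G * q) ≤
      E / 12 * k * w * q ^ 2 + 192 / (E * k) * (w⁻¹ * G ^ 2) := by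
    have h4 : 8 * θ * A / h ≤ 8 := by
      rw [div_le_iff₀ hh]; linarith
    have h5 := two_mul_mul_le_of_sq_le (X := 4) (D := E / 12 * k * w) (B := 192 / (E * k) * w⁻¹)
      (q := G) (Q := q) (by positivity) (by positivity) (le_of_eq (by field_simp; norm_num)) hG hq
    calc 8 * θ * A / h * (G * q) ≤ 8 * (G * q) := by gcongr
      _ ≤ _ := by linarith
  have h6 : E / 3 * (k * w) * q ^ 2 ≤ E / 3 * m' * q ^ 2 := by gcongr
  have e1 : 8 * θ * A / h * (G * q + D * q ^ 2 - h ^ 2 * Y ^ 2) = 8 * θ * A / h * (G * q) +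
    8 * θ * A / h * D * q ^ 2 - 8 * θ * A / h * (h ^ 2 * Y ^ 2) := by ring
  have e2 : 8 * θ * A / h * (q ^ 2 + h ^ 2 * Y ^ 2) = 8 * θ * A / h * q ^ 2 +
    8 * θ * A / h * (h ^ 2 * Y ^ 2) := by ring
  have e3 : 8 * θ * A / h * (D + 1) * q ^ 2 = 8 * θ * A / h * D * q ^ 2 +
    8 * θ * A / h * q ^ 2 := by ring
  have e4 : (128 * A ^ 2 / (h ^ 2 * k) + 192 / (E * k)) * (w⁻¹ * G ^ 2) =
    128 * A ^ 2 / (h ^ 2 * k) * (w⁻¹ * G ^ 2) + 192 / (E * k) * (w⁻¹ * G ^ 2) := by ring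
  have e5 : E / 3 * (k * w) * q ^ 2 = E / 4 * k * w * q ^ 2 + E / 12 * k * w * q ^ 2 := by ring
  linarith

/-- The scaled multiplier form, bounded through the equation. -/
theorem multiplier_form_le {E C S δ β h ε k a τ : ℝ} (hb : WeightBounds E C S δ β h ε k a τ)
    {r V U θ σ : ℝ} {f g Q F : ℂ} (hr : 0 < r) (hU : U ≤ E / 3)
    (hVU : |V - U| ≤ S * (r + 1) ^ (-δ)) (hθ : 0 ≤ θ) (hσ : σ = 1 ∨ σ = -1)
    (hF : F = -(h : ℂ) ^ 2 * g + V * f - (E - σ * θ * Complex.I) * f) :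
    h ^ 2 * (2 * multiplier a k ε r * inner ℝ (-g + ((U - E) / h ^ 2) • f -
        (phaseSecond a k τ r / h) • f) Q -
      (multiplierDeriv a k ε r + 4 * (multiplier a k ε r * (Carleman.phaseDeriv a k τ r / h))) *
        ‖Q‖ ^ 2 -
      (multiplierDeriv a k ε r * (Carleman.phaseDeriv a k τ r / h) ^ 2 +
        2 * (multiplier a k ε r * ((Carleman.phaseDeriv a k τ r / h) * (phaseSecond a k τ r / h))) -
        multiplierDeriv a k ε r * ((U - E) / h ^ 2) -
        C * (r + 1) ^ (-β) / h ^ 2 * multiplier a k ε r) * ‖f‖ ^ 2) ≤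
    -(h ^ 2 * multiplierDeriv a k ε r / 2 * ‖Q‖ ^ 2) - E / 3 * multiplierDeriv a k ε r * ‖f‖ ^ 2 +
      2 * multiplier a k ε r * ‖F‖ * ‖Q‖ + 2 * multiplier a k ε r * θ * ‖f‖ * ‖Q‖ := by
  have hh := hb.h_pos
  have hm := hb.multiplier_nonneg hr
  have hK := hb.pointwise_lower_bound hr (norm_nonneg f) (norm_nonneg Q) (abs_nonneg _) hVU hU
  -- The equation replaces the second order expression by F, up to the short range remainder, iθ and
  -- h φ''.
  have e1 : (h ^ 2 : ℝ) • (-g + ((U - E) / h ^ 2) • f - (phaseSecond a k τ r / h) • f) =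
      F - ((V - U : ℝ) : ℂ) * f - ((σ * θ : ℝ) : ℂ) * Complex.I * f -
        ((h * phaseSecond a k τ r : ℝ) : ℂ) * f := by
    rw [hF]
    simp only [Complex.real_smul]
    push_cast
    have : (h : ℂ) ≠ 0 := by exact_mod_cast hh.ne'
    field_simp
    ring
  have hσ1 : |σ| = 1 := by rcases hσ with rfl | rfl <;> simp
  have e2 : ‖(h ^ 2 : ℝ) • (-g + ((U - E) / h ^ 2) • f - (phaseSecond a k τ r / h) • f)‖ ≤
      ‖F‖ + (|V - U| + h * |phaseSecond a k τ r|) * ‖f‖ + θ * ‖f‖ := by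
    rw [e1]
    refine (norm_sub_le _ _).trans ?_
    have n1 : ‖((h * phaseSecond a k τ r : ℝ) : ℂ) * f‖ = h * |phaseSecond a k τ r| * ‖f‖ := by
      rw [norm_mul, Complex.norm_real, Real.norm_eq_abs, abs_mul, abs_of_pos hh]
    have n2 : ‖((σ * θ : ℝ) : ℂ) * Complex.I * f‖ = θ * ‖f‖ := by
      rw [norm_mul, norm_mul, Complex.norm_real, Complex.norm_I, Real.norm_eq_abs, abs_mul, hσ1,
        abs_of_nonneg hθ, one_mul, mul_one]
    have n3 : ‖((V - U : ℝ) : ℂ) * f‖ = |V - U| * ‖f‖ := by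
      rw [norm_mul, Complex.norm_real, Real.norm_eq_abs]
    have n4 := norm_sub_le (F - ((V - U : ℝ) : ℂ) * f) (((σ * θ : ℝ) : ℂ) * Complex.I * f)
    have n5 := norm_sub_le F (((V - U : ℝ) : ℂ) * f)
    rw [n1]
    rw [n2] at n4
    rw [n3] at n5
    linarith
  have e3 : h ^ 2 * inner ℝ (-g + ((U - E) / h ^ 2) • f - (phaseSecond a k τ r / h) • f) Q ≤
      (‖F‖ + (|V - U| + h * |phaseSecond a k τ r|) * ‖f‖ + θ * ‖f‖) * ‖Q‖ := by
    rw [← real_inner_smul_left]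
    exact (real_inner_le_norm _ _).trans (by gcongr)
  have e4 := mul_le_mul_of_nonneg_left e3 (mul_nonneg zero_le_two hm)
  generalize inner ℝ (-g + ((U - E) / h ^ 2) • f - (phaseSecond a k τ r / h) • f) Q = I at *
  have e5 : h ^ 2 * (2 * multiplier a k ε r * I -
      (multiplierDeriv a k ε r + 4 * (multiplier a k ε r * (Carleman.phaseDeriv a k τ r / h))) *
        ‖Q‖ ^ 2 -
      (multiplierDeriv a k ε r * (Carleman.phaseDeriv a k τ r / h) ^ 2 +
        2 * (multiplier a k ε r * ((Carleman.phaseDeriv a k τ r / h) * (phaseSecond a k τ r / h))) -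
        multiplierDeriv a k ε r * ((U - E) / h ^ 2) -
        C * (r + 1) ^ (-β) / h ^ 2 * multiplier a k ε r) * ‖f‖ ^ 2) =
      2 * multiplier a k ε r * (h ^ 2 * I) - (h ^ 2 * multiplierDeriv a k ε r +
        4 * h * (multiplier a k ε r * Carleman.phaseDeriv a k τ r)) * ‖Q‖ ^ 2 -
      (multiplierDeriv a k ε r * Carleman.phaseDeriv a k τ r ^ 2 +
        2 * (multiplier a k ε r * (Carleman.phaseDeriv a k τ r * phaseSecond a k τ r)) +
        multiplierDeriv a k ε r * (E - U) - C * (r + 1) ^ (-β) * multiplier a k ε r) * ‖f‖ ^ 2 := by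
    field_simp
    ring
  rw [e5]
  linarith

/-- The scaled elliptic form, bounded through the equation. -/
theorem elliptic_form_le {E h V B θ σ ψ τ : ℝ} {f g Q F : ℂ} (hh : 0 < h) (hV : |V| ≤ B)
    (hψ : 0 ≤ ψ) (hψτ : ψ ≤ τ)
    (hF : F = -(h : ℂ) ^ 2 * g + V * f - (E - σ * θ * Complex.I) * f) :
    h ^ 2 * ((ψ / h) ^ 2 * ‖f‖ ^ 2 - inner ℝ g f - ‖Q‖ ^ 2) ≤
      ‖F‖ * ‖f‖ + (τ ^ 2 + E + B) * ‖f‖ ^ 2 - h ^ 2 * ‖Q‖ ^ 2 := by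
  have e1 : -(h ^ 2 * inner ℝ g f) = inner ℝ F f + (E - V) * ‖f‖ ^ 2 := by
    rw [hF, Complex.real_inner_eq, Complex.real_inner_eq, Complex.sq_norm, Complex.normSq_apply]
    simp [← Complex.ofReal_pow]
    ring
  have e2 : h ^ 2 * ((ψ / h) ^ 2 * ‖f‖ ^ 2 - inner ℝ g f - ‖Q‖ ^ 2) =
      ψ ^ 2 * ‖f‖ ^ 2 + -(h ^ 2 * inner ℝ g f) - h ^ 2 * ‖Q‖ ^ 2 := by
    field_simp
    ring
  have h1 := real_inner_le_norm F f
  have h2 : ψ ^ 2 * ‖f‖ ^ 2 ≤ τ ^ 2 * ‖f‖ ^ 2 := by gcongr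
  have h3 : (E - V) * ‖f‖ ^ 2 ≤ (E + B) * ‖f‖ ^ 2 := by
    have := (abs_le.1 hV).1
    gcongr
    linarith
  rw [e2, e1]
  linarith

variable {X : Type*} [NormedAddCommGroup X] [InnerProductSpace ℝ X] [FiniteDimensional ℝ X]
  [MeasurableSpace X] [BorelSpace X] {N : ℕ}

theorem HasRadialDeriv.weighted_estimate {f g d F : X → ℂ} {ν : ℝ} (hd : HasRadialDeriv ν f g d)
    (hN : Module.finrank ℝ X = N + 3) (hν : ν = N + 2) {E C S δ β h ε k a τ : ℝ}
    (hb : WeightBounds E C S δ β h ε k a τ) (hβ : 0 < β) {V U : X → ℝ} {B θ σ : ℝ}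
    (hV : ∀ᵐ x, |V x| ≤ B) (hU : BddMeas U) (hUE : ∀ x, U x ≤ E / 3)
    (hUr : ∀ w : X, ‖w‖ = 1 → ContinuousOn (fun r : ℝ => U (r • w)) (Ici 0) ∧ ∀ r, 0 < r →
        ∃ d, d ≤ C * (r + 1) ^ (-β) ∧ HasDerivWithinAt (fun r : ℝ => U (r • w)) d (Ioi r) r)
    (hVU : ∀ᵐ x, |V x - U x| ≤ S * (‖x‖ + 1) ^ (-δ)) (hθ : 0 ≤ θ)
    (hθa : θ * a ^ (2 * k) ≤ h) (hσ : σ = 1 ∨ σ = -1)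
    (hF : ∀ x, F x = -(h : ℂ) ^ 2 * g x + V x * f x - (E - σ * θ * Complex.I) * f x)
    (hfi : Integrable fun x => Real.exp (2 * (Carleman.phase a k τ ‖x‖ / h)) * ‖f x‖ ^ 2)
    (hfw : Integrable fun x => Real.exp (2 * (Carleman.phase a k τ ‖x‖ / h)) *
      ((‖x‖ + 1) ^ (-1 - ε) * ‖f x‖ ^ 2))
    (hFi : Integrable fun x => Real.exp (2 * (Carleman.phase a k τ ‖x‖ / h)) *
      (((‖x‖ + 1) ^ (-1 - ε))⁻¹ * ‖F x‖ ^ 2)) :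
    E / 4 * k * ∫ x, Real.exp (2 * (Carleman.phase a k τ ‖x‖ / h)) *
      ((‖x‖ + 1) ^ (-1 - ε) * ‖f x‖ ^ 2) ≤
    (128 * (a ^ (2 * k)) ^ 2 / (h ^ 2 * k) + 192 / (E * k)) *
      (∫ x, Real.exp (2 * (Carleman.phase a k τ ‖x‖ / h)) *
        (((‖x‖ + 1) ^ (-1 - ε))⁻¹ * ‖F x‖ ^ 2)) +
    8 * θ * a ^ (2 * k) / h * (τ ^ 2 + E + B + 1) *
      ∫ x, Real.exp (2 * (Carleman.phase a k τ ‖x‖ / h)) * ‖f x‖ ^ 2 := by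
  have hdim : 3 ≤ Module.finrank ℝ X := by omega
  have hh := hb.h_pos
  have ha := hb.a_ge
  have hτ : 0 ≤ τ := zero_le_one.trans hb.τ_ge
  have hk := hb.k_pos
  have hϕ := radialPhase_div ha hk hb.k_le hτ hh
  have hμ := hb.radialMultiplier
  -- A single constant bounds the phase, the multiplier and the slope of the potential, as the
  -- multiplier inequality requires.
  set B₁ := τ * a / h + (2 * (a + 1) + 2 * ((a + 1) ^ k) ^ 2) + C / h ^ 2 with hB₁
  have p1 : 0 ≤ τ * a / h := by positivity
  have p2 : 0 ≤ 2 * (a + 1) + 2 * ((a + 1) ^ k) ^ 2 := by positivity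
  have hC := hb.C_pos
  have p3 : 0 ≤ C / h ^ 2 := by positivity
  have hϕ' := hϕ.mono (B' := B₁) (by linarith)
  have hμ' := hμ.mono (B' := B₁) (by linarith)
  have hW : BddMeas (fun x => (U x - E) / h ^ 2) := by
    simpa [div_eq_mul_inv] using (hU.sub (BddMeas.const E)).mul (BddMeas.const (h ^ 2)⁻¹)
  obtain ⟨i1, j1⟩ := hd.integral_multiplier_nonneg hN hν hϕ' hμ' hW
    (c := fun r => C * (r + 1) ^ (-β) / h ^ 2) (fun w hw => by
      obtain ⟨h1, h2⟩ := hUr w hw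
      refine ⟨(h1.sub continuousOn_const).div_const _, fun r hr => ?_⟩
      obtain ⟨d, hd, hd'⟩ := h2 r hr
      exact ⟨d / h ^ 2, by gcongr, (hd'.sub_const E).div_const _⟩) (by fun_prop) (fun r hr => by
      have h1 : (r + 1) ^ (-β) ≤ 1 :=
        Real.rpow_le_one_of_one_le_of_nonpos (by linarith) (by linarith)
      have h2 : 0 ≤ (r + 1) ^ (-β) := Real.rpow_nonneg (by linarith) _
      rw [abs_of_nonneg (by positivity)]
      have : C * (r + 1) ^ (-β) / h ^ 2 ≤ C / h ^ 2 := by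
        gcongr
        exact mul_le_of_le_one_right hC.le h1
      linarith)
  obtain ⟨i2, j2⟩ := hd.integral_sq_le hN hν hϕ
  set A := a ^ (2 * k) with hA
  have hA0 : 0 ≤ A := Real.rpow_nonneg (by linarith) _
  -- Since a ≥ 1 and k ≤ 1, (a+1)^k ≤ 2a^k.
  have hPA : 2 * ((a + 1) ^ k) ^ 2 ≤ 8 * A := by
    have h1 : (a + 1) ^ k ≤ (2 * a) ^ k := Real.rpow_le_rpow (by linarith) (by linarith) hk.le
    have h2 : (2 * a) ^ k ≤ 2 * a ^ k := by
      rw [Real.mul_rpow (by norm_num) (by linarith)]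
      have : (2 : ℝ) ^ k ≤ 2 := by
        simpa using Real.rpow_le_rpow_of_exponent_le (x := 2) (by norm_num) hb.k_le
      gcongr
    have h3 : A = (a ^ k) ^ 2 := by
      rw [hA, two_mul, Real.rpow_add (by linarith), sq]
    have h4 : 0 ≤ (a + 1) ^ k := Real.rpow_nonneg (by linarith) _
    have h5 : ((a + 1) ^ k) ^ 2 ≤ (2 * a ^ k) ^ 2 := by
      gcongr
      exact h1.trans h2
    rw [h3]
    linarith
  set lam := 8 * θ * A / h with hlam
  have hlam0 : 0 ≤ lam := by positivity
  have key : 0 ≤ ∫ x, (-(E / 4 * k * (Real.exp (2 * (Carleman.phase a k τ ‖x‖ / h)) *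
      ((‖x‖ + 1) ^ (-1 - ε) * ‖f x‖ ^ 2))) +
      (128 * A ^ 2 / (h ^ 2 * k) + 192 / (E * k)) *
        (Real.exp (2 * (Carleman.phase a k τ ‖x‖ / h)) *
        (((‖x‖ + 1) ^ (-1 - ε))⁻¹ * ‖F x‖ ^ 2)) +
      lam * (τ ^ 2 + E + B + 1) *
        (Real.exp (2 * (Carleman.phase a k τ ‖x‖ / h)) * ‖f x‖ ^ 2)) := by
    have j3 := add_nonneg (mul_nonneg (sq_nonneg h) j1)
      (mul_nonneg (mul_nonneg hlam0 (sq_nonneg h)) j2)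
    rw [← integral_const_mul, ← integral_const_mul,
      ← integral_add (i1.const_mul _) (i2.const_mul _)] at j3
    refine j3.trans (integral_mono_ae ((i1.const_mul _).add (i2.const_mul _))
      (((hfw.const_mul _).neg.add (hFi.const_mul _)).add (hfi.const_mul _)) ?_)
    filter_upwards [hV, hVU, ae_ne_zero hdim] with x h1 h2 h3
    have hr : 0 < ‖x‖ := norm_pos_iff.2 h3
    have hw : 0 < (‖x‖ + 1) ^ (-1 - ε) := Real.rpow_pos_of_pos (by linarith) _
    have m1 := multiplier_form_le hb (Q := d x + (Carleman.phaseDeriv a k τ ‖x‖ / h) • f x) hr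
      (hUE x) h2 hθ hσ (hF x)
    have m2 := elliptic_form_le (Q := d x + (Carleman.phaseDeriv a k τ ‖x‖ / h) • f x) hh h1
      (phaseDeriv_nonneg hk hτ hr.le) (phaseDeriv_le ha hk hτ hr.le) (hF x)
    have m3 := absorption_bound (D := τ ^ 2 + E + B) hh hk hw hb.E_pos (hb.le_multiplierDeriv hr)
      (hb.multiplier_nonneg hr) ((hb.multiplier_le hr).trans hPA) hA0 hθ hθa (norm_nonneg (f x))
      (norm_nonneg (d x + (Carleman.phaseDeriv a k τ ‖x‖ / h) • f x)) (norm_nonneg (F x))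
    have m4 := mul_le_mul_of_nonneg_left m2 hlam0
    have m5 := (add_le_add m1 m4).trans m3
    have m6 := mul_le_mul_of_nonneg_left m5
      (Real.exp_pos (2 * (Carleman.phase a k τ ‖x‖ / h))).le
    refine le_trans (le_of_eq ?_) (m6.trans (le_of_eq ?_))
    · ring
    · ring
  rw [integral_add (by exact (hfw.const_mul _).neg.add (hFi.const_mul _)) (hfi.const_mul _),
    integral_add (by exact (hfw.const_mul _).neg) (hFi.const_mul _), integral_neg,
    integral_const_mul, integral_const_mul, integral_const_mul] at key
  linarith

end IntegralEstimate

/-! ### From weighted integrals to L² norms with a uniform constant. -/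

section NormEstimate

theorem sqrt_le_of_le_add {x y z p q : ℝ} (hp : 0 ≤ p) (hq : 0 ≤ q) (hy : 0 ≤ y) (hz : 0 ≤ z)
    (h : x ≤ p ^ 2 * y + q ^ 2 * z) : √x ≤ p * √y + q * √z := by
  refine Real.sqrt_le_iff.2 ⟨by positivity, h.trans ?_⟩
  have h1 := Real.sq_sqrt hy
  have h2 := Real.sq_sqrt hz
  have h3 : 0 ≤ 2 * (p * √y) * (q * √z) := by positivity
  nlinarith

/-- The constant of the final estimate. -/
theorem constant_bound {E B κ k ε h A τ θ x y z : ℝ} (hE : 0 < E) (hB : 0 ≤ B) (hκ : 0 < κ)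
    (hκk : κ ≤ k) (hε : 0 < ε) (hε1 : ε ≤ 1) (hh : 0 < h) (hh1 : h ≤ 1) (hA : 1 ≤ A) (hτ : 1 ≤ τ)
    (hθ : 0 ≤ θ) (hx : 0 ≤ x) (hy : 0 ≤ y) (hz : 0 ≤ z)
    (H : E / 4 * k * x ≤ (128 * A ^ 2 / (h ^ 2 * k) + 192 / (E * k)) * y +
      8 * θ * A / h * (τ ^ 2 + E + B + 1) * z) :
    x ≤ (1 + 4 * (128 / κ + 192 / (E * κ)) / (E * κ) + 32 * (2 + E + B) / (E * κ)) *
      ((A * (ε * h)⁻¹) ^ 2 * y + A * τ ^ 2 * (θ / (ε * h)) * z) := by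
  have h1 : E / 4 * κ * x ≤ E / 4 * k * x := by gcongr
  have hεh : 0 < ε * h := by positivity
  have hεh1 : ε * h ≤ h := mul_le_of_le_one_left hh.le hε1
  have hinv : h⁻¹ ≤ (ε * h)⁻¹ := inv_anti₀ hεh hεh1
  have hinv1 : 1 ≤ (ε * h)⁻¹ := (one_le_inv₀ hεh).2 (hεh1.trans hh1)
  have h2 : 128 * A ^ 2 / (h ^ 2 * k) ≤ 128 / κ * (A * (ε * h)⁻¹) ^ 2 := by
    have e : 128 * A ^ 2 / (h ^ 2 * k) = 128 / k * (A * h⁻¹) ^ 2 := by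
      have : 0 < k := hκ.trans_le hκk
      field_simp
    rw [e]
    gcongr
  have h3 : 192 / (E * k) ≤ 192 / (E * κ) * (A * (ε * h)⁻¹) ^ 2 := by
    have h4 : 192 / (E * k) ≤ 192 / (E * κ) := by gcongr
    have h5 : 1 ≤ (A * (ε * h)⁻¹) ^ 2 := one_le_pow₀ (one_le_mul_of_one_le_of_one_le hA hinv1)
    exact h4.trans (le_mul_of_one_le_right (by positivity) h5)
  have h4 : 8 * θ * A / h * (τ ^ 2 + E + B + 1) ≤
      8 * (2 + E + B) * (A * τ ^ 2 * (θ / (ε * h))) := by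
    have h5 : τ ^ 2 + E + B + 1 ≤ (2 + E + B) * τ ^ 2 := by
      have : 1 ≤ τ ^ 2 := one_le_pow₀ hτ
      nlinarith
    have h6 : θ / h ≤ θ / (ε * h) := by gcongr
    calc 8 * θ * A / h * (τ ^ 2 + E + B + 1) = 8 * A * (θ / h) * (τ ^ 2 + E + B + 1) := by ring
      _ ≤ 8 * A * (θ / (ε * h)) * ((2 + E + B) * τ ^ 2) := by gcongr
      _ = _ := by ring
  set P := (A * (ε * h)⁻¹) ^ 2 with hP
  set R := A * τ ^ 2 * (θ / (ε * h)) with hR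
  have hP0 : 0 ≤ P := by positivity
  have hR0 : 0 ≤ R := by positivity
  have h7 : (128 * A ^ 2 / (h ^ 2 * k) + 192 / (E * k)) * y ≤ (128 / κ + 192 / (E * κ)) * P * y := by
    gcongr
    linarith
  have h8 : 8 * θ * A / h * (τ ^ 2 + E + B + 1) * z ≤ 8 * (2 + E + B) * R * z := by gcongr
  have h9 : x ≤ 4 * (128 / κ + 192 / (E * κ)) / (E * κ) * (P * y) +
      32 * (2 + E + B) / (E * κ) * (R * z) := by
    have h10 : E / 4 * κ * x ≤ (128 / κ + 192 / (E * κ)) * P * y + 8 * (2 + E + B) * R * z := by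
      linarith
    have e : 4 * (128 / κ + 192 / (E * κ)) / (E * κ) * (P * y) +
        32 * (2 + E + B) / (E * κ) * (R * z) =
        ((128 / κ + 192 / (E * κ)) * P * y + 8 * (2 + E + B) * R * z) / (E / 4 * κ) := by
      field_simp
      ring
    rw [e, le_div_iff₀ (by positivity)]
    linarith
  refine h9.trans ?_
  have q1 : 0 ≤ 4 * (128 / κ + 192 / (E * κ)) / (E * κ) := by positivity
  have q2 : 0 ≤ 32 * (2 + E + B) / (E * κ) := by positivity
  have q3 : 0 ≤ P * y := by positivity
  have q4 : 0 ≤ R * z := by positivity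
  nlinarith [mul_nonneg q1 q4, mul_nonneg q2 q3]

variable {X : Type*} [NormedAddCommGroup X] [InnerProductSpace ℝ X] [FiniteDimensional ℝ X]
  [MeasurableSpace X] [BorelSpace X] {N : ℕ}

theorem eLpNorm_two_eq_sqrt {u : X → ℂ} (hu : MemLp u 2 volume) :
    eLpNorm u 2 volume = ENNReal.ofReal √(∫ x, ‖u x‖ ^ 2) := by
  rw [hu.eLpNorm_eq_integral_rpow_norm two_ne_zero ENNReal.ofNat_ne_top, Real.sqrt_eq_rpow]
  simp

/-- The integrands are squares of the weighted functions because (1+ε)/2 doubles to 1+ε, so square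
roots give norms. The constant K involves only E, B and the lower bound κ of k, hence neither h nor
θ. -/
theorem HasRadialDeriv.weighted_norm_estimate {f g d F : X → ℂ} {ν : ℝ}
    (hd : HasRadialDeriv ν f g d)
    (hN : Module.finrank ℝ X = N + 3) (hν : ν = N + 2) {E C S δ β h ε k a τ κ : ℝ}
    (hb : WeightBounds E C S δ β h ε k a τ) (hβ : 0 < β) (hκ : 0 < κ) (hκk : κ ≤ k)
    {V U : X → ℝ} {B θ σ K : ℝ} (hB : 0 ≤ B)
    (hV : ∀ᵐ x, |V x| ≤ B) (hU : BddMeas U) (hUE : ∀ x, U x ≤ E / 3)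
    (hUr : ∀ w : X, ‖w‖ = 1 → ContinuousOn (fun r : ℝ => U (r • w)) (Ici 0) ∧ ∀ r, 0 < r →
        ∃ d, d ≤ C * (r + 1) ^ (-β) ∧ HasDerivWithinAt (fun r : ℝ => U (r • w)) d (Ioi r) r)
    (hVU : ∀ᵐ x, |V x - U x| ≤ S * (‖x‖ + 1) ^ (-δ)) (hθ : 0 < θ)
    (hθa : θ ≤ ε * h * a ^ (-2 * k)) (hσ : σ = 1 ∨ σ = -1)
    (hF : ∀ x, F x = -(h : ℂ) ^ 2 * g x + V x * f x - (E - σ * θ * Complex.I) * f x)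
    (hf : MemLp f 2 volume)
    (hFs : MemLp (fun x => (((‖x‖ + 1) ^ ((1 + ε) / 2) : ℝ) : ℂ) * F x) 2 volume)
    (hK : K = 1 + 4 * (128 / κ + 192 / (E * κ)) / (E * κ) + 32 * (2 + E + B) / (E * κ)) :
    eLpNorm (fun x => (((‖x‖ + 1) ^ (-((1 + ε) / 2)) *
        Real.exp (Carleman.phase a k τ ‖x‖ / h) : ℝ) : ℂ) * f x) 2 volume ≤
      ENNReal.ofReal (K * a ^ (2 * k) * (ε * h)⁻¹) *
        eLpNorm (fun x => (((‖x‖ + 1) ^ ((1 + ε) / 2) *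
          Real.exp (Carleman.phase a k τ ‖x‖ / h) : ℝ) : ℂ) * F x) 2 volume +
      ENNReal.ofReal (K * a ^ k * τ * (θ / (ε * h)) ^ (1 / 2 : ℝ)) *
        eLpNorm (fun x => ((Real.exp (Carleman.phase a k τ ‖x‖ / h) : ℝ) : ℂ) * f x) 2 volume := by
  have hdim : 3 ≤ Module.finrank ℝ X := by omega
  have hh := hb.h_pos
  have ha := hb.a_ge
  have hε := hb.ε_pos
  have hk := hb.k_pos
  have hτ := hb.τ_ge
  have hϕ := radialPhase_div ha hk hb.k_le (zero_le_one.trans hτ) hh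
  have bM : BddMeas (fun x : X => Real.exp (Carleman.phase a k τ ‖x‖ / h)) := by
    refine BddMeas.of_continuousOn hdim (ζ := fun r => Real.exp (Carleman.phase a k τ r / h))
      (B := Real.exp (τ * a / h)) (hϕ.cont_phase.mono Ioi_subset_Ici_self).rexp fun r hr => ?_
    rw [abs_of_pos (Real.exp_pos _)]
    exact Real.exp_le_exp.2 (abs_le.1 (hϕ.bound_phase r hr)).2
  have hR : ∀ x : X, 0 < ‖x‖ + 1 := fun x => by positivity
  have hcont : ∀ s : ℝ, Continuous fun x : X => (‖x‖ + 1) ^ s := fun s =>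
    (continuous_norm.add continuous_const).rpow_const fun x => Or.inl (hR x).ne'
  have bw : BddMeas (fun x : X => (‖x‖ + 1) ^ (-((1 + ε) / 2))) :=
    ⟨(hcont _).aestronglyMeasurable, 1, ae_of_all _ fun x => by
      rw [abs_of_nonneg (Real.rpow_nonneg (hR x).le _)]
      exact Real.rpow_le_one_of_one_le_of_nonpos (by linarith [norm_nonneg x]) (by linarith)⟩
  have u1 : MemLp (fun x => (((‖x‖ + 1) ^ (-((1 + ε) / 2)) *
      Real.exp (Carleman.phase a k τ ‖x‖ / h) : ℝ) : ℂ) * f x) 2 volume := by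
    simpa only [Complex.real_smul] using (bw.mul bM).memLp_smul hf
  have u2 : MemLp (fun x => (((‖x‖ + 1) ^ ((1 + ε) / 2) *
      Real.exp (Carleman.phase a k τ ‖x‖ / h) : ℝ) : ℂ) * F x) 2 volume := by
    refine (bM.memLp_smul hFs).ae_eq (ae_of_all _ fun x => ?_)
    simp only [Complex.real_smul]
    push_cast
    ring
  have u3 : MemLp (fun x => ((Real.exp (Carleman.phase a k τ ‖x‖ / h) : ℝ) : ℂ) * f x) 2 volume := by
    simpa only [Complex.real_smul] using bM.memLp_smul hf
  have hexp : ∀ x : X, Real.exp (Carleman.phase a k τ ‖x‖ / h) ^ 2 =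
      Real.exp (2 * (Carleman.phase a k τ ‖x‖ / h)) := fun x => by
    rw [← Real.exp_nat_mul]; norm_num
  have hw : ∀ x : X, ((‖x‖ + 1) ^ (-((1 + ε) / 2))) ^ 2 = (‖x‖ + 1) ^ (-1 - ε) := fun x => by
    rw [← Real.rpow_natCast, ← Real.rpow_mul (hR x).le]
    congr 1
    push_cast
    ring
  have hw' : ∀ x : X, ((‖x‖ + 1) ^ ((1 + ε) / 2)) ^ 2 = ((‖x‖ + 1) ^ (-1 - ε))⁻¹ := fun x => by
    rw [← hw, Real.rpow_neg (hR x).le, inv_pow, inv_inv]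
  have e1 : ∀ x, ‖(((‖x‖ + 1) ^ (-((1 + ε) / 2)) *
      Real.exp (Carleman.phase a k τ ‖x‖ / h) : ℝ) : ℂ) * f x‖ ^ 2 =
      Real.exp (2 * (Carleman.phase a k τ ‖x‖ / h)) *
      ((‖x‖ + 1) ^ (-1 - ε) * ‖f x‖ ^ 2) := fun x => by
    rw [norm_mul, Complex.norm_real, Real.norm_eq_abs, mul_pow, sq_abs, mul_pow, hexp, hw]
    ring
  have e2 : ∀ x, ‖(((‖x‖ + 1) ^ ((1 + ε) / 2) *
      Real.exp (Carleman.phase a k τ ‖x‖ / h) : ℝ) : ℂ) * F x‖ ^ 2 =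
      Real.exp (2 * (Carleman.phase a k τ ‖x‖ / h)) *
      (((‖x‖ + 1) ^ (-1 - ε))⁻¹ * ‖F x‖ ^ 2) := fun x => by
    rw [norm_mul, Complex.norm_real, Real.norm_eq_abs, mul_pow, sq_abs, mul_pow, hexp, hw']
    ring
  have e3 : ∀ x, ‖((Real.exp (Carleman.phase a k τ ‖x‖ / h) : ℝ) : ℂ) * f x‖ ^ 2 =
      Real.exp (2 * (Carleman.phase a k τ ‖x‖ / h)) * ‖f x‖ ^ 2 := fun x => by
    rw [norm_mul, Complex.norm_real, Real.norm_eq_abs, mul_pow, sq_abs, hexp]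
  have v1 := (memLp_two_iff_integrable_sq_norm u1.1).1 u1
  have v2 := (memLp_two_iff_integrable_sq_norm u2.1).1 u2
  have v3 := (memLp_two_iff_integrable_sq_norm u3.1).1 u3
  simp only [e1] at v1
  simp only [e2] at v2
  simp only [e3] at v3
  have hA : 1 ≤ a ^ (2 * k) := Real.one_le_rpow ha (by linarith)
  have hθa' : θ * a ^ (2 * k) ≤ h := by
    have h1 : a ^ (-2 * k) * a ^ (2 * k) = 1 := by
      rw [← Real.rpow_add (by linarith)]
      simp
    calc θ * a ^ (2 * k) ≤ ε * h * a ^ (-2 * k) * a ^ (2 * k) := by gcongr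
      _ = ε * h := by rw [mul_assoc, h1, mul_one]
      _ ≤ h := mul_le_of_le_one_left hh.le hb.ε_le
  have main := hd.weighted_estimate hN hν hb hβ hV hU hUE hUr hVU hθ.le hθa' hσ hF v3 v1 v2
  have x0 : 0 ≤ ∫ x, Real.exp (2 * (Carleman.phase a k τ ‖x‖ / h)) *
      ((‖x‖ + 1) ^ (-1 - ε) * ‖f x‖ ^ 2) := by
    simp only [← e1]; exact integral_nonneg fun x => by positivity
  have y0 : 0 ≤ ∫ x, Real.exp (2 * (Carleman.phase a k τ ‖x‖ / h)) *
      (((‖x‖ + 1) ^ (-1 - ε))⁻¹ * ‖F x‖ ^ 2) := by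
    simp only [← e2]; exact integral_nonneg fun x => by positivity
  have z0 : 0 ≤ ∫ x, Real.exp (2 * (Carleman.phase a k τ ‖x‖ / h)) * ‖f x‖ ^ 2 :=
    integral_nonneg fun x => by positivity
  have hE := hb.E_pos
  have main2 := constant_bound hE hB hκ hκk hε hb.ε_le hh hb.h_lt.le hA hτ hθ.le x0 y0 z0 main
  rw [← hK] at main2
  have hK1 : 1 ≤ K := by
    have q1 : 0 ≤ 4 * (128 / κ + 192 / (E * κ)) / (E * κ) := by positivity
    have q2 : 0 ≤ 32 * (2 + E + B) / (E * κ) := by positivity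
    linarith
  rw [eLpNorm_two_eq_sqrt u1, eLpNorm_two_eq_sqrt u2, eLpNorm_two_eq_sqrt u3]
  simp only [e1, e2, e3]
  have p0 : 0 ≤ K * a ^ (2 * k) * (ε * h)⁻¹ := by positivity
  have q0 : 0 ≤ K * a ^ k * τ * (θ / (ε * h)) ^ (1 / 2 : ℝ) := by positivity
  rw [← ENNReal.ofReal_mul p0, ← ENNReal.ofReal_mul q0,
    ← ENNReal.ofReal_add (by positivity) (by positivity)]
  refine ENNReal.ofReal_le_ofReal (sqrt_le_of_le_add p0 q0 y0 z0 (main2.trans ?_))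
  -- The coefficients are squared when roots are taken; the summand 1 in K ensures that K² still
  -- dominates K.
  have hKK : K ≤ K ^ 2 := by nlinarith
  have s1 : (K * a ^ (2 * k) * (ε * h)⁻¹) ^ 2 = K ^ 2 * (a ^ (2 * k) * (ε * h)⁻¹) ^ 2 := by ring
  have s2 : (K * a ^ k * τ * (θ / (ε * h)) ^ (1 / 2 : ℝ)) ^ 2 =
      K ^ 2 * (a ^ (2 * k) * τ ^ 2 * (θ / (ε * h))) := by
    have t1 : ((θ / (ε * h)) ^ (1 / 2 : ℝ)) ^ 2 = θ / (ε * h) := by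
      rw [← Real.sqrt_eq_rpow, Real.sq_sqrt (by positivity)]
    have t2 : a ^ (2 * k) = (a ^ k) ^ 2 := by
      rw [two_mul, Real.rpow_add (by linarith), sq]
    rw [mul_pow, t1, t2]
    ring
  rw [s1, s2, mul_assoc (K ^ 2), mul_assoc (K ^ 2), ← mul_add]
  gcongr

end NormEstimate

/-! ### Assembly of the Carleman estimate. -/

theorem theorem3p1 (n : ℕ) (hn : 3 ≤ n)
    (V VL VS : EuclideanSpace ℝ (Fin n) → ℝ) (p : ℝ → ℝ) (E δ β r₀ C₁ C₂ : ℝ)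
    (hE : 0 < E) (hδ : 1 < δ) (hβ : 1 < β) (hr₀ : 0 < r₀) (hC₁ : 0 < C₁) (hC₂ : 0 < C₂)
    -- the potential is bounded and measurable, and splits into two parts
    (hV : MemLp V ∞ volume) (hsplit : ∀ x, V x = VL x + VS x)
    -- the short-range part
    (hVS_meas : AEStronglyMeasurable VS volume)
    (hVS : ∀ᵐ x, |VS x| ≤ C₁ * (‖x‖ + 1) ^ (-δ))
    -- the long-range part
    (hVL_C1 : ∀ w : EuclideanSpace ℝ (Fin n), ‖w‖ = 1 →
      ContDiffOn ℝ 1 (fun r : ℝ => VL (r • w)) (Ici r₀))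
    (hp_anti : AntitoneOn p (Ici r₀)) (hp_pos : ∀ r, r₀ ≤ r → 0 < p r)
    (hp_lim : Tendsto p atTop (𝓝 0))
    (hVL : ∀ x, r₀ ≤ ‖x‖ → VL x ≤ p ‖x‖)
    (hVL_deriv : ∀ w : EuclideanSpace ℝ (Fin n), ‖w‖ = 1 → ∀ r, r₀ ≤ r →
      derivWithin (fun r : ℝ => VL (r • w)) (Ici r₀) r ≤ C₂ * (r + 1) ^ (-β)) :
    ∃ τs > 0, ∀ τ₀ ≥ τs, ∃ ts > 1, ∀ t ≥ ts,
      ∃ h₀ : ℝ, 0 < h₀ ∧ h₀ < 1 ∧ ∃ C : ℝ, 0 < C ∧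
        ∀ h : ℝ, 0 < h → h ≤ h₀ →
        ∀ θ : ℝ, 0 < θ →
          θ ≤ Carleman.eps h * h * Carleman.aRad δ β t h ^ (-2 * Carleman.kExp δ β t h) →
        -- `σ` is the sign in `P(h) - E ± iθ`
        ∀ σ : ℝ, σ = 1 ∨ σ = -1 →
        ∀ (f : Lp ℂ 2 (volume : Measure (EuclideanSpace ℝ (Fin n)))) (hf : Carleman.MemH2 f),
          MemLp (fun x => (((‖x‖ + 1) ^ Carleman.sExp h : ℝ) : ℂ) *
            Carleman.schrodingerSub h V (E - σ * θ * Complex.I) f hf x) 2 volume →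
          eLpNorm (fun x => (((‖x‖ + 1) ^ (-Carleman.sExp h) *
              Carleman.expWeight δ β t τ₀ h x : ℝ) : ℂ) * f x) 2 volume ≤
            ENNReal.ofReal (C * Carleman.aRad δ β t h ^ (2 * Carleman.kExp δ β t h) *
                (Carleman.eps h * h)⁻¹) *
              eLpNorm (fun x => (((‖x‖ + 1) ^ Carleman.sExp h *
                Carleman.expWeight δ β t τ₀ h x : ℝ) : ℂ) *
                Carleman.schrodingerSub h V (E - σ * θ * Complex.I) f hf x) 2 volume +
            ENNReal.ofReal (C * Carleman.aRad δ β t h ^ Carleman.kExp δ β t h *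
                Carleman.tauPar τ₀ h * (θ / (Carleman.eps h * h)) ^ (1 / 2 : ℝ)) *
              eLpNorm (fun x => ((Carleman.expWeight δ β t τ₀ h x : ℝ) : ℂ) * f x) 2 volume := by
  obtain ⟨N, rfl⟩ : ∃ N, n = N + 3 := ⟨n - 3, by omega⟩
  have hN : Module.finrank ℝ (EuclideanSpace ℝ (Fin (N + 3))) = N + 3 := finrank_euclideanSpace_fin
  obtain ⟨U, C, S, hC, hS, hU, hUE, hUr, hVU⟩ := exists_longRange_modification hE
    (zero_lt_one.trans hδ) (zero_lt_one.trans hβ) hr₀ hC₁ hC₂ hV hsplit hVS_meas hVS hVL_C1 hp_lim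
    hVL hVL_deriv
  obtain ⟨B, hB0, hB⟩ := exists_ae_norm_le hV
  -- κ bounds k from below for all small h, so the final constant can be fixed before h.
  obtain ⟨κ, hκ, τs, hτs, hpar⟩ := eventually_weightBounds hE hC hS hδ hβ
  refine ⟨τs, zero_lt_one.trans_le hτs, fun τ₀ hτ₀ => ?_⟩
  obtain ⟨ts, hts, hpar⟩ := hpar τ₀ hτ₀
  refine ⟨ts, hts, fun t ht => ?_⟩
  obtain ⟨u, hu, hpar⟩ := mem_nhdsGT_iff_exists_Ioo_subset.1 (hpar t ht)
  have hu0 : (0 : ℝ) < u := hu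
  -- The good values of h fill the open interval (0, u), while h = h₀ is allowed, hence u/2; the
  -- bound 1/2 keeps h₀ below 1.
  refine ⟨min (u / 2) (1 / 2), by positivity, (min_le_right _ _).trans_lt (by norm_num),
    1 + 4 * (128 / κ + 192 / (E * κ)) / (E * κ) + 32 * (2 + E + B) / (E * κ), by positivity, fun h h0 hle θ hθ hθa σ hσ f hf hF => ?_⟩
  obtain ⟨hκk, hb⟩ := hpar ⟨h0, (hle.trans (min_le_left _ _)).trans_lt (by linarith)⟩
  obtain ⟨d, hd⟩ := exists_hasRadialDeriv hN (ν := N + 2) rfl hf (Carleman.laplacianH2_spec f hf)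
  exact hd.weighted_norm_estimate hN rfl hb (zero_lt_one.trans hβ) hκ hκk hB0 hB hU hUE hUr hVU hθ
    hθa hσ (fun x => rfl) (Lp.memLp f) hF rfl
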